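/- Let $s=(s_+,s_-)\in\mathbb R^2\setminus\{0\}$ and $\varphi(x)=s_+\max(x,0)+s_-\min(x,0)$. Let $g,w$ be independent $\mathcal N(0,1)$ variables. For $\rho\in[-1,1]$ put $q=\sqrt{1-\rho^2}$, $\hat g=\rho g+qw$, and $$c=\big(\mathbb E\,\varphi(g)^2\big)^{-1},\quad M_2=\mathrm{Var}\big(c\,\varphi(g)^2\big),\quad K_{p,r}(\rho)=\mathbb E\,\varphi(g)^p\varphi(\hat g)^r,\quad K_p=K_{p,p}.$$ Set $$\mu_{\mathrm{ReLU}}=\tfrac c4\big[K_1(c^2K_2+3M_2+3)-4cK_{3,1}\big],\qquad \sigma^2_{\mathrm{ReLU}}=\tfrac{c^2}2\big[K_1^2(c^2K_2+M_2+1)-4cK_1K_{3,1}+2K_2\big].$$ (i) (Explicit formulas.) $c=\frac{2}{s_+^2+s_-^2}$, $\mathbb E\varphi(g)^4=\frac32(s_+^4+s_-^4)$, $M_2=c^2\,\mathbb E\varphi(g)^4-1$. Let $\bar J_{p,r}(\rho)$ denote $K_{p,r}(\rho)$ for $s=(1,0)$ (the usual ReLU) and $\bar J_p=\bar J_{p,p}$.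 Then, for all $\rho\in[-1,1]$, $$\bar J_1(\rho)=\tfrac{q+\rho\arccos(-\rho)}{2\pi},\quad \bar J_2(\rho)=\tfrac{3\rho q+(1+2\rho^2)\arccos(-\rho)}{2\pi},\quad \bar J_{3,1}(\rho)=\tfrac{q(2+\rho^2)+3\rho\arccos(-\rho)}{2\pi},$$ $$K_1(\rho)=(s_+^2+s_-^2)\bar J_1(\rho)-2s_+s_-\bar J_1(-\rho),\qquad K_2(\rho)=(s_+^4+s_-^4)\bar J_2(\rho)+2s_+^2s_-^2\bar J_2(-\rho),$$ $$K_{3,1}(\rho)=(s_+^4+s_-^4)\bar J_{3,1}(\rho)-s_+s_-(s_+^2+s_-^2)\bar J_{3,1}(-\rho),\qquad \sigma^2_{\mathrm{ReLU}}(\rho)\ge 0 .$$ (ii) (The chains and their kernels.) For a width $n\ge1$ and inputs $x^1,\dots,x^m\in\mathbb R^{n_{\rm in}}$ consider the network $$z_1^\alpha=\tfrac1{\sqrt{n_{\rm in}}}W_0x^\alpha,\qquad \varphi_\ell^\alpha=\varphi(z_\ell^\alpha)\ \text{(entrywise)},\qquad z_{\ell+1}^\alpha=\sqrt{\tfrac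 cn}\,W_\ell\varphi_\ell^\alpha\qquad(\ell\ge1),$$ where $W_0\in\mathbb R^{n\times n_{\rm in}}$ and $W_\ell\in\mathbb R^{n\times n}$ ($\ell\ge 1$) have iid $\mathcal N(0,1)$ entries. Let $\mathbf e$ be an extra point with $|x-\mathbf e|=\infty$ for $x\in\mathbb R$. Let $\rho_\ell^{\alpha\beta}=\frac{\langle\varphi_\ell^\alpha,\varphi_\ell^\beta\rangle}{|\varphi_\ell^\alpha||\varphi_\ell^\beta|}$ if both norms are positive, and $\rho_\ell^{\alpha\beta}=\mathbf e$ otherwise. Let $\Pi$ be the kernel on $\mathbb R\cup\{\mathbf e\}$ for which $\Pi(\mathbf e,\cdot)=\delta_{\mathbf e}$ and, for $x\in[-1,1]$, $\Pi(x,\cdot)$ is the law of the correlation (with value $\mathbf e$ if one of the vectors vanishes) of the vectors $\varphi(G)$ and $\varphi(xG+\sqrt{1-x^2}\,H)$, where $G,H$ are independent standard Gaussian vectors in $\mathbb R^n$. Then $(\rho_\ell^{\alpha\beta})_{\ell\ge1}$ is a Markov chain with transition kernel $\Pi$, with respect to the filtration generated by the layers $(z_\ell^\gamma)_{\gamma\le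 m}$. Define the approximate chain by $$p_{\ell+1}=cK_1(p_\ell)+\frac{\mu_{\mathrm{ReLU}}(p_\ell)}n+\sigma_{\mathrm{ReLU}}(p_\ell)\frac{z_\ell}{\sqrt n},\qquad z_\ell\ \text{iid }\mathcal N(0,1)\text{, independent of }p_0,$$ with $\mathbf e$ absorbing, and let $P$ be its one-step kernel: $P(\mathbf e,\cdot)=\delta_{\mathbf e}$, and $P(x,\cdot)$ is the law of the right-hand side for $p_\ell=x$. (For $p_\ell\notin[-1,1]$ the coefficients are continued by the same formulas, with the convention $\sqrt t=0$ for $t<0$; this continuation does not matter in (iii).) Then $(p_\ell)$ is a Markov chain with transition kernel $P$. (iii) (Approximation.) For a function $h$ on $\mathbb R\cup\{\mathbf e\}$ put $\|h\|_{BL}=\|h\|_\infty+\sup_{x\ne y}\frac{|h(x)-h(y)|}{|x-y|}$, and let $d_{BL}(\mu,\nu)=\sup_{\|h\|_{BL}\le1}\big(\int h\,d\mu-\int h\,d\nu\big)$. There is a constant $C$, depending only on $s_+$ and $s_-$, such that for every $n\ge1$ and every $x\in[-1,1]\cup\{\mathbf e\}$ $$d_{BL}\big(\Pi(x,\cdot),P(x,\cdot)\big)\le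 \frac Cn .$$ -/

import Mathlib

open MeasureTheory ProbabilityTheory Set
open scoped ENNReal Matrix

namespace ReLUNet

noncomputable section

/-! ## ReLU-like activations and Gaussian moments

Throughout, `sp` and `sm` are the slopes of the activation on the positive and on the negative
half-line. -/

/-- The ReLU-like activation `s₊ max(x, 0) + s₋ min(x, 0)`. -/
def act (sp sm x : ℝ) : ℝ := sp * max x 0 + sm * min x 0

/-- The standard Gaussian measure on `ℝ`. -/
abbrev stdGauss : Measure ℝ := gaussianReal 0 1

/-- The normalizing constant `c = (𝔼 φ(g)²)⁻¹`. -/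
def normConst (sp sm : ℝ) : ℝ := (∫ g, act sp sm g ^ 2 ∂stdGauss)⁻¹

/-- `M₂ = Var(c φ(g)²)`, for a standard Gaussian `g`. -/
def M2 (sp sm : ℝ) : ℝ := Var[fun g => normConst sp sm * act sp sm g ^ 2; stdGauss]

/-- `K_{p,r}(ρ) = 𝔼 φ(g)^p φ(ρ g + √(1 - ρ²) w)^r`, with `g`, `w` independent standard Gaussians.
It is only meaningful for `ρ ∈ [-1, 1]`. -/
def K (sp sm : ℝ) (p r : ℕ) (ρ : ℝ) : ℝ :=
  ∫ y : ℝ × ℝ, act sp sm y.1 ^ p * act sp sm (ρ * y.1 + √(1 - ρ ^ 2) * y.2) ^ r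
    ∂(stdGauss.prod stdGauss)

/-- The arccos-kernel moments: the moments `K_{p,r}` of the usual ReLU. -/
def J (p r : ℕ) (ρ : ℝ) : ℝ := K 1 0 p r ρ

/-- The drift coefficient of the approximate chain. -/
def muReLU (sp sm ρ : ℝ) : ℝ :=
  normConst sp sm / 4 *
    (K sp sm 1 1 ρ * (normConst sp sm ^ 2 * K sp sm 2 2 ρ + 3 * M2 sp sm + 3)
      - 4 * normConst sp sm * K sp sm 3 1 ρ)

/-- The square of the diffusion coefficient of the approximate chain. -/
def sigmaSqReLU (sp sm ρ : ℝ) : ℝ :=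
  normConst sp sm ^ 2 / 2 *
    (K sp sm 1 1 ρ ^ 2 * (normConst sp sm ^ 2 * K sp sm 2 2 ρ + M2 sp sm + 1)
      - 4 * normConst sp sm * K sp sm 1 1 ρ * K sp sm 3 1 ρ + 2 * K sp sm 2 2 ρ)

/-- The diffusion coefficient of the approximate chain. -/
def sigmaReLU (sp sm ρ : ℝ) : ℝ := √(sigmaSqReLU sp sm ρ)

/-! ## The state space `ℝ ∪ {e}` and the bounded-Lipschitz distance -/

/-- The state space `ℝ ∪ {e}`: `Sum.inl x` is the real number `x`, `Sum.inr ()` is the extra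
point `e`. The measurable structure is that of the disjoint union. -/
abbrev CorrState : Type := ℝ ⊕ Unit

/-- The set `[-1, 1] ∪ {e}` of all possible values of a correlation. -/
def corrValues : Set CorrState := insert (Sum.inr ()) (Sum.inl '' Icc (-1 : ℝ) 1)

/-- The distance on `ℝ ∪ {e}`: the usual one on `ℝ`, and `|x - e| = ∞`. -/
def stateEDist : CorrState → CorrState → ℝ≥0∞
  | Sum.inl x, Sum.inl y => edist x y
  | Sum.inr _, Sum.inr _ => 0
  | _, _ => ⊤

/-- The norm `‖h‖_BL = ‖h‖_∞ + sup_{x ≠ y} |h(x) - h(y)| / |x - y|`. -/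
def blNorm (h : CorrState → ℝ) : ℝ≥0∞ :=
  (⨆ x, ‖h x‖ₑ) + ⨆ (x) (y) (_ : x ≠ y), ‖h x - h y‖ₑ / stateEDist x y

/-- The bounded-Lipschitz distance `sup_{‖h‖_BL ≤ 1} (∫ h dμ - ∫ h dν)`. -/
def dBL (μ ν : Measure CorrState) : ℝ≥0∞ :=
  ⨆ (h : CorrState → ℝ) (_ : blNorm h ≤ 1), ENNReal.ofReal (∫ x, h x ∂μ - ∫ x, h x ∂ν)

/-! ## The correlation of two vectors, and the network -/

/-- `⟨u, v⟩ / (|u| |v|)` if `u, v ≠ 0`, and `e` otherwise. -/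
def corr {n : ℕ} (u v : Fin n → ℝ) : CorrState :=
  if u = 0 ∨ v = 0 then Sum.inr () else Sum.inl ((u ⬝ᵥ v) / (√(u ⬝ᵥ u) * √(v ⬝ᵥ v)))

/-- The pre-activations `z_{k+1}` (index `k` is hidden layer `k + 1`) of the network with first
weight matrix `W₀` and later weight matrices `W 0, W 1, …`, on the input `x`. -/
def preAct (sp sm : ℝ) {nin n : ℕ} (W₀ : Matrix (Fin n) (Fin nin) ℝ)
    (W : ℕ → Matrix (Fin n) (Fin n) ℝ) (x : Fin nin → ℝ) : ℕ → Fin n → ℝ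
  | 0 => (1 / √(nin : ℝ)) • (W₀ *ᵥ x)
  | k + 1 => √(normConst sp sm / n) • (W k *ᵥ fun i => act sp sm (preAct sp sm W₀ W x k i))

/-- The index set of all the weights: those of `W₀`, and those of the later matrices. -/
abbrev WeightIdx (nin n : ℕ) : Type := (Fin n × Fin nin) ⊕ (ℕ × Fin n × Fin n)

/-- The pre-activations of the network with random weights `w`. -/
def netPre (sp sm : ℝ) {Ω : Type*} {nin n : ℕ} (w : WeightIdx nin n → Ω → ℝ) (x : Fin nin → ℝ)
    (k : ℕ) (ω : Ω) : Fin n → ℝ :=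
  preAct sp sm (Matrix.of fun i j => w (Sum.inl (i, j)) ω)
    (fun l => Matrix.of fun i j => w (Sum.inr (l, i, j)) ω) x k

/-- The correlation of the post-activations in hidden layer `k + 1` for the inputs `x`, `x'`. -/
def netCorr (sp sm : ℝ) {Ω : Type*} {nin n : ℕ} (w : WeightIdx nin n → Ω → ℝ)
    (x x' : Fin nin → ℝ) (k : ℕ) (ω : Ω) : CorrState :=
  corr (fun i => act sp sm (netPre sp sm w x k ω i)) (fun i => act sp sm (netPre sp sm w x' k ω i))

/-- A family of independent standard Gaussian random variables. -/
def IsStdGaussianFamily {Ω ι : Type*} [MeasurableSpace Ω] (μ : Measure Ω) (w : ι → Ω → ℝ) : Prop :=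
  (∀ i, Measurable (w i)) ∧ (∀ i, μ.map (w i) = stdGauss) ∧ iIndepFun w μ

/-! ## Markov chains -/

/-- The σ-algebra generated by `Y 0, …, Y k`. -/
abbrev history {Ω E : Type*} [MeasurableSpace E] (Y : ℕ → Ω → E) (k : ℕ) : MeasurableSpace Ω :=
  ⨆ j ∈ Iic k, MeasurableSpace.comap (Y j) inferInstance

/-- `X` is, with respect to the σ-algebras `ℱ 0, ℱ 1, …`, a Markov chain with transition
kernel `κ`. -/
def IsMarkovChain {Ω S : Type*} [MeasurableSpace Ω] [MeasurableSpace S] (μ : Measure Ω)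
    (ℱ : ℕ → MeasurableSpace Ω) (X : ℕ → Ω → S) (κ : Kernel S S) : Prop :=
  IsMarkovKernel κ ∧ (∀ k, Measurable[ℱ k] (X k)) ∧
    ∀ (k : ℕ) (A : Set S), MeasurableSet A →
      μ[(X (k + 1) ⁻¹' A).indicator (fun _ => (1 : ℝ)) | ℱ k] =ᵐ[μ] fun ω => (κ (X k ω)).real A

/-! ## The two transition kernels -/

/-- The standard Gaussian measure on `ℝⁿ`. -/
abbrev stdGaussVec (n : ℕ) : Measure (Fin n → ℝ) := Measure.pi fun _ => stdGauss

/-- One step of the correlation chain from the correlation `x ∈ [-1, 1]`, where `y.1`, `y.2` are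
independent standard Gaussian vectors: the two normalized pre-activation vectors are `y.1` and
`x y.1 + √(1 - x²) y.2`. -/
def corrStep (sp sm : ℝ) (n : ℕ) (x : ℝ) (y : (Fin n → ℝ) × (Fin n → ℝ)) : CorrState :=
  corr (fun i => act sp sm (y.1 i)) (fun i => act sp sm (x * y.1 i + √(1 - x ^ 2) * y.2 i))

/-- One step of the approximate chain from `x ∈ ℝ`, driven by the noise `z`. -/
def approxStepReal (sp sm : ℝ) (n : ℕ) (x z : ℝ) : ℝ :=
  normConst sp sm * K sp sm 1 1 x + muReLU sp sm x / n + sigmaReLU sp sm x * (z / √(n : ℝ))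

/-- One step of the approximate chain on `ℝ ∪ {e}`, where `e` is absorbing. -/
def approxStep (sp sm : ℝ) (n : ℕ) : CorrState → ℝ → CorrState
  | Sum.inl x, z => Sum.inl (approxStepReal sp sm n x z)
  | Sum.inr _, _ => Sum.inr ()

/-- The approximate chain `p` started from `p₀` and driven by the noises `z 0, z 1, …`. -/
def approxChain (sp sm : ℝ) (n : ℕ) {Ω : Type*} (p₀ : Ω → CorrState) (z : ℕ → Ω → ℝ) :
    ℕ → Ω → CorrState
  | 0, ω => p₀ ω
  | k + 1, ω => approxStep sp sm n (approxChain sp sm n p₀ z k ω) (z k ω)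

lemma measurable_act (sp sm : ℝ) : Measurable (act sp sm) := by
  unfold act; fun_prop

lemma measurable_K (sp sm : ℝ) (p r : ℕ) : Measurable (K sp sm p r) := by
  have h := measurable_act sp sm
  have : Measurable (fun q : ℝ × (ℝ × ℝ) =>
      act sp sm q.2.1 ^ p * act sp sm (q.1 * q.2.1 + √(1 - q.1 ^ 2) * q.2.2) ^ r) := by
    fun_prop
  exact (this.stronglyMeasurable.integral_prod_right' (ν := stdGauss.prod stdGauss)).measurable

lemma measurable_approxStepReal (sp sm : ℝ) (n : ℕ) :
    Measurable (Function.uncurry (approxStepReal sp sm n)) := by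
  have h11 := measurable_K sp sm 1 1
  have h22 := measurable_K sp sm 2 2
  have h31 := measurable_K sp sm 3 1
  unfold approxStepReal sigmaReLU sigmaSqReLU muReLU Function.uncurry
  fun_prop

lemma measurable_corr {n : ℕ} :
    Measurable (fun q : (Fin n → ℝ) × (Fin n → ℝ) => corr q.1 q.2) := by
  unfold corr dotProduct
  refine Measurable.ite ?_ measurable_const (measurable_inl.comp (by fun_prop))
  exact (measurable_fst (measurableSet_singleton 0)).union
    (measurable_snd (measurableSet_singleton 0))

lemma measurable_corrStep (sp sm : ℝ) (n : ℕ) :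
    Measurable (Function.uncurry (corrStep sp sm n)) := by
  have h := measurable_act sp sm
  unfold corrStep Function.uncurry
  exact measurable_corr.comp (f := fun q : ℝ × ((Fin n → ℝ) × (Fin n → ℝ)) =>
    ((fun i => act sp sm (q.2.1 i)),
      (fun i => act sp sm (q.1 * q.2.1 i + √(1 - q.1 ^ 2) * q.2.2 i)))) (by fun_prop)

lemma measurable_map_param {α β S : Type*} [MeasurableSpace α] [MeasurableSpace β]
    [MeasurableSpace S] (γ : Measure β) [SFinite γ] {f : α → β → S}
    (hf : Measurable (Function.uncurry f)) : Measurable fun x => γ.map (f x) := by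
  have h : (fun x => γ.map (f x)) = fun x => (γ.map (Prod.mk x)).map (Function.uncurry f) := by
    funext x
    rw [Measure.map_map hf measurable_prodMk_left]
    rfl
  rw [h]
  exact (Measure.measurable_map _ hf).comp Measurable.map_prodMk_left

/-- The kernel `Π`, the transition kernel of the correlation chain of a network of width `n`. The
point `e` is absorbing. -/
def corrKernel (sp sm : ℝ) (n : ℕ) : Kernel CorrState CorrState where
  toFun := Sum.elim
    (fun x => ((stdGaussVec n).prod (stdGaussVec n)).map (corrStep sp sm n x))
    (fun _ => Measure.dirac (Sum.inr ()))
  measurable' := (measurable_map_param _ (measurable_corrStep sp sm n)).sumElim measurable_const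

/-- The kernel `P`, the transition kernel of the approximate chain. -/
def approxKernel (sp sm : ℝ) (n : ℕ) : Kernel CorrState CorrState where
  toFun := Sum.elim
    (fun x => stdGauss.map fun z => (Sum.inl (approxStepReal sp sm n x z) : CorrState))
    (fun _ => Measure.dirac (Sum.inr ()))
  measurable' := (measurable_map_param stdGauss
    (f := fun x z => (Sum.inl (approxStepReal sp sm n x z) : CorrState))
    (measurable_inl.comp (measurable_approxStepReal sp sm n))).sumElim measurable_const

end

end ReLUNet

open ReLUNet

namespace ReLUNet

/-! ## Linear images of standard Gaussian vectors -/

/-! Everything rests on the positive homogeneity of `φ` and on the rotation invariance of Gaussian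
vectors.

Moments. For `p + r` even, the integrand of `K_{p,r}` is homogeneous of even degree, so polar
coordinates split it into a Gamma integral and a trigonometric integral (`integral_homogeneous`).
For the usual ReLU the latter lives on the arc where two cosines at angular distance `arccos ρ` are
both positive (`J_eq_integral`). A general `φ` is split into its two half-lines, and sign flips of
the Gaussians reduce the four resulting terms to `ρ` and `-ρ` (`K_eq_J`).

Chains. The noise of each step is independent of the past, so the conditional law is obtained by
freezing the past and integrating out the noise (`condExp_indicator_of_indep`). A Gaussian matrix
sends two unit vectors of scalar product `ρ` to two Gaussian vectors of correlation `ρ`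
(`map_mulVec_pair`). Correlations ignore positive factors and `φ` commutes with them, so the next
correlation depends on the present layer only through its correlation (`map_corr_layer`).

Comparison. With `A`, `B`, `D` the empirical means over the neurons of `cφ(g)φ(ĝ)`, `cφ(g)²`,
`cφ(ĝ)²`, the correlation is `A / √(B D)`, and the means of `A`, `B`, `D` are `a = cK₁`, `1`, `1`. A
first-order expansion gives `a + (A - a/2 (B + D))`, with an error quadratic in the deviations,
hence of expectation `O(1/n)` (`abs_corr_sub_linearization_le`). The correction is a mean of `n` iid
centred variables `Y` (`corrLin`) of variance `σ²_ReLU`, to which a Wasserstein Berry–Esseen bound,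
proved by Stein's method, applies (`abs_integral_mean_sub_le`). After rescaling, its leading error
is `E|Y|³ / (σ² n)`.

This must be uniform in `ρ` although `σ` may vanish. Since `Y` is the squared radius times a
function of the angle, `|Y| ≤ C r²` and `E r²Y² = 6 E Y²`, whence `E|Y|³ ≤ 6Cσ²`
(`integral_abs_corrLin_pow_three_le`). The drift is bounded, so `μ/n` is itself `O(1/n)` and only
its boundedness enters the comparison. -/

lemma charFunDual_stdGauss (L : StrongDual ℝ ℝ) :
    charFunDual stdGauss L = Complex.exp (-(((L 1) ^ 2 : ℝ) : ℂ) / 2) := by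
  rw [charFunDual_apply]
  have h : ∀ x : ℝ, L x = L 1 * x := fun x => by
    have := L.map_smul x 1
    rw [smul_eq_mul, mul_one, smul_eq_mul, mul_comm] at this
    exact this
  generalize L 1 = a at h ⊢
  simp_rw [h, Complex.ofReal_mul]
  rw [← charFun_apply_real, charFun_gaussianReal]
  simp [neg_div]

lemma charFunDual_pi_stdGauss {ι : Type*} [Fintype ι] [DecidableEq ι]
    (L : StrongDual ℝ (ι → ℝ)) :
    charFunDual (Measure.pi fun _ : ι => stdGauss) L =
      Complex.exp (-((∑ i, L (Pi.single i 1) ^ 2 : ℝ) : ℂ) / 2) := by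
  rw [charFunDual_pi]
  simp_rw [charFunDual_stdGauss]
  rw [← Complex.exp_sum]
  congr 1
  push_cast
  rw [neg_div, Finset.sum_div, ← Finset.sum_neg_distrib]
  refine Finset.sum_congr rfl fun i _ => ?_
  simp [neg_div]

/-- The map has orthonormal rows, so its transpose preserves `u² + v²`, and the characteristic
function of the Gaussian depends on a functional only through that quantity. -/
lemma map_prod_stdGauss {a b c d : ℝ} (h1 : a ^ 2 + b ^ 2 = 1) (h2 : c ^ 2 + d ^ 2 = 1)
    (h3 : a * c + b * d = 0) :
    (stdGauss.prod stdGauss).map (fun y : ℝ × ℝ => (a * y.1 + b * y.2, c * y.1 + d * y.2)) =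
      stdGauss.prod stdGauss := by
  set T : ℝ × ℝ →L[ℝ] ℝ × ℝ :=
    (a • ContinuousLinearMap.fst ℝ ℝ ℝ + b • ContinuousLinearMap.snd ℝ ℝ ℝ).prod
      (c • ContinuousLinearMap.fst ℝ ℝ ℝ + d • ContinuousLinearMap.snd ℝ ℝ ℝ) with hT
  have hfun : (fun y : ℝ × ℝ => (a * y.1 + b * y.2, c * y.1 + d * y.2)) = T := by
    funext y; simp [hT]
  rw [hfun]
  have : IsProbabilityMeasure ((stdGauss.prod stdGauss).map T) :=
    Measure.isProbabilityMeasure_map (by fun_prop)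
  refine Measure.ext_of_charFunDual ?_
  ext L
  rw [charFunDual_map, charFunDual_prod, charFunDual_prod]
  simp only [charFunDual_stdGauss]
  rw [← Complex.exp_add, ← Complex.exp_add]
  congr 1
  have hL : ∀ x y : ℝ, L (x, y) = x * L (1, 0) + y * L (0, 1) := fun x y => by
    have : ((x, y) : ℝ × ℝ) = x • (1, 0) + y • (0, 1) := by simp
    rw [this, map_add, map_smul, map_smul]; rfl
  simp only [ContinuousLinearMap.comp_apply, ContinuousLinearMap.inl_apply,
    ContinuousLinearMap.inr_apply]
  have e1 : T (1, 0) = (a, c) := by simp [hT]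
  have e2 : T (0, 1) = (b, d) := by simp [hT]
  rw [e1, e2, hL a c, hL b d]
  set u := L (1, 0)
  set v := L (0, 1)
  have : (a * u + c * v) ^ 2 + (b * u + d * v) ^ 2 = u ^ 2 + v ^ 2 := by
    linear_combination u ^ 2 * h1 + v ^ 2 * h2 + 2 * u * v * h3
  have h' := congrArg (fun x : ℝ => -(x : ℂ) / 2) this
  push_cast at h' ⊢
  linear_combination h'

/-- A standard Gaussian matrix applied to two unit vectors of scalar product `ρ` gives two
standard Gaussian vectors of correlation `ρ`. -/
lemma map_mulVec_pair {n : ℕ} (u v : Fin n → ℝ) (hu : u ⬝ᵥ u = 1) (hv : v ⬝ᵥ v = 1) :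
    (Measure.pi fun _ : Fin n × Fin n => stdGauss).map
        (fun W => ((fun i => ∑ j, W (i, j) * u j), (fun i => ∑ j, W (i, j) * v j))) =
      ((stdGaussVec n).prod (stdGaussVec n)).map
        (fun y => (y.1, fun i => (u ⬝ᵥ v) * y.1 i + √(1 - (u ⬝ᵥ v) ^ 2) * y.2 i)) := by
  set ρ := u ⬝ᵥ v with hρ
  have hρ1 : ρ ^ 2 ≤ 1 := by
    have := Finset.sum_mul_sq_le_sq_mul_sq Finset.univ u v
    simp only [dotProduct] at hu hv hρ
    rw [hρ]
    calc _ ≤ _ := this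
      _ = 1 := by
        rw [show ∑ i, u i ^ 2 = 1 by simpa [sq] using hu,
          show ∑ i, v i ^ 2 = 1 by simpa [sq] using hv, one_mul]
  have hq : √(1 - ρ ^ 2) ^ 2 = 1 - ρ ^ 2 := Real.sq_sqrt (by linarith)
  set q := √(1 - ρ ^ 2) with hqdef
  set S : (Fin n × Fin n → ℝ) →L[ℝ] (Fin n → ℝ) × (Fin n → ℝ) :=
    (ContinuousLinearMap.pi fun i => ∑ j, u j • ContinuousLinearMap.proj (R := ℝ)
        (φ := fun _ : Fin n × Fin n => ℝ) (i, j)).prod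
      (ContinuousLinearMap.pi fun i => ∑ j, v j • ContinuousLinearMap.proj (R := ℝ)
        (φ := fun _ : Fin n × Fin n => ℝ) (i, j)) with hS
  set T : (Fin n → ℝ) × (Fin n → ℝ) →L[ℝ] (Fin n → ℝ) × (Fin n → ℝ) :=
    (ContinuousLinearMap.fst ℝ _ _).prod
      (ρ • ContinuousLinearMap.fst ℝ _ _ + q • ContinuousLinearMap.snd ℝ _ _) with hT
  have hSf : (fun W : Fin n × Fin n → ℝ =>
      ((fun i => ∑ j, W (i, j) * u j), (fun i => ∑ j, W (i, j) * v j))) = S := by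
    funext W
    refine Prod.ext ?_ ?_ <;> funext i <;> simp [hS, mul_comm]
  have hTf : (fun y : (Fin n → ℝ) × (Fin n → ℝ) =>
      (y.1, fun i => ρ * y.1 i + q * y.2 i)) = T := by
    funext y
    refine Prod.ext ?_ ?_
    · simp [hT]
    · funext i; simp [hT]
  rw [hSf, hTf]
  have : IsProbabilityMeasure ((Measure.pi fun _ : Fin n × Fin n => stdGauss).map S) :=
    Measure.isProbabilityMeasure_map (by fun_prop)
  have : IsProbabilityMeasure (((stdGaussVec n).prod (stdGaussVec n)).map T) :=
    Measure.isProbabilityMeasure_map (by fun_prop)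
  refine Measure.ext_of_charFunDual ?_
  ext L
  rw [charFunDual_map, charFunDual_map, charFunDual_prod, charFunDual_pi_stdGauss,
    charFunDual_pi_stdGauss, charFunDual_pi_stdGauss, ← Complex.exp_add]
  congr 1
  set a : Fin n → ℝ := fun i => L (Pi.single i 1, 0) with ha
  set b : Fin n → ℝ := fun i => L (0, Pi.single i 1) with hb
  have hL : ∀ i (x y : ℝ), L (Pi.single i x, Pi.single i y) = x * a i + y * b i := by
    intro i x y
    have : ((Pi.single i x, Pi.single i y) : (Fin n → ℝ) × (Fin n → ℝ)) =
        x • (Pi.single i 1, 0) + y • (0, Pi.single i 1) := by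
      refine Prod.ext ?_ ?_ <;> ext j <;> simp [Pi.single_apply]
    rw [this, map_add, map_smul, map_smul]; rfl
  have eS : ∀ i j, S (Pi.single (i, j) 1) = (Pi.single i (u j), Pi.single i (v j)) := by
    intro i j
    rw [← hSf]
    refine Prod.ext ?_ ?_ <;> ext k <;>
      by_cases hk : k = i <;> simp [Pi.single_apply, hk]
  have eT1 : ∀ i, T (Pi.single i 1, 0) = (Pi.single i 1, Pi.single i ρ) := by
    intro i
    rw [← hTf]
    refine Prod.ext rfl ?_
    ext k; by_cases hk : k = i <;> simp [hk]
  have eT2 : ∀ i, T (0, Pi.single i 1) = (Pi.single i 0, Pi.single i q) := by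
    intro i
    rw [← hTf]
    refine Prod.ext (by simp) ?_
    ext k; by_cases hk : k = i <;> simp [hk]
  simp only [ContinuousLinearMap.comp_apply, ContinuousLinearMap.inl_apply,
    ContinuousLinearMap.inr_apply, eT1, eT2, hL]
  -- Row `i` of the matrix contributes `|a i • u + b i • v|²`, which is `(a i)² + 2ρ (a i)(b i) + (b
  -- i)²` for unit vectors. Completing the square in `a i` produces exactly the coefficients of `T`.
  have key : ∑ p : Fin n × Fin n, (L (S (Pi.single p 1))) ^ 2 =
      ∑ i, (1 * a i + ρ * b i) ^ 2 + ∑ i, (0 * a i + q * b i) ^ 2 := by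
    rw [Fintype.sum_prod_type, ← Finset.sum_add_distrib]
    refine Finset.sum_congr rfl fun i _ => ?_
    simp only [eS, hL]
    have : ∀ j, (u j * a i + v j * b i) ^ 2 =
        a i ^ 2 * (u j * u j) + b i ^ 2 * (v j * v j) + 2 * a i * b i * (u j * v j) :=
      fun j => by ring
    simp only [this, Finset.sum_add_distrib, ← Finset.mul_sum]
    simp only [dotProduct] at hu hv hρ
    rw [hu, hv, ← hρ]
    linear_combination -(b i ^ 2) * hq
  rw [key]
  push_cast
  ring

/-! ## Markov chains driven by independent noise -/

/-- Freezing lemma. To test the candidate on `s ∈ m`, the pair (indicator of `s`, `X`) is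
`m`-measurable and so independent of `Y`; Tonelli for the product law then gives the identity. -/
lemma condExp_indicator_of_indep {Ω E F S : Type*} {m m0 : MeasurableSpace Ω} [MeasurableSpace E]
    [MeasurableSpace F] [MeasurableSpace S] {μ : Measure Ω} [IsProbabilityMeasure μ]
    (hm : m ≤ m0) {X : Ω → E} {Y : Ω → F} (hX : Measurable[m] X)
    (hY : Measurable Y) (hind : Indep m (MeasurableSpace.comap Y inferInstance) μ)
    {f : E → F → S} (hf : Measurable (Function.uncurry f)) {A : Set S} (hA : MeasurableSet A) :
    μ[((fun ω => f (X ω) (Y ω)) ⁻¹' A).indicator (fun _ => (1 : ℝ)) | m] =ᵐ[μ]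
      fun ω => ((μ.map Y).map (f (X ω))).real A := by
  have hX0 : Measurable X := hX.mono hm le_rfl
  have hYp : IsProbabilityMeasure (μ.map Y) := Measure.isProbabilityMeasure_map hY.aemeasurable
  have hker : Measurable fun x => (μ.map Y).map (f x) A :=
    (Measure.measurable_coe hA).comp (measurable_map_param (μ.map Y) hf)
  have hfx : ∀ x, Measurable (f x) := fun x => hf.comp measurable_prodMk_left
  have hmeasA : MeasurableSet ((fun ω => f (X ω) (Y ω)) ⁻¹' A) :=
    (hf.comp (hX0.prodMk hY)) hA
  have hreal : Measurable fun x => ((μ.map Y).map (f x)).real A := hker.ennreal_toReal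
  have hbound : ∀ x, ((μ.map Y).map (f x)) A ≤ 1 := fun x => by
    have := Measure.isProbabilityMeasure_map (μ := μ.map Y) (hfx x).aemeasurable
    exact prob_le_one
  have hgint : Integrable (fun ω => ((μ.map Y).map (f (X ω))).real A) μ := by
    refine Integrable.of_bound (hreal.comp hX0).aestronglyMeasurable 1 (ae_of_all _ fun ω => ?_)
    rw [Real.norm_of_nonneg measureReal_nonneg]
    exact ENNReal.toReal_le_of_le_ofReal zero_le_one (by simpa using hbound (X ω))
  refine (ae_eq_condExp_of_forall_setIntegral_eq hm ?_ (fun s _ _ => hgint.integrableOn) ?_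
    (hreal.comp hX).stronglyMeasurable.aestronglyMeasurable).symm
  · exact (integrable_const 1).indicator hmeasA
  intro s hs _
  have hs0 := hm s hs
  rw [setIntegral_indicator hmeasA, setIntegral_const, smul_eq_mul, mul_one]
  simp only [Measure.real]
  rw [integral_toReal (f := fun ω => ((μ.map Y).map (f (X ω))) A) (hker.comp hX0).aemeasurable
    (ae_of_all _ fun ω => (hbound _).trans_lt ENNReal.one_lt_top)]
  congr 1
  -- the joint law of the past and of the noise is a product
  have hXs : Measurable[m] fun ω => (s.indicator (fun _ => (1 : ℝ≥0∞)) ω, X ω) :=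
    (measurable_const.indicator hs).prodMk hX
  set T : Ω → ℝ≥0∞ × E := fun ω => (s.indicator (fun _ => (1 : ℝ≥0∞)) ω, X ω) with hT
  have hT0 : Measurable T := hXs.mono hm le_rfl
  have hindep : IndepFun T Y μ := by
    rw [IndepFun_iff_Indep]
    exact indep_of_indep_of_le_left hind hXs.comap_le
  have hlaw := (indepFun_iff_map_prod_eq_prod_map_map hT0.aemeasurable hY.aemeasurable).1 hindep
  set G : (ℝ≥0∞ × E) × F → ℝ≥0∞ := fun p => p.1.1 * A.indicator (fun _ => 1) (f p.1.2 p.2) with hG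
  have hGm : Measurable G := by
    refine (measurable_fst.comp measurable_fst).mul ?_
    exact (measurable_const.indicator hA).comp
      (hf.comp ((measurable_snd.comp measurable_fst).prodMk measurable_snd))
  have hTp : IsProbabilityMeasure (μ.map T) := Measure.isProbabilityMeasure_map hT0.aemeasurable
  calc ∫⁻ ω in s, ((μ.map Y).map (f (X ω))) A ∂μ
      = ∫⁻ ω, ∫⁻ y, G (T ω, y) ∂(μ.map Y) ∂μ := by
        rw [← lintegral_indicator hs0]
        refine lintegral_congr fun ω => ?_
        simp only [hG, hT]
        have hmi : Measurable fun y => A.indicator (fun _ => (1 : ℝ≥0∞)) (f (X ω) y) :=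
          (measurable_const.indicator hA).comp (hfx (X ω))
        rw [lintegral_const_mul _ hmi]
        have : ∫⁻ y, A.indicator (fun _ => (1 : ℝ≥0∞)) (f (X ω) y) ∂(μ.map Y) =
            ((μ.map Y).map (f (X ω))) A := by
          rw [← lintegral_map (measurable_const.indicator hA) (hfx (X ω)),
            lintegral_indicator hA]
          simp
        rw [this]
        by_cases hω : ω ∈ s <;> simp [hω]
    _ = ∫⁻ t, ∫⁻ y, G (t, y) ∂(μ.map Y) ∂(μ.map T) := by
        rw [lintegral_map hGm.lintegral_prod_right' hT0]
    _ = ∫⁻ p, G p ∂((μ.map T).prod (μ.map Y)) := by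
        rw [lintegral_prod _ hGm.aemeasurable]
    _ = ∫⁻ ω, G (T ω, Y ω) ∂μ := by
        rw [← hlaw, lintegral_map hGm (hT0.prodMk hY)]
    _ = μ (s ∩ (fun ω => f (X ω) (Y ω)) ⁻¹' A) := by
        rw [← lintegral_indicator_one (hs0.inter hmeasA)]
        refine lintegral_congr fun ω => ?_
        by_cases h1 : ω ∈ s <;> by_cases h2 : f (X ω) (Y ω) ∈ A <;> simp [hG, hT, h1, h2]

end ReLUNet

namespace ReLUNet

/-! ### Markov kernels and histories -/

lemma isMarkovKernel_corrKernel (sp sm : ℝ) (n : ℕ) : IsMarkovKernel (corrKernel sp sm n) where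
  isProbabilityMeasure := by
    rintro (x | x)
    · exact Measure.isProbabilityMeasure_map
        ((measurable_corrStep sp sm n).comp measurable_prodMk_left).aemeasurable
    · exact Measure.dirac.isProbabilityMeasure

lemma isMarkovKernel_approxKernel (sp sm : ℝ) (n : ℕ) :
    IsMarkovKernel (approxKernel sp sm n) where
  isProbabilityMeasure := by
    rintro (x | x)
    · exact Measure.isProbabilityMeasure_map
        (measurable_inl.comp ((measurable_approxStepReal sp sm n).comp
          measurable_prodMk_left)).aemeasurable
    · exact Measure.dirac.isProbabilityMeasure

lemma measurable_history {Ω E : Type*} [MeasurableSpace E] (Y : ℕ → Ω → E) (k : ℕ) :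
    Measurable[history Y k] (Y k) :=
  (comap_measurable (Y k)).mono (le_biSup (fun j => MeasurableSpace.comap (Y j) inferInstance)
    self_mem_Iic) le_rfl

lemma history_le {Ω E : Type*} [MeasurableSpace E] {m : MeasurableSpace Ω} {Y : ℕ → Ω → E}
    {k : ℕ} (h : ∀ j ≤ k, Measurable[m] (Y j)) : history Y k ≤ m :=
  iSup₂_le fun j hj => (h j hj).comap_le

/-! ## The approximate chain -/

lemma measurable_approxStep (sp sm : ℝ) (n : ℕ) :
    Measurable (Function.uncurry (approxStep sp sm n)) := by
  have h1 : Measurable fun p : ℝ × ℝ =>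
      (Sum.inl (approxStepReal sp sm n p.1 p.2) : CorrState) :=
    measurable_inl.comp (measurable_approxStepReal sp sm n)
  have h : Function.uncurry (approxStep sp sm n) =
      (Sum.elim (fun p : ℝ × ℝ => (Sum.inl (approxStepReal sp sm n p.1 p.2) : CorrState))
        (fun _ : Unit × ℝ => Sum.inr ())) ∘ (MeasurableEquiv.sumProdDistrib ℝ Unit ℝ) := by
    funext p
    obtain ⟨x | x, z⟩ := p <;> rfl
  rw [h]
  exact (h1.sumElim measurable_const).comp (MeasurableEquiv.measurable _)

lemma approxKernel_apply (sp sm : ℝ) (n : ℕ) (x : CorrState) :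
    approxKernel sp sm n x = stdGauss.map (approxStep sp sm n x) := by
  obtain x | x := x
  · rfl
  · have : approxStep sp sm n (Sum.inr x) = fun _ => Sum.inr () := rfl
    rw [this, Measure.map_const, measure_univ, one_smul]
    rfl

/-- Used with `m1` the initial state, `m2` the past noises, `m3` the present noise and `m4` all the
noises. On the π-system of sets `a ∩ b`, split off `a` by independence from `m4`, then separate `b`
from `c`. -/
lemma indep_sup_of_indep_of_indep {Ω : Type*} {m1 m2 m3 m4 m0 : MeasurableSpace Ω}
    {μ : Measure Ω} [IsProbabilityMeasure μ] (h1 : m1 ≤ m0) (h2 : m2 ≤ m0) (h3 : m3 ≤ m0)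
    (h24 : m2 ≤ m4) (h34 : m3 ≤ m4) (h14 : Indep m1 m4 μ) (h23 : Indep m2 m3 μ) :
    Indep (m1 ⊔ m2) m3 μ := by
  set C : Set (Set Ω) := image2 (· ∩ ·) {s | MeasurableSet[m1] s} {s | MeasurableSet[m2] s}
    with hC
  have hsup : m1 ⊔ m2 = MeasurableSpace.generateFrom C := by
    refine le_antisymm (sup_le (fun s hs => ?_) fun s hs => ?_)
      (MeasurableSpace.generateFrom_le ?_)
    · exact MeasurableSpace.measurableSet_generateFrom
        ⟨s, hs, univ, @MeasurableSet.univ Ω m2, inter_univ s⟩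
    · exact MeasurableSpace.measurableSet_generateFrom
        ⟨univ, @MeasurableSet.univ Ω m1, s, hs, univ_inter s⟩
    · rintro _ ⟨a, ha, b, hb, rfl⟩
      exact MeasurableSet.inter ((le_sup_left : m1 ≤ m1 ⊔ m2) a ha)
        ((le_sup_right : m2 ≤ m1 ⊔ m2) b hb)
  have hpi : IsPiSystem C := by
    rintro _ ⟨a, ha, b, hb, rfl⟩ _ ⟨a', ha', b', hb', rfl⟩ _
    exact ⟨a ∩ a', @MeasurableSet.inter _ m1 _ _ ha ha', b ∩ b',
      @MeasurableSet.inter _ m2 _ _ hb hb', inter_inter_inter_comm a a' b b'⟩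
  refine IndepSets.indep (sup_le h1 h2) h3 hpi (@MeasurableSpace.isPiSystem_measurableSet Ω m3)
    hsup (@MeasurableSpace.generateFrom_measurableSet Ω m3).symm ?_
  rw [IndepSets_iff]
  rintro _ c ⟨a, ha, b, hb, rfl⟩ hc
  rw [Indep_iff] at h14 h23
  rw [inter_assoc, h14 a (b ∩ c) ha (@MeasurableSet.inter _ m4 _ _ (h24 b hb) (h34 c hc)),
    h14 a b ha (h24 b hb), h23 b c hb hc, mul_assoc]

lemma isMarkovChain_approxChain (sp sm : ℝ) (n : ℕ) {Ω : Type*} [MeasurableSpace Ω]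
    (μ : Measure Ω) [IsProbabilityMeasure μ] (p₀ : Ω → CorrState) (z : ℕ → Ω → ℝ)
    (hp : Measurable p₀) (hz : IsStdGaussianFamily μ z)
    (hind : IndepFun p₀ (fun ω k => z k ω) μ) :
    IsMarkovChain μ (history (approxChain sp sm n p₀ z)) (approxChain sp sm n p₀ z)
      (approxKernel sp sm n) := by
  refine ⟨isMarkovKernel_approxKernel sp sm n, measurable_history _, fun k A hA => ?_⟩
  obtain ⟨hzm, hzl, hzi⟩ := hz
  -- The index `k` is excluded: `z k` drives the step from `k` to `k + 1`, so the state at time `k`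
  -- depends only on `z j` with `j < k`.
  set past : ℕ → MeasurableSpace Ω := fun k => MeasurableSpace.comap p₀ inferInstance ⊔
    ⨆ j ∈ Iio k, MeasurableSpace.comap (z j) inferInstance with hpast
  have hmono : Monotone past := fun a b hab =>
    sup_le_sup_left (biSup_mono fun j hj => lt_of_lt_of_le hj hab) _
  have hchain : ∀ j, Measurable[past j] (approxChain sp sm n p₀ z j) := by
    intro j
    induction j with
    | zero => exact (comap_measurable p₀).mono le_sup_left le_rfl
    | succ j ih =>
      have hzj : Measurable[past (j + 1)] (z j) := (comap_measurable (z j)).mono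
        ((le_biSup (fun j => MeasurableSpace.comap (z j) inferInstance)
          (show j ∈ Iio (j + 1) from Nat.lt_succ_self j)).trans le_sup_right) le_rfl
      exact (measurable_approxStep sp sm n).comp
        ((ih.mono (hmono (Nat.le_succ j)) le_rfl).prodMk hzj)
  have hpast0 : ∀ k, past k ≤ ‹MeasurableSpace Ω› := fun k =>
    sup_le hp.comap_le (iSup₂_le fun j _ => (hzm j).comap_le)
  have hhist : history (approxChain sp sm n p₀ z) k ≤ past k :=
    history_le fun j hj => (hchain j).mono (hmono hj) le_rfl
  have hindep : Indep (past k) (MeasurableSpace.comap (z k) inferInstance) μ := by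
    have hzle : ∀ j, MeasurableSpace.comap (z j) inferInstance ≤
        MeasurableSpace.comap (fun ω k => z k ω) inferInstance := fun j => by
      have : Measurable[MeasurableSpace.comap (fun ω k => z k ω) inferInstance] (z j) :=
        (measurable_pi_apply j).comp (comap_measurable (fun ω k => z k ω))
      exact this.comap_le
    refine indep_sup_of_indep_of_indep hp.comap_le
      (iSup₂_le fun j _ => (hzm j).comap_le) (hzm k).comap_le
      (iSup₂_le fun j _ => hzle j) (hzle k) ((IndepFun_iff_Indep _ _ _).1 hind) ?_
    have := indep_iSup_of_disjoint (fun i => (hzm i).comap_le)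
      ((iIndepFun_iff_iIndep _ _ _).1 hzi) (S := Iio k) (T := {k}) (by simp)
    simpa using this
  have h := condExp_indicator_of_indep (hhist.trans (hpast0 k)) (measurable_history _ k) (hzm k)
    (indep_of_indep_of_le_left hindep hhist) (measurable_approxStep sp sm n) hA
  rw [hzl k] at h
  refine h.trans (ae_of_all _ fun ω => ?_)
  simp only [approxKernel_apply]

end ReLUNet

namespace ReLUNet

/-! ## The chain of the network -/

lemma act_mul_of_nonneg (sp sm : ℝ) {t : ℝ} (ht : 0 ≤ t) (x : ℝ) :
    act sp sm (t * x) = t * act sp sm x := by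
  unfold act
  rw [show max (t * x) 0 = t * max x 0 by rw [mul_max_of_nonneg _ _ ht, mul_zero],
    show min (t * x) 0 = t * min x 0 by rw [mul_min_of_nonneg _ _ ht, mul_zero]]
  ring

lemma act_zero (sp sm : ℝ) : act sp sm 0 = 0 := by simp [act]

lemma corr_zero_left {n : ℕ} (v : Fin n → ℝ) : corr 0 v = Sum.inr () := by simp [corr]

lemma corr_zero_right {n : ℕ} (u : Fin n → ℝ) : corr u 0 = Sum.inr () := by simp [corr]

lemma corr_smul {n : ℕ} (u v : Fin n → ℝ) {s t : ℝ} (hs : 0 < s) (ht : 0 < t) :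
    corr (s • u) (t • v) = corr u v := by
  unfold corr
  have h1 : s • u = 0 ↔ u = 0 := smul_eq_zero_iff_right hs.ne'
  have h2 : t • v = 0 ↔ v = 0 := smul_eq_zero_iff_right ht.ne'
  simp only [h1, h2]
  congr 2
  simp only [smul_dotProduct, dotProduct_smul, smul_eq_mul]
  rw [← mul_assoc s s, ← mul_assoc t t, Real.sqrt_mul (mul_self_nonneg s),
    Real.sqrt_mul (mul_self_nonneg t), Real.sqrt_mul_self hs.le, Real.sqrt_mul_self ht.le]
  rw [show s * √(u ⬝ᵥ u) * (t * √(v ⬝ᵥ v)) = (s * t) * (√(u ⬝ᵥ u) * √(v ⬝ᵥ v)) by ring,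
    show t * (s * (u ⬝ᵥ v)) = (s * t) * (u ⬝ᵥ v) by ring,
    mul_div_mul_left _ _ (by positivity)]

lemma dotProduct_self_pos {n : ℕ} {u : Fin n → ℝ} (hu : u ≠ 0) : 0 < u ⬝ᵥ u :=
  lt_of_le_of_ne (Finset.sum_nonneg fun i _ => mul_self_nonneg (u i))
    fun h => hu (dotProduct_self_eq_zero.1 h.symm)

/-- The pre-activations of the next layer after a layer with post-activations `u`, up to the
factor `t`. -/
lemma map_corr_layer (sp sm : ℝ) {n : ℕ} {t : ℝ} (ht : 0 < t) (u v : Fin n → ℝ) :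
    (Measure.pi fun _ : Fin n × Fin n => stdGauss).map (fun W =>
      corr (fun i => act sp sm (t * ∑ j, W (i, j) * u j))
        (fun i => act sp sm (t * ∑ j, W (i, j) * v j))) =
      corrKernel sp sm n (corr u v) := by
  -- Because `φ 0 = 0`, a vanishing layer stays zero for every weight matrix, which matches the
  -- absorbing state `e`.
  by_cases hu : u = 0
  · have : (fun W : Fin n × Fin n → ℝ => corr (fun i => act sp sm (t * ∑ j, W (i, j) * u j))
        (fun i => act sp sm (t * ∑ j, W (i, j) * v j))) = fun _ => Sum.inr () := by
      funext W
      convert corr_zero_left _ using 2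
      funext i
      simp [hu, act_zero]
    rw [this, Measure.map_const, measure_univ, one_smul, hu, corr_zero_left]
    rfl
  by_cases hv : v = 0
  · have : (fun W : Fin n × Fin n → ℝ => corr (fun i => act sp sm (t * ∑ j, W (i, j) * u j))
        (fun i => act sp sm (t * ∑ j, W (i, j) * v j))) = fun _ => Sum.inr () := by
      funext W
      convert corr_zero_right _ using 2
      funext i
      simp [hv, act_zero]
    rw [this, Measure.map_const, measure_univ, one_smul, hv, corr_zero_right]
    rfl
  have hu1 := dotProduct_self_pos hu
  have hv1 := dotProduct_self_pos hv
  have hus := Real.sqrt_pos.2 hu1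
  have hvs := Real.sqrt_pos.2 hv1
  set a := √(u ⬝ᵥ u) with ha
  set b := √(v ⬝ᵥ v) with hb
  have ha2 : a * a = u ⬝ᵥ u := Real.mul_self_sqrt hu1.le
  have hb2 : b * b = v ⬝ᵥ v := Real.mul_self_sqrt hv1.le
  have hpair := map_mulVec_pair (a⁻¹ • u) (b⁻¹ • v)
    (by rw [smul_dotProduct, dotProduct_smul, ← ha2]; simp [hus.ne'])
    (by rw [smul_dotProduct, dotProduct_smul, ← hb2]; simp [hvs.ne'])
  have hρ : (a⁻¹ • u) ⬝ᵥ (b⁻¹ • v) = (u ⬝ᵥ v) / (a * b) := by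
    rw [smul_dotProduct, dotProduct_smul, smul_eq_mul, smul_eq_mul]
    field_simp
  rw [hρ] at hpair
  have hcorr : corr u v = Sum.inl ((u ⬝ᵥ v) / (a * b)) := by simp [corr, hu, hv, ha, hb]
  rw [hcorr]
  set ρ := (u ⬝ᵥ v) / (a * b)
  have hact := measurable_act sp sm
  have hm : Measurable fun p : (Fin n → ℝ) × (Fin n → ℝ) =>
      corr (fun i => act sp sm (p.1 i)) (fun i => act sp sm (p.2 i)) :=
    measurable_corr.comp (f := fun p : (Fin n → ℝ) × (Fin n → ℝ) =>
      ((fun i => act sp sm (p.1 i)), (fun i => act sp sm (p.2 i)))) (by fun_prop)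
  have hpair' := congrArg (Measure.map fun p : (Fin n → ℝ) × (Fin n → ℝ) =>
      corr (fun i => act sp sm (p.1 i)) (fun i => act sp sm (p.2 i))) hpair
  rw [Measure.map_map hm (by fun_prop), Measure.map_map hm (by fun_prop)] at hpair'
  have e2 : corrKernel sp sm n (Sum.inl ρ) =
      ((stdGaussVec n).prod (stdGaussVec n)).map (corrStep sp sm n ρ) := rfl
  rw [e2]
  refine Eq.trans ?_ (hpair'.trans rfl)
  congr 1
  funext W
  simp only [Function.comp_apply, Pi.smul_apply, smul_eq_mul]
  -- Homogeneity pulls both the weight scale `t` and the norm `d` out of the activation, so that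
  -- `corr_smul` discards them.
  have hscale : ∀ (y : Fin n → ℝ) (d : ℝ), 0 < d →
      (fun i => act sp sm (t * ∑ j, W (i, j) * y j)) =
        (t * d) • fun i => act sp sm (∑ j, W (i, j) * (d⁻¹ * y j)) := by
    intro y d hd
    funext i
    rw [Pi.smul_apply, smul_eq_mul, ← act_mul_of_nonneg _ _ (by positivity), mul_assoc t,
      Finset.mul_sum Finset.univ _ d]
    congr 2
    refine Finset.sum_congr rfl fun j _ => ?_
    field_simp
  rw [hscale u a hus, hscale v b hvs, corr_smul _ _ (by positivity) (by positivity)]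

lemma measurable_of_eval {Ω ι : Type*} {E : ι → Type*} [∀ i, MeasurableSpace (E i)]
    {m : MeasurableSpace Ω} {f : Ω → ∀ i, E i} (h : ∀ i, Measurable[m] fun ω => f ω i) :
    Measurable[m] f :=
  measurable_pi_iff.2 h

/-- Layer index `k` reads only `W₀` and the matrices `W l` with `l < k`. The σ-algebra is arbitrary
so that it can be the one generated by these weights alone. -/
lemma measurable_netPre (sp sm : ℝ) {Ω : Type*} {m : MeasurableSpace Ω} {nin n : ℕ}
    (w : WeightIdx nin n → Ω → ℝ) (y : Fin nin → ℝ) (k : ℕ)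
    (h : ∀ i, (∀ l p, i = Sum.inr (l, p) → l < k) → Measurable (w i)) :
    Measurable (netPre sp sm w y k) := by
  induction k with
  | zero =>
    refine measurable_pi_lambda _ fun i => ?_
    have : (fun ω => netPre sp sm w y 0 ω i) =
        fun ω => (1 / √(nin : ℝ)) * ∑ j, w (Sum.inl (i, j)) ω * y j := rfl
    rw [this]
    refine Measurable.const_mul (Finset.measurable_fun_sum _ fun j _ => ?_) _
    exact (h _ (by rintro l p ⟨⟩)).mul_const _
  | succ k ih =>
    refine measurable_pi_lambda _ fun i => ?_
    have : (fun ω => netPre sp sm w y (k + 1) ω i) = fun ω => √(normConst sp sm / n) *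
        ∑ j, w (Sum.inr (k, i, j)) ω * act sp sm (netPre sp sm w y k ω j) := rfl
    rw [this]
    refine Measurable.const_mul (Finset.measurable_fun_sum _ fun j _ => ?_) _
    refine (h _ ?_).mul ((measurable_act sp sm).comp ((measurable_pi_apply j).comp
      (ih fun i hi => h i fun l p hlp => (hi l p hlp).trans (Nat.lt_succ_self k))))
    rintro l p ⟨⟩
    exact Nat.lt_succ_self _

lemma isMarkovChain_netCorr (sp sm : ℝ) (hc : 0 < normConst sp sm) {n nin m : ℕ} (hn : 0 < n)
    {Ω : Type*} [MeasurableSpace Ω] (μ : Measure Ω) [IsProbabilityMeasure μ]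
    (w : WeightIdx nin n → Ω → ℝ) (hw : IsStdGaussianFamily μ w) (x : Fin m → Fin nin → ℝ)
    (α β : Fin m) :
    IsMarkovChain μ (history fun k ω γ => netPre sp sm w (x γ) k ω)
      (netCorr sp sm w (x α) (x β)) (corrKernel sp sm n) := by
  obtain ⟨hwm, hwl, hwi⟩ := hw
  have hact := measurable_act sp sm
  have hactv : Measurable fun p : (Fin n → ℝ) × (Fin n → ℝ) =>
      corr (fun i => act sp sm (p.1 i)) (fun i => act sp sm (p.2 i)) :=
    measurable_corr.comp (f := fun p : (Fin n → ℝ) × (Fin n → ℝ) =>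
      ((fun i => act sp sm (p.1 i)), (fun i => act sp sm (p.2 i)))) (by fun_prop)
  have hpair : ∀ k, Measurable[history (fun k ω γ => netPre sp sm w (x γ) k ω) k]
      (fun ω => (netPre sp sm w (x α) k ω, netPre sp sm w (x β) k ω)) := fun k => by
    have h := measurable_history (fun k ω (γ : Fin m) => netPre sp sm w (x γ) k ω) k
    exact ((measurable_pi_apply α).comp h).prodMk ((measurable_pi_apply β).comp h)
  refine ⟨isMarkovKernel_corrKernel sp sm n, fun k => hactv.comp (hpair k), fun k A hA => ?_⟩
  set I : ℕ → Set (WeightIdx nin n) := fun k => {i | ∀ l p, i = Sum.inr (l, p) → l < k} with hI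
  set past : ℕ → MeasurableSpace Ω := fun k =>
    ⨆ i ∈ I k, MeasurableSpace.comap (w i) inferInstance with hpast
  have hmono : Monotone past := fun a b hab =>
    biSup_mono fun i hi l p h => (hi l p h).trans_le hab
  have hwpast : ∀ k, ∀ i ∈ I k, Measurable[past k] (w i) := fun k i hi =>
    (comap_measurable (w i)).mono
      (le_biSup (fun i => MeasurableSpace.comap (w i) inferInstance) hi) le_rfl
  have hpre : ∀ (y : Fin nin → ℝ) (k : ℕ), Measurable[past k] (netPre sp sm w y k) :=
    fun y k => measurable_netPre sp sm w y k fun i hi => hwpast k i hi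
  have hpast0 : ∀ k, past k ≤ ‹MeasurableSpace Ω› := fun k =>
    iSup₂_le fun i _ => (hwm i).comap_le
  have hhist : history (fun k ω (γ : Fin m) => netPre sp sm w (x γ) k ω) k ≤ past k :=
    history_le fun j hj => measurable_of_eval fun γ =>
      (hpre (x γ) j).mono (hmono hj) le_rfl
  -- The matrix `W k` leads from layer index `k` to `k + 1` and is the first one not contained in
  -- `past k`.
  set Y : Ω → Fin n × Fin n → ℝ := fun ω p => w (Sum.inr (k, p)) ω with hY
  have hYm : Measurable Y := measurable_pi_lambda _ fun p => hwm _
  have hYl : μ.map Y = Measure.pi fun _ => stdGauss := by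
    have hsub : iIndepFun (fun p : Fin n × Fin n => w (Sum.inr (k, p))) μ :=
      hwi.precomp (g := fun p : Fin n × Fin n => Sum.inr (k, p)) fun p q h => by simpa using h
    rw [hY, hsub.map_fun_eq_pi_map fun p => (hwm _).aemeasurable]
    simp_rw [hwl]
  have hindep : Indep (past k) (MeasurableSpace.comap Y inferInstance) μ := by
    have h := indep_iSup_of_disjoint (fun i => (hwm i).comap_le)
      ((iIndepFun_iff_iIndep _ _ _).1 hwi) (S := I k) (T := range fun p => Sum.inr (k, p)) (by
        rw [Set.disjoint_left]
        rintro _ h ⟨p, rfl⟩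
        exact lt_irrefl _ (h k p rfl))
    refine indep_of_indep_of_le_right h ?_
    have : Measurable[⨆ i ∈ range fun p : Fin n × Fin n => (Sum.inr (k, p) : WeightIdx nin n),
        MeasurableSpace.comap (w i) inferInstance] Y :=
      measurable_of_eval fun p => (comap_measurable (w (Sum.inr (k, p)))).mono
        (le_biSup (fun i => MeasurableSpace.comap (w i) inferInstance) ⟨p, rfl⟩) le_rfl
    exact this.comap_le
  set t := √(normConst sp sm / n) with ht
  have htpos : 0 < t := Real.sqrt_pos.2 (div_pos hc (by exact_mod_cast hn))
  set f : (Fin n → ℝ) × (Fin n → ℝ) → (Fin n × Fin n → ℝ) → CorrState := fun p W =>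
    corr (fun i => act sp sm (t * ∑ j, W (i, j) * act sp sm (p.1 j)))
      (fun i => act sp sm (t * ∑ j, W (i, j) * act sp sm (p.2 j))) with hf
  have hfm : Measurable (Function.uncurry f) :=
    measurable_corr.comp (f := fun q : ((Fin n → ℝ) × (Fin n → ℝ)) × (Fin n × Fin n → ℝ) =>
      ((fun i => act sp sm (t * ∑ j, q.2 (i, j) * act sp sm (q.1.1 j))),
        (fun i => act sp sm (t * ∑ j, q.2 (i, j) * act sp sm (q.1.2 j))))) (by fun_prop)
  have h := condExp_indicator_of_indep (hhist.trans (hpast0 k)) (hpair k) hYm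
    (indep_of_indep_of_le_left hindep hhist) hfm hA
  rw [hYl] at h
  refine h.trans (ae_of_all _ fun ω => ?_)
  simp only [hf]
  rw [map_corr_layer sp sm htpos]
  rfl

end ReLUNet

namespace ReLUNet

/-! ## Gaussian integrals of homogeneous functions of two variables -/

/-- The radial factor: `2k` of the exponent comes from the homogeneity and `1` from the polar
Jacobian. It is a Gamma integral with value `2^k Γ(k + 1)`. -/
lemma integral_pow_mul_exp_neg_sq_div_two (k : ℕ) :
    ∫ r in Ioi (0 : ℝ), r ^ (2 * k + 1) * Real.exp (-(r ^ 2 / 2)) = 2 ^ k * k.factorial := by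
  have h := integral_rpow_mul_exp_neg_mul_rpow (p := 2) (q := 2 * k + 1) (b := 1 / 2)
    (by norm_num)
    (by linarith [(Nat.cast_nonneg k : (0 : ℝ) ≤ k)]) (by norm_num)
  have e1 : ((2 * k + 1 : ℝ) + 1) / 2 = k + 1 := by ring
  have e2 : -((2 * k + 1 : ℝ) + 1) / 2 = -((k + 1 : ℕ) : ℝ) := by push_cast; ring
  rw [e1, e2, Real.Gamma_nat_eq_factorial, Real.rpow_neg (by norm_num), Real.rpow_natCast] at h
  have e3 : (((1 / 2 : ℝ) ^ (k + 1))⁻¹ * (1 / 2)) = 2 ^ k := by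
    rw [one_div, inv_pow, inv_inv, pow_succ]; ring
  rw [e3] at h
  rw [← h]
  refine setIntegral_congr_fun measurableSet_Ioi fun r hr => ?_
  rw [Real.rpow_ofNat, show (2 * k + 1 : ℝ) = ((2 * k + 1 : ℕ) : ℝ) by push_cast; ring,
    Real.rpow_natCast]
  congr 2
  ring

lemma integral_stdGauss_prod_eq (f : ℝ × ℝ → ℝ) :
    ∫ y, f y ∂(stdGauss.prod stdGauss) =
      ∫ y : ℝ × ℝ, (2 * Real.pi)⁻¹ * Real.exp (-((y.1 ^ 2 + y.2 ^ 2) / 2)) * f y := by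
  have hm := measurable_gaussianPDF 0 1
  rw [stdGauss, gaussianReal_of_var_ne_zero 0 one_ne_zero, prod_withDensity hm hm,
    integral_withDensity_eq_integral_toReal_smul (by fun_prop)
      (ae_of_all _ fun y => ENNReal.mul_lt_top gaussianPDF_lt_top gaussianPDF_lt_top)]
  refine integral_congr_ae (ae_of_all _ fun y => ?_)
  simp only [ENNReal.toReal_mul, toReal_gaussianPDF, gaussianPDFReal, smul_eq_mul, sub_zero,
    NNReal.coe_one, mul_one]
  congr 1
  rw [mul_mul_mul_comm, ← mul_inv, Real.mul_self_sqrt (by positivity), ← Real.exp_add]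
  congr 2
  ring

/-- A homogeneous function of even degree, in polar coordinates. -/
lemma integral_homogeneous {f : ℝ × ℝ → ℝ} {k : ℕ}
    (hf : ∀ r > 0, ∀ a b, f (r * a, r * b) = r ^ (2 * k) * f (a, b)) :
    ∫ y, f y ∂(stdGauss.prod stdGauss) = 2 ^ k * k.factorial / (2 * Real.pi) *
      ∫ θ in Ioo (-Real.pi) Real.pi, f (Real.cos θ, Real.sin θ) := by
  rw [integral_stdGauss_prod_eq, ← integral_comp_polarCoord_symm, polarCoord_target]
  -- The product formula and the polar change of variables hold for Bochner integrals without
  -- integrability. Hence integrability may later be deduced from the value of such an integral.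
  have h : ∫ p in Ioi (0 : ℝ) ×ˢ Ioo (-Real.pi) Real.pi, (p.1 ^ (2 * k + 1) *
        Real.exp (-(p.1 ^ 2 / 2))) * f (Real.cos p.2, Real.sin p.2) =
      (∫ r in Ioi (0 : ℝ), r ^ (2 * k + 1) * Real.exp (-(r ^ 2 / 2))) *
        ∫ θ in Ioo (-Real.pi) Real.pi, f (Real.cos θ, Real.sin θ) :=
    setIntegral_prod_mul (μ := volume) (ν := volume)
      (fun r : ℝ => r ^ (2 * k + 1) * Real.exp (-(r ^ 2 / 2)))
      (fun θ => f (Real.cos θ, Real.sin θ)) _ _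
  rw [integral_pow_mul_exp_neg_sq_div_two] at h
  rw [div_mul_eq_mul_div, ← h, div_eq_inv_mul, ← integral_const_mul]
  refine setIntegral_congr_fun (measurableSet_Ioi.prod measurableSet_Ioo) fun p hp => ?_
  have hp1 : 0 < p.1 := hp.1
  simp only [polarCoord_symm_apply, smul_eq_mul]
  rw [hf _ hp1]
  have : (p.1 * Real.cos p.2) ^ 2 + (p.1 * Real.sin p.2) ^ 2 = p.1 ^ 2 := by
    linear_combination p.1 ^ 2 * Real.cos_sq_add_sin_sq p.2
  rw [this]
  ring

/-! ## The arccos kernels -/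

lemma act_one_zero (x : ℝ) : act 1 0 x = max x 0 := by simp [act]

/-- For `0 ≤ φ ≤ π` both cosines are nonnegative on `[φ - π/2, π/2]`, and elsewhere in `(-π, π)` one
of the two truncated factors vanishes. Nonzero exponents are needed because `0 ^ 0 = 1`. -/
lemma integral_max_cos {p r : ℕ} (hp : p ≠ 0) (hr : r ≠ 0) {φ : ℝ} (h0 : 0 ≤ φ)
    (hπ : φ ≤ Real.pi) :
    ∫ θ in Ioo (-Real.pi) Real.pi, max (Real.cos θ) 0 ^ p * max (Real.cos (θ - φ)) 0 ^ r =
      ∫ θ in (φ - Real.pi / 2)..(Real.pi / 2), Real.cos θ ^ p * Real.cos (θ - φ) ^ r := by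
  have hpi := Real.pi_pos
  rw [intervalIntegral.integral_of_le (by linarith)]
  rw [setIntegral_eq_of_subset_of_forall_sdiff_eq_zero measurableSet_Ioo
    (s := Ioc (φ - Real.pi / 2) (Real.pi / 2)) ?_ ?_]
  · refine setIntegral_congr_fun measurableSet_Ioc fun θ hθ => ?_
    obtain ⟨h1, h2⟩ := hθ
    rw [max_eq_left (Real.cos_nonneg_of_mem_Icc ⟨by linarith, h2⟩),
      max_eq_left (Real.cos_nonneg_of_mem_Icc ⟨by linarith, by linarith⟩)]
  · rintro θ ⟨h1, h2⟩
    exact ⟨by linarith, by linarith⟩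
  · rintro θ ⟨⟨h1, h2⟩, h3⟩
    by_cases h4 : Real.cos θ ≤ 0
    · rw [max_eq_right h4, zero_pow hp, zero_mul]
    · have h5 : -(Real.pi / 2) < θ := by
        by_contra! h
        refine h4 ?_
        rw [← Real.cos_neg]
        exact Real.cos_nonpos_of_pi_div_two_le_of_le (by linarith) (by linarith)
      have h6 : θ < Real.pi / 2 := by
        by_contra! h
        exact h4 (Real.cos_nonpos_of_pi_div_two_le_of_le h (by linarith))
      have h7 : θ ≤ φ - Real.pi / 2 := by
        by_contra! h
        exact h3 ⟨h, h6.le⟩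
      have h8 : Real.cos (θ - φ) ≤ 0 := by
        rw [← Real.cos_neg]
        exact Real.cos_nonpos_of_pi_div_two_le_of_le (by linarith) (by linarith)
      rw [max_eq_right h8, zero_pow hr, mul_zero]

/-- On the unit circle the second Gaussian coordinate is `ρ cos θ + √(1 - ρ²) sin θ = cos (θ -
arccos ρ)`. -/
lemma J_eq_integral {p r k : ℕ} (hp : p ≠ 0) (hr : r ≠ 0) (hk : p + r = 2 * k) {ρ : ℝ}
    (hρ : ρ ∈ Icc (-1 : ℝ) 1) :
    J p r ρ = 2 ^ k * k.factorial / (2 * Real.pi) *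
      ∫ θ in (Real.arccos ρ - Real.pi / 2)..(Real.pi / 2),
        Real.cos θ ^ p * (Real.cos θ * ρ + Real.sin θ * √(1 - ρ ^ 2)) ^ r := by
  unfold J K
  rw [integral_homogeneous (k := k)]
  · congr 1
    have hc : Real.cos (Real.arccos ρ) = ρ := Real.cos_arccos hρ.1 hρ.2
    have h := integral_max_cos hp hr (Real.arccos_nonneg ρ) (Real.arccos_le_pi ρ)
    simp only [Real.cos_sub, hc, Real.sin_arccos] at h
    rw [← h]
    simp only [act_one_zero]
    refine setIntegral_congr_fun measurableSet_Ioo fun θ _ => ?_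
    rw [mul_comm ρ, mul_comm √(1 - ρ ^ 2)]
  · intro t ht a b
    rw [show ρ * (t * a) + √(1 - ρ ^ 2) * (t * b) = t * (ρ * a + √(1 - ρ ^ 2) * b) by ring,
      act_mul_of_nonneg _ _ ht.le, act_mul_of_nonneg _ _ ht.le, ← hk, pow_add]
    ring

lemma hasDerivAt_cos_pow_mul_sin (n : ℕ) (θ : ℝ) :
    HasDerivAt (fun θ => Real.cos θ ^ (n + 1) * Real.sin θ)
      (-(n + 1) * Real.cos θ ^ n * Real.sin θ ^ 2 + Real.cos θ ^ (n + 2)) θ := by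
  have h := ((Real.hasDerivAt_cos θ).pow (n + 1)).mul (Real.hasDerivAt_sin θ)
  refine HasDerivAt.congr_deriv h ?_
  simp only [Pi.pow_apply, Nat.add_sub_cancel]
  push_cast
  ring

/-- The antiderivative takes the angle, its cosine and its sine as separate arguments, so that the
endpoint values become algebraic in `ρ` and `√(1 - ρ²)`. The lower endpoint `arccos ρ - π/2` equals
`π/2 - arccos (-ρ)`. -/
lemma integral_trig_of_hasDerivAt {ρ : ℝ} (hρ : ρ ∈ Icc (-1 : ℝ) 1) {F : ℝ → ℝ → ℝ → ℝ}
    {f : ℝ → ℝ} (hF : ∀ θ, HasDerivAt (fun θ => F θ (Real.cos θ) (Real.sin θ)) (f θ) θ)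
    (hf : Continuous f) :
    ∫ θ in (Real.arccos ρ - Real.pi / 2)..(Real.pi / 2), f θ =
      F (Real.pi / 2) 0 1 - F (Real.pi / 2 - Real.arccos (-ρ)) √(1 - ρ ^ 2) (-ρ) := by
  rw [intervalIntegral.integral_eq_sub_of_hasDerivAt (fun θ _ => hF θ)
    (hf.intervalIntegrable _ _), Real.cos_pi_div_two, Real.sin_pi_div_two, Real.cos_sub_pi_div_two,
    Real.sin_sub_pi_div_two, Real.sin_arccos, Real.cos_arccos hρ.1 hρ.2, Real.arccos_neg]
  congr 2
  ring

lemma J_one_one {ρ : ℝ} (hρ : ρ ∈ Icc (-1 : ℝ) 1) :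
    J 1 1 ρ = (√(1 - ρ ^ 2) + ρ * Real.arccos (-ρ)) / (2 * Real.pi) := by
  rw [J_eq_integral one_ne_zero one_ne_zero (k := 1) rfl hρ]
  have hq : √(1 - ρ ^ 2) ^ 2 = 1 - ρ ^ 2 := Real.sq_sqrt (by nlinarith [hρ.1, hρ.2])
  set q := √(1 - ρ ^ 2) with hqd
  rw [integral_trig_of_hasDerivAt hρ
    (F := fun θ c s => ρ * (θ / 2 + c ^ 1 * s / 2) - q * (c ^ 2 / 2))]
  · rw [← hqd]
    have : Real.pi ≠ 0 := Real.pi_ne_zero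
    simp only [Nat.factorial]
    field_simp
    push_cast
    linear_combination 2 * q * hq
  · intro θ
    have := ((((hasDerivAt_id θ).div_const 2).add
      ((hasDerivAt_cos_pow_mul_sin 0 θ).div_const 2)).const_mul ρ).sub
      ((((Real.hasDerivAt_cos θ).pow 2).div_const 2).const_mul q)
    refine HasDerivAt.congr_deriv this ?_
    push_cast
    linear_combination (-ρ / 2) * Real.cos_sq_add_sin_sq θ
  · fun_prop

lemma J_two_two {ρ : ℝ} (hρ : ρ ∈ Icc (-1 : ℝ) 1) :
    J 2 2 ρ = (3 * ρ * √(1 - ρ ^ 2) + Real.arccos (-ρ) * (1 + 2 * ρ ^ 2)) / (2 * Real.pi) := by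
  rw [J_eq_integral two_ne_zero two_ne_zero (k := 2) rfl hρ]
  have hq : √(1 - ρ ^ 2) ^ 2 = 1 - ρ ^ 2 := Real.sq_sqrt (by nlinarith [hρ.1, hρ.2])
  set q := √(1 - ρ ^ 2) with hqd
  rw [integral_trig_of_hasDerivAt hρ
    (F := fun θ c s => ρ ^ 2 * (θ * (3 / 8) + c ^ 1 * s * (3 / 8) + c ^ 3 * s / 4) -
      2 * ρ * q * (c ^ 4 / 4) + q ^ 2 * (θ / 8 + c ^ 1 * s / 8 - c ^ 3 * s / 4))]
  · rw [← hqd]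
    have : Real.pi ≠ 0 := Real.pi_ne_zero
    simp only [Nat.factorial]
    field_simp
    push_cast
    linear_combination (32 * Real.arccos (-ρ) + ρ * q * (64 * q ^ 2 + 96)) * hq
  · intro θ
    have := ((((((hasDerivAt_id θ).mul_const (3 / 8)).add
      ((hasDerivAt_cos_pow_mul_sin 0 θ).mul_const (3 / 8))).add
      ((hasDerivAt_cos_pow_mul_sin 2 θ).div_const 4)).const_mul (ρ ^ 2)).sub
      ((((Real.hasDerivAt_cos θ).pow 4).div_const 4).const_mul (2 * ρ * q))).add
      (((((hasDerivAt_id θ).div_const 8).add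
      ((hasDerivAt_cos_pow_mul_sin 0 θ).div_const 8)).sub
      ((hasDerivAt_cos_pow_mul_sin 2 θ).div_const 4)).const_mul (q ^ 2))
    refine HasDerivAt.congr_deriv this ?_
    push_cast
    linear_combination (-ρ ^ 2 * (3 / 8 + 3 * Real.cos θ ^ 2 / 4)
      - q ^ 2 * (Real.cos θ ^ 2 / 4 + 1 / 8)) * Real.cos_sq_add_sin_sq θ
  · fun_prop

lemma J_three_one {ρ : ℝ} (hρ : ρ ∈ Icc (-1 : ℝ) 1) :
    J 3 1 ρ = (√(1 - ρ ^ 2) * (2 + ρ ^ 2) + 3 * Real.arccos (-ρ) * ρ) / (2 * Real.pi) := by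
  rw [J_eq_integral three_ne_zero one_ne_zero (k := 2) rfl hρ]
  have hq : √(1 - ρ ^ 2) ^ 2 = 1 - ρ ^ 2 := Real.sq_sqrt (by nlinarith [hρ.1, hρ.2])
  set q := √(1 - ρ ^ 2) with hqd
  rw [integral_trig_of_hasDerivAt hρ
    (F := fun θ c s => ρ * (θ * (3 / 8) + c ^ 1 * s * (3 / 8) + c ^ 3 * s / 4) -
      q * (c ^ 4 / 4))]
  · rw [← hqd]
    have : Real.pi ≠ 0 := Real.pi_ne_zero
    simp only [Nat.factorial]
    field_simp
    push_cast
    linear_combination 64 * q * (q ^ 2 + 1) * hq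
  · intro θ
    have := (((((hasDerivAt_id θ).mul_const (3 / 8)).add
      ((hasDerivAt_cos_pow_mul_sin 0 θ).mul_const (3 / 8))).add
      ((hasDerivAt_cos_pow_mul_sin 2 θ).div_const 4)).const_mul ρ).sub
      ((((Real.hasDerivAt_cos θ).pow 4).div_const 4).const_mul q)
    refine HasDerivAt.congr_deriv this ?_
    push_cast
    linear_combination (-ρ * (3 / 8 + 3 * Real.cos θ ^ 2 / 4)) * Real.cos_sq_add_sin_sq θ
  · fun_prop

end ReLUNet

namespace ReLUNet

/-! ## Moments of the activations -/

lemma integral_normSq_pow (k : ℕ) :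
    ∫ y : ℝ × ℝ, (y.1 ^ 2 + y.2 ^ 2) ^ k ∂(stdGauss.prod stdGauss) = 2 ^ k * k.factorial := by
  rw [integral_homogeneous (k := k)]
  · simp only [Real.cos_sq_add_sin_sq, one_pow]
    rw [setIntegral_const, Real.volume_real_Ioo_of_le (by linarith [Real.pi_pos])]
    have := Real.pi_ne_zero
    simp only [smul_eq_mul]
    field_simp
    ring
  · intro r _ a b
    simp only
    rw [pow_mul, ← mul_pow]
    ring

/-- The integral has been computed and is nonzero, whereas a non-integrable function has Bochner
integral `0`. -/
lemma integrable_normSq_pow (k : ℕ) :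
    Integrable (fun y : ℝ × ℝ => (y.1 ^ 2 + y.2 ^ 2) ^ k) (stdGauss.prod stdGauss) := by
  by_contra h
  have h1 := integral_undef h
  rw [integral_normSq_pow] at h1
  have : (0 : ℝ) < 2 ^ k * k.factorial := by positivity
  exact this.ne' h1

lemma integrable_of_abs_le_normSq_pow {f : ℝ × ℝ → ℝ} (hf : Measurable f) {C : ℝ} {k : ℕ}
    (h : ∀ y, |f y| ≤ C * (y.1 ^ 2 + y.2 ^ 2) ^ k) : Integrable f (stdGauss.prod stdGauss) :=
  ((integrable_normSq_pow k).const_mul C).mono' hf.aestronglyMeasurable (ae_of_all _ h)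

lemma abs_integral_le_of_abs_le_normSq_pow {f : ℝ × ℝ → ℝ} {C : ℝ} {k : ℕ}
    (h : ∀ y, |f y| ≤ C * (y.1 ^ 2 + y.2 ^ 2) ^ k) :
    |∫ y, f y ∂(stdGauss.prod stdGauss)| ≤ C * (2 ^ k * k.factorial) := by
  rw [← integral_normSq_pow, ← integral_const_mul]
  exact norm_integral_le_of_norm_le (f := f) ((integrable_normSq_pow k).const_mul C)
    (ae_of_all _ h)

lemma abs_act_le (sp sm x : ℝ) : |act sp sm x| ≤ (|sp| + |sm|) * |x| := by
  unfold act
  rcases le_total 0 x with h | h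
  · rw [max_eq_left h, min_eq_right h, mul_zero, add_zero, abs_mul]
    nlinarith [mul_nonneg (abs_nonneg sm) (abs_nonneg x)]
  · rw [max_eq_right h, min_eq_left h, mul_zero, zero_add, abs_mul]
    nlinarith [mul_nonneg (abs_nonneg sp) (abs_nonneg x)]

lemma abs_act_pow_mul_le (sp sm : ℝ) {p r k : ℕ} (hk : p + r = 2 * k) {a b M : ℝ}
    (ha : a ^ 2 ≤ M) (hb : b ^ 2 ≤ M) :
    |act sp sm a ^ p * act sp sm b ^ r| ≤ (|sp| + |sm|) ^ (2 * k) * M ^ k := by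
  have hS : 0 ≤ |sp| + |sm| := by positivity
  have hM : 0 ≤ M := (sq_nonneg a).trans ha
  have h : ∀ x : ℝ, x ^ 2 ≤ M → |act sp sm x| ≤ (|sp| + |sm|) * √M := fun x hx =>
    (abs_act_le sp sm x).trans (mul_le_mul_of_nonneg_left (Real.abs_le_sqrt hx) hS)
  rw [abs_mul, abs_pow, abs_pow]
  calc |act sp sm a| ^ p * |act sp sm b| ^ r
      ≤ ((|sp| + |sm|) * √M) ^ p * ((|sp| + |sm|) * √M) ^ r := by
        gcongr
        · exact h a ha
        · exact h b hb
    _ = (|sp| + |sm|) ^ (2 * k) * M ^ k := by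
        rw [← pow_add, hk, mul_pow, pow_mul (√M), Real.sq_sqrt hM]

lemma corr_coord_sq_le {ρ : ℝ} (hρ : ρ ∈ Icc (-1 : ℝ) 1) (y : ℝ × ℝ) :
    (ρ * y.1 + √(1 - ρ ^ 2) * y.2) ^ 2 ≤ y.1 ^ 2 + y.2 ^ 2 := by
  have hq : √(1 - ρ ^ 2) ^ 2 = 1 - ρ ^ 2 := Real.sq_sqrt (by nlinarith [hρ.1, hρ.2])
  have : y.1 ^ 2 + y.2 ^ 2 - (ρ * y.1 + √(1 - ρ ^ 2) * y.2) ^ 2 =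
      (√(1 - ρ ^ 2) * y.1 - ρ * y.2) ^ 2 := by
    linear_combination -(y.1 ^ 2 + y.2 ^ 2) * hq
  nlinarith [sq_nonneg (√(1 - ρ ^ 2) * y.1 - ρ * y.2)]

lemma abs_act_mul_le (sp sm : ℝ) {p r k : ℕ} (hk : p + r = 2 * k) {ρ : ℝ}
    (hρ : ρ ∈ Icc (-1 : ℝ) 1) (y : ℝ × ℝ) :
    |act sp sm y.1 ^ p * act sp sm (ρ * y.1 + √(1 - ρ ^ 2) * y.2) ^ r| ≤
      (|sp| + |sm|) ^ (2 * k) * (y.1 ^ 2 + y.2 ^ 2) ^ k :=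
  abs_act_pow_mul_le sp sm hk (by nlinarith [sq_nonneg y.2]) (corr_coord_sq_le hρ y)

lemma integrable_act_mul (sp sm : ℝ) {p r k : ℕ} (hk : p + r = 2 * k) {ρ : ℝ}
    (hρ : ρ ∈ Icc (-1 : ℝ) 1) :
    Integrable (fun y : ℝ × ℝ => act sp sm y.1 ^ p *
      act sp sm (ρ * y.1 + √(1 - ρ ^ 2) * y.2) ^ r) (stdGauss.prod stdGauss) := by
  have h := measurable_act sp sm
  exact integrable_of_abs_le_normSq_pow (by fun_prop) (abs_act_mul_le sp sm hk hρ)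

lemma abs_K_le (sp sm : ℝ) {p r k : ℕ} (hk : p + r = 2 * k) {ρ : ℝ}
    (hρ : ρ ∈ Icc (-1 : ℝ) 1) :
    |K sp sm p r ρ| ≤ (|sp| + |sm|) ^ (2 * k) * (2 ^ k * k.factorial) :=
  abs_integral_le_of_abs_le_normSq_pow (abs_act_mul_le sp sm hk hρ)

lemma integral_comp_orthogonal {a b c d : ℝ} (h1 : a ^ 2 + b ^ 2 = 1) (h2 : c ^ 2 + d ^ 2 = 1)
    (h3 : a * c + b * d = 0) {f : ℝ × ℝ → ℝ} (hf : Measurable f) :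
    ∫ y, f (a * y.1 + b * y.2, c * y.1 + d * y.2) ∂(stdGauss.prod stdGauss) =
      ∫ y, f y ∂(stdGauss.prod stdGauss) := by
  conv_rhs => rw [← map_prod_stdGauss h1 h2 h3]
  rw [integral_map (by fun_prop) hf.aestronglyMeasurable]

/-- The symmetric orthogonal matrix with rows `(ρ, q)` and `(q, -ρ)`, `q = √(1 - ρ²)`, is an
involution exchanging the two correlated Gaussians. -/
lemma K_comm (sp sm : ℝ) (p r : ℕ) {ρ : ℝ} (hρ : ρ ∈ Icc (-1 : ℝ) 1) :
    K sp sm p r ρ = K sp sm r p ρ := by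
  have hq : √(1 - ρ ^ 2) ^ 2 = 1 - ρ ^ 2 := Real.sq_sqrt (by nlinarith [hρ.1, hρ.2])
  have h := measurable_act sp sm
  unfold K
  rw [← integral_comp_orthogonal (a := ρ) (b := √(1 - ρ ^ 2)) (c := √(1 - ρ ^ 2)) (d := -ρ)
    (by linarith) (by linarith) (by ring) (by fun_prop)]
  refine integral_congr_ae (ae_of_all _ fun y => ?_)
  simp only
  rw [show ρ * (ρ * y.1 + √(1 - ρ ^ 2) * y.2) + √(1 - ρ ^ 2) * (√(1 - ρ ^ 2) * y.1 + -ρ * y.2) =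
    y.1 by linear_combination y.1 * hq]
  ring

lemma K_zero_right (sp sm : ℝ) (p : ℕ) (ρ : ℝ) : K sp sm p 0 ρ = ∫ g, act sp sm g ^ p ∂stdGauss := by
  have h := measurable_act sp sm
  unfold K
  simp only [pow_zero, mul_one]
  rw [integral_fun_fst (μ := stdGauss) (ν := stdGauss) (fun x => act sp sm x ^ p)]
  simp

lemma K_apply_one (sp sm : ℝ) (p r : ℕ) :
    K sp sm p r 1 = ∫ g, act sp sm g ^ (p + r) ∂stdGauss := by
  rw [← K_zero_right sp sm (p + r) 1]
  unfold K
  simp [pow_add]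

/-- The two half-line parts are never both nonzero, so a positive power has no cross terms. -/
lemma act_pow (sp sm x : ℝ) {p : ℕ} (hp : p ≠ 0) :
    act sp sm x ^ p = sp ^ p * act 1 0 x ^ p + (-sm) ^ p * act 1 0 (-x) ^ p := by
  simp only [act_one_zero]
  unfold act
  rcases le_total 0 x with h | h
  · rw [max_eq_left h, min_eq_right h, max_eq_right (neg_nonpos.2 h), zero_pow hp, ← mul_pow]
    ring
  · rw [max_eq_right h, min_eq_left h, max_eq_left (neg_nonneg.2 h), zero_pow hp, ← mul_pow]
    ring

/-- Expanding both powers gives four sign patterns of `(g, ĝ)`. Equal signs are removed by flipping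
both independent Gaussians; opposite signs turn the correlation into `-ρ`, after flipping one of
them. -/
lemma K_eq_J (sp sm : ℝ) {p r k : ℕ} (hp : p ≠ 0) (hr : r ≠ 0) (hk : p + r = 2 * k) {ρ : ℝ}
    (hρ : ρ ∈ Icc (-1 : ℝ) 1) :
    K sp sm p r ρ = (sp ^ (p + r) + (-sm) ^ (p + r)) * J p r ρ +
      (sp ^ p * (-sm) ^ r + (-sm) ^ p * sp ^ r) * J p r (-ρ) := by
  have hρ' : -ρ ∈ Icc (-1 : ℝ) 1 := ⟨by linarith [hρ.2], by linarith [hρ.1]⟩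
  have hm := measurable_act 1 0
  set f : ℝ → ℝ × ℝ → ℝ := fun ρ y =>
    act 1 0 y.1 ^ p * act 1 0 (ρ * y.1 + √(1 - ρ ^ 2) * y.2) ^ r with hf
  have hfm : ∀ ρ, Measurable (f ρ) := fun ρ => by simp only [hf]; fun_prop
  have hJ : ∀ ρ, J p r ρ = ∫ y, f ρ y ∂(stdGauss.prod stdGauss) := fun ρ => rfl
  have hI : ∀ ρ ∈ Icc (-1 : ℝ) 1, ∀ a b : ℝ, a ^ 2 = 1 → b ^ 2 = 1 →
      Integrable (fun y : ℝ × ℝ => f ρ (a * y.1, b * y.2)) (stdGauss.prod stdGauss) := by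
    intro ρ hρ a b ha hb
    refine integrable_of_abs_le_normSq_pow (by have := hfm ρ; fun_prop)
      (C := (|1| + |0|) ^ (2 * k)) (k := k) fun y => ?_
    have := abs_act_mul_le 1 0 hk hρ (a * y.1, b * y.2)
    simpa only [mul_pow, ha, hb, one_mul] using this
  have hE : ∀ ρ : ℝ, ∀ a b : ℝ, a ^ 2 = 1 → b ^ 2 = 1 →
      ∫ y, f ρ (a * y.1, b * y.2) ∂(stdGauss.prod stdGauss) = J p r ρ := by
    intro ρ a b ha hb
    rw [hJ, ← integral_comp_orthogonal (a := a) (b := 0) (c := 0) (d := b)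
      (by rw [ha]; ring) (by rw [hb]; ring) (by ring) (hfm ρ)]
    simp
  have h1 : (1 : ℝ) ^ 2 = 1 := by norm_num
  have h2 : (-1 : ℝ) ^ 2 = 1 := by norm_num
  have key : ∀ y : ℝ × ℝ, act sp sm y.1 ^ p * act sp sm (ρ * y.1 + √(1 - ρ ^ 2) * y.2) ^ r =
      (sp ^ (p + r) * f ρ (1 * y.1, 1 * y.2) + (-sm) ^ (p + r) * f ρ (-1 * y.1, -1 * y.2)) +
      (sp ^ p * (-sm) ^ r * f (-ρ) (1 * y.1, -1 * y.2) +
        (-sm) ^ p * sp ^ r * f (-ρ) (-1 * y.1, 1 * y.2)) := by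
    intro y
    rw [act_pow sp sm _ hp, act_pow sp sm _ hr]
    simp only [hf, neg_sq]
    rw [show ρ * (-1 * y.1) + √(1 - ρ ^ 2) * (-1 * y.2) = -(ρ * y.1 + √(1 - ρ ^ 2) * y.2) by ring,
      show -ρ * (1 * y.1) + √(1 - ρ ^ 2) * (-1 * y.2) = -(ρ * y.1 + √(1 - ρ ^ 2) * y.2) by ring,
      show -ρ * (-1 * y.1) + √(1 - ρ ^ 2) * (1 * y.2) = ρ * y.1 + √(1 - ρ ^ 2) * y.2 by ring,
      show -1 * y.1 = -y.1 by ring, one_mul, one_mul]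
    ring
  unfold K
  simp only [key]
  rw [integral_add, integral_add, integral_add, integral_const_mul, integral_const_mul,
    integral_const_mul, integral_const_mul, hE _ _ _ h1 h1, hE _ _ _ h2 h2, hE _ _ _ h1 h2,
    hE _ _ _ h2 h1]
  · ring
  · exact (hI _ hρ' _ _ h1 h2).const_mul _
  · exact (hI _ hρ' _ _ h2 h1).const_mul _
  · exact (hI _ hρ _ _ h1 h1).const_mul _
  · exact (hI _ hρ _ _ h2 h2).const_mul _
  · exact ((hI _ hρ _ _ h1 h1).const_mul _).add ((hI _ hρ _ _ h2 h2).const_mul _)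
  · exact ((hI _ hρ' _ _ h1 h2).const_mul _).add ((hI _ hρ' _ _ h2 h1).const_mul _)

lemma integral_act_sq (sp sm : ℝ) : ∫ g, act sp sm g ^ 2 ∂stdGauss = (sp ^ 2 + sm ^ 2) / 2 := by
  have h1 : (1 : ℝ) ∈ Icc (-1 : ℝ) 1 := by norm_num
  have h2 : (-1 : ℝ) ∈ Icc (-1 : ℝ) 1 := by norm_num
  have := Real.pi_ne_zero
  rw [← K_apply_one sp sm 1 1, K_eq_J sp sm one_ne_zero one_ne_zero (k := 1) rfl h1,
    J_one_one h1, J_one_one h2]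
  simp
  field_simp

lemma integral_act_pow_four (sp sm : ℝ) :
    ∫ g, act sp sm g ^ 4 ∂stdGauss = 3 / 2 * (sp ^ 4 + sm ^ 4) := by
  have h1 : (1 : ℝ) ∈ Icc (-1 : ℝ) 1 := by norm_num
  have h2 : (-1 : ℝ) ∈ Icc (-1 : ℝ) 1 := by norm_num
  have := Real.pi_ne_zero
  rw [← K_apply_one sp sm 2 2, K_eq_J sp sm two_ne_zero two_ne_zero (k := 2) rfl h1,
    J_two_two h1, J_two_two h2]
  simp
  field_simp
  norm_num

lemma normConst_eq (sp sm : ℝ) : normConst sp sm = 2 / (sp ^ 2 + sm ^ 2) := by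
  rw [normConst, integral_act_sq, inv_div]

lemma normConst_pos {sp sm : ℝ} (hs : sp ≠ 0 ∨ sm ≠ 0) : 0 < normConst sp sm := by
  rw [normConst_eq]
  rcases hs with h | h <;> positivity

lemma normConst_mul_integral {sp sm : ℝ} (hs : sp ≠ 0 ∨ sm ≠ 0) :
    normConst sp sm * ∫ g, act sp sm g ^ 2 ∂stdGauss = 1 := by
  have h := (normConst_pos hs).ne'
  rw [normConst] at h ⊢
  exact inv_mul_cancel₀ fun h0 => h (by rw [h0, inv_zero])

lemma integrable_act_pow_even (sp sm : ℝ) (k : ℕ) :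
    Integrable (fun g => act sp sm g ^ (2 * k)) stdGauss := by
  have h1 : (1 : ℝ) ∈ Icc (-1 : ℝ) 1 := by norm_num
  have h := integrable_act_mul sp sm (p := 2 * k) (r := 0) (k := k) (by ring) h1
  simp only [pow_zero, mul_one] at h
  exact (Integrable.comp_fst_iff (f := fun x => act sp sm x ^ (2 * k)) (NeZero.ne stdGauss)).1 h

lemma M2_eq {sp sm : ℝ} (hs : sp ≠ 0 ∨ sm ≠ 0) :
    M2 sp sm = normConst sp sm ^ 2 * (∫ g, act sp sm g ^ 4 ∂stdGauss) - 1 := by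
  have hm := measurable_act sp sm
  unfold M2
  rw [variance_eq_sub, integral_const_mul, normConst_mul_integral hs]
  · have : ((fun g => normConst sp sm * act sp sm g ^ 2) ^ 2) =
        fun g => normConst sp sm ^ 2 * act sp sm g ^ 4 := by
      funext g; simp only [Pi.pow_apply]; ring
    rw [this, integral_const_mul, one_pow]
  · rw [memLp_two_iff_integrable_sq (by fun_prop)]
    have : (fun g => (normConst sp sm * act sp sm g ^ 2) ^ 2) =
        fun g => normConst sp sm ^ 2 * act sp sm g ^ (2 * 2) := by
      funext g; ring
    rw [this]
    exact (integrable_act_pow_even sp sm 2).const_mul _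

/-! ## The linearized correlation -/

/-- The contribution of one neuron to the linearization of the correlation at its mean. -/
noncomputable def corrLin (sp sm ρ : ℝ) (y : ℝ × ℝ) : ℝ :=
  normConst sp sm * (act sp sm y.1 * act sp sm (ρ * y.1 + √(1 - ρ ^ 2) * y.2)) -
    normConst sp sm * K sp sm 1 1 ρ / 2 * (normConst sp sm * act sp sm y.1 ^ 2 +
      normConst sp sm * act sp sm (ρ * y.1 + √(1 - ρ ^ 2) * y.2) ^ 2)

lemma measurable_corrLin (sp sm ρ : ℝ) : Measurable (corrLin sp sm ρ) := by
  have h := measurable_act sp sm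
  unfold corrLin
  fun_prop

/-- A bound of the linearized correlation by the squared norm. -/
noncomputable def corrLinBound (sp sm : ℝ) : ℝ :=
  normConst sp sm * (|sp| + |sm|) ^ 2 + 2 * normConst sp sm ^ 2 * (|sp| + |sm|) ^ 4

lemma corrLinBound_nonneg {sp sm : ℝ} (hs : sp ≠ 0 ∨ sm ≠ 0) : 0 ≤ corrLinBound sp sm := by
  have := normConst_pos hs
  unfold corrLinBound
  positivity

lemma abs_corrLin_le {sp sm : ℝ} (hs : sp ≠ 0 ∨ sm ≠ 0) {ρ : ℝ} (hρ : ρ ∈ Icc (-1 : ℝ) 1)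
    (y : ℝ × ℝ) : |corrLin sp sm ρ y| ≤ corrLinBound sp sm * (y.1 ^ 2 + y.2 ^ 2) := by
  have hc := normConst_pos hs
  have h11 := abs_act_mul_le sp sm (p := 1) (r := 1) (k := 1) rfl hρ y
  have h20 := abs_act_mul_le sp sm (p := 2) (r := 0) (k := 1) rfl hρ y
  have h02 := abs_act_mul_le sp sm (p := 0) (r := 2) (k := 1) rfl hρ y
  have hK := abs_K_le sp sm (p := 1) (r := 1) (k := 1) rfl hρ
  simp only [pow_one, pow_zero, mul_one, one_mul, Nat.factorial, Nat.cast_one] at h11 h20 h02 hK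
  unfold corrLin corrLinBound
  set c := normConst sp sm
  set S := (|sp| + |sm|) with hS
  set N := y.1 ^ 2 + y.2 ^ 2 with hN
  have hN0 : 0 ≤ N := by positivity
  have hsum : |c * act sp sm y.1 ^ 2 + c * act sp sm (ρ * y.1 + √(1 - ρ ^ 2) * y.2) ^ 2| ≤
      2 * c * (S ^ 2 * N) := by
    rw [← mul_add, abs_mul, abs_of_pos hc]
    have := (abs_add_le (act sp sm y.1 ^ 2)
      (act sp sm (ρ * y.1 + √(1 - ρ ^ 2) * y.2) ^ 2)).trans (add_le_add h20 h02)
    nlinarith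
  refine (abs_sub _ _).trans ?_
  rw [abs_mul c, abs_of_pos hc, abs_mul (c * _ / 2), abs_div, abs_mul c, abs_of_pos hc, abs_two]
  have h3 : c * |K sp sm 1 1 ρ| / 2 ≤ c * S ^ 2 := by
    nlinarith
  have h4 := mul_le_mul h3 hsum (abs_nonneg _) (by positivity)
  have h5 := mul_le_mul_of_nonneg_left h11 hc.le
  calc _ ≤ c * (S ^ 2 * N) + c * S ^ 2 * (2 * c * (S ^ 2 * N)) := add_le_add h5 h4
    _ = _ := by ring

lemma integral_corrLin {sp sm : ℝ} (hs : sp ≠ 0 ∨ sm ≠ 0) {ρ : ℝ} (hρ : ρ ∈ Icc (-1 : ℝ) 1) :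
    ∫ y, corrLin sp sm ρ y ∂(stdGauss.prod stdGauss) = 0 := by
  have h11 := integrable_act_mul sp sm (p := 1) (r := 1) (k := 1) rfl hρ
  have h20 := integrable_act_mul sp sm (p := 2) (r := 0) (k := 1) rfl hρ
  have h02 := integrable_act_mul sp sm (p := 0) (r := 2) (k := 1) rfl hρ
  have k20 := K_zero_right sp sm 2 ρ
  have k02 := (K_comm sp sm 0 2 hρ).trans k20
  have hc := normConst_mul_integral hs
  -- Only one side is unfolded: `K sp sm 1 1 ρ` also occurs as a coefficient in `corrLin` and has to
  -- stay folded there.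
  have k11 : K sp sm 1 1 ρ = K sp sm 1 1 ρ := rfl
  conv_rhs at k11 => unfold K
  unfold K at k20 k02
  simp only [pow_zero, mul_one, one_mul, pow_one] at h11 h20 h02 k20 k02 k11
  unfold corrLin
  rw [integral_sub, integral_const_mul, integral_const_mul, integral_add, integral_const_mul,
    integral_const_mul, k20, k02, ← k11, hc]
  · ring
  · exact h20.const_mul _
  · exact h02.const_mul _
  · exact h11.const_mul _
  · exact ((h20.const_mul _).add (h02.const_mul _)).const_mul _

/-- This is the origin of the formula for `σ²_ReLU`, and of its nonnegativity. After expansion,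
symmetry identifies `K_{1,3}` with `K_{3,1}`, and `c² K_{4,0} = c² K_{0,4} = M₂ + 1`. -/
lemma integral_corrLin_sq {sp sm : ℝ} (hs : sp ≠ 0 ∨ sm ≠ 0) {ρ : ℝ}
    (hρ : ρ ∈ Icc (-1 : ℝ) 1) :
    ∫ y, corrLin sp sm ρ y ^ 2 ∂(stdGauss.prod stdGauss) = sigmaSqReLU sp sm ρ := by
  have h22 := integrable_act_mul sp sm (p := 2) (r := 2) (k := 2) rfl hρ
  have h31 := integrable_act_mul sp sm (p := 3) (r := 1) (k := 2) rfl hρ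
  have h13 := integrable_act_mul sp sm (p := 1) (r := 3) (k := 2) rfl hρ
  have h40 := integrable_act_mul sp sm (p := 4) (r := 0) (k := 2) rfl hρ
  have h04 := integrable_act_mul sp sm (p := 0) (r := 4) (k := 2) rfl hρ
  have k40 := K_zero_right sp sm 4 ρ
  have k04 := (K_comm sp sm 0 4 hρ).trans k40
  have k13 := K_comm sp sm 1 3 hρ
  have hM := M2_eq hs
  unfold sigmaSqReLU
  set c := normConst sp sm with hc
  set k1 := K sp sm 1 1 ρ with hk1
  have key : ∀ y, corrLin sp sm ρ y ^ 2 =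
      ((c ^ 2 + c ^ 4 * k1 ^ 2 / 2) * (act sp sm y.1 ^ 2 *
        act sp sm (ρ * y.1 + √(1 - ρ ^ 2) * y.2) ^ 2) +
      (-(c ^ 3 * k1)) * (act sp sm y.1 ^ 3 * act sp sm (ρ * y.1 + √(1 - ρ ^ 2) * y.2) ^ 1)) +
      ((-(c ^ 3 * k1)) * (act sp sm y.1 ^ 1 * act sp sm (ρ * y.1 + √(1 - ρ ^ 2) * y.2) ^ 3) +
      (c ^ 4 * k1 ^ 2 / 4 * (act sp sm y.1 ^ 4 * act sp sm (ρ * y.1 + √(1 - ρ ^ 2) * y.2) ^ 0) +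
      c ^ 4 * k1 ^ 2 / 4 * (act sp sm y.1 ^ 0 *
        act sp sm (ρ * y.1 + √(1 - ρ ^ 2) * y.2) ^ 4))) := by
    intro y
    unfold corrLin
    rw [← hc, ← hk1]
    ring
  simp only [key]
  rw [integral_add, integral_add, integral_add, integral_add, integral_const_mul,
    integral_const_mul, integral_const_mul, integral_const_mul, integral_const_mul]
  · change (c ^ 2 + c ^ 4 * k1 ^ 2 / 2) * K sp sm 2 2 ρ + -(c ^ 3 * k1) * K sp sm 3 1 ρ +
      (-(c ^ 3 * k1) * K sp sm 1 3 ρ + (c ^ 4 * k1 ^ 2 / 4 * K sp sm 4 0 ρ +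
        c ^ 4 * k1 ^ 2 / 4 * K sp sm 0 4 ρ)) = _
    rw [k13, k40, k04, hM]
    ring
  · exact h40.const_mul _
  · exact h04.const_mul _
  · exact h13.const_mul _
  · exact (h40.const_mul _).add (h04.const_mul _)
  · exact h22.const_mul _
  · exact h31.const_mul _
  · exact (h22.const_mul _).add (h31.const_mul _)
  · exact (h13.const_mul _).add ((h40.const_mul _).add (h04.const_mul _))

lemma sigmaSqReLU_nonneg {sp sm : ℝ} (hs : sp ≠ 0 ∨ sm ≠ 0) {ρ : ℝ}
    (hρ : ρ ∈ Icc (-1 : ℝ) 1) : 0 ≤ sigmaSqReLU sp sm ρ := by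
  rw [← integral_corrLin_sq hs hρ]
  exact integral_nonneg fun y => sq_nonneg _

lemma corrLin_smul (sp sm ρ : ℝ) {t : ℝ} (ht : 0 < t) (a b : ℝ) :
    corrLin sp sm ρ (t * a, t * b) = t ^ 2 * corrLin sp sm ρ (a, b) := by
  unfold corrLin
  simp only
  rw [show ρ * (t * a) + √(1 - ρ ^ 2) * (t * b) = t * (ρ * a + √(1 - ρ ^ 2) * b) by ring,
    act_mul_of_nonneg _ _ ht.le, act_mul_of_nonneg _ _ ht.le]
  ring

lemma integrable_abs_corrLin_pow_three {sp sm : ℝ} (hs : sp ≠ 0 ∨ sm ≠ 0) {ρ : ℝ}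
    (hρ : ρ ∈ Icc (-1 : ℝ) 1) :
    Integrable (fun y => |corrLin sp sm ρ y| ^ 3) (stdGauss.prod stdGauss) := by
  have := measurable_corrLin sp sm ρ
  refine integrable_of_abs_le_normSq_pow (by fun_prop)
    (C := corrLinBound sp sm ^ 3) (k := 3) fun y => ?_
  rw [abs_pow, abs_abs, ← mul_pow]
  exact pow_le_pow_left₀ (abs_nonneg _) (abs_corrLin_le hs hρ y) 3

/-- The third absolute moment is controlled by the variance, uniformly in `ρ`: the squared radius
is independent of the angular part. -/
lemma integral_abs_corrLin_pow_three_le {sp sm : ℝ} (hs : sp ≠ 0 ∨ sm ≠ 0) {ρ : ℝ}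
    (hρ : ρ ∈ Icc (-1 : ℝ) 1) :
    ∫ y, |corrLin sp sm ρ y| ^ 3 ∂(stdGauss.prod stdGauss) ≤
      6 * corrLinBound sp sm * sigmaSqReLU sp sm ρ := by
  have hm := measurable_corrLin sp sm ρ
  -- Both integrals have the same angular part; the radial factors are `2³ 3! = 48` and `2² 2! = 8`,
  -- whose ratio is `6`.
  have h2 : ∫ y : ℝ × ℝ, (y.1 ^ 2 + y.2 ^ 2) * corrLin sp sm ρ y ^ 2 ∂(stdGauss.prod stdGauss) =
      6 * sigmaSqReLU sp sm ρ := by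
    rw [← integral_corrLin_sq hs hρ, integral_homogeneous (k := 3), integral_homogeneous (k := 2)]
    · simp only [Real.cos_sq_add_sin_sq, one_mul, Nat.factorial]
      push_cast
      ring
    · intro r hr a b
      rw [corrLin_smul _ _ _ hr]
      ring
    · intro r hr a b
      simp only
      rw [corrLin_smul _ _ _ hr]
      ring
  calc ∫ y, |corrLin sp sm ρ y| ^ 3 ∂(stdGauss.prod stdGauss)
      ≤ ∫ y : ℝ × ℝ, corrLinBound sp sm * ((y.1 ^ 2 + y.2 ^ 2) * corrLin sp sm ρ y ^ 2)
          ∂(stdGauss.prod stdGauss) := by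
        refine integral_mono (integrable_abs_corrLin_pow_three hs hρ) ?_ fun y => ?_
        · refine Integrable.const_mul (integrable_of_abs_le_normSq_pow (by fun_prop)
            (C := corrLinBound sp sm ^ 2) (k := 3) fun y => ?_) _
          rw [abs_mul, abs_pow, abs_of_nonneg (by positivity)]
          have := pow_le_pow_left₀ (abs_nonneg _) (abs_corrLin_le hs hρ y) 2
          calc _ ≤ (y.1 ^ 2 + y.2 ^ 2) * (corrLinBound sp sm * (y.1 ^ 2 + y.2 ^ 2)) ^ 2 := by
                gcongr
            _ = _ := by ring
        · have := abs_corrLin_le hs hρ y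
          calc |corrLin sp sm ρ y| ^ 3 = |corrLin sp sm ρ y| * corrLin sp sm ρ y ^ 2 := by
                rw [← sq_abs (corrLin sp sm ρ y)]; ring
            _ ≤ corrLinBound sp sm * (y.1 ^ 2 + y.2 ^ 2) * corrLin sp sm ρ y ^ 2 := by gcongr
            _ = _ := by ring
    _ = 6 * corrLinBound sp sm * sigmaSqReLU sp sm ρ := by
        rw [integral_const_mul, h2]; ring

end ReLUNet

namespace ReLUNet

open Filter Topology

/-! ## Stein's equation for Lipschitz test functions -/

/-- Comparison principle from infinity: with the integrating factor `exp (-t²/2)` the function is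
nondecreasing on `[x, ∞)` and tends to `0`. -/
lemma nonpos_of_mul_le_deriv {d d' : ℝ → ℝ} {x : ℝ} (hd : ∀ t, x ≤ t → HasDerivAt d (d' t) t)
    (h : ∀ t, x ≤ t → t * d t ≤ d' t)
    (hlim : Tendsto (fun t => d t * Real.exp (-(t ^ 2 / 2))) atTop (𝓝 0)) : d x ≤ 0 := by
  have hw : ∀ t, x ≤ t → HasDerivAt (fun t => d t * Real.exp (-(t ^ 2 / 2)))
      ((d' t - t * d t) * Real.exp (-(t ^ 2 / 2))) t := by
    intro t ht
    have h1 : HasDerivAt (fun t : ℝ => -(t ^ 2 / 2)) (-t) t := by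
      refine (((hasDerivAt_id t).pow 2).div_const 2).neg.congr_deriv ?_
      simp
    refine ((hd t ht).mul h1.exp).congr_deriv ?_
    ring
  have hmono : MonotoneOn (fun t => d t * Real.exp (-(t ^ 2 / 2))) (Ici x) := by
    refine monotoneOn_of_hasDerivWithinAt_nonneg (convex_Ici x)
      (fun t ht => (hw t ht).continuousAt.continuousWithinAt)
      (fun t ht => (hw t (interior_subset ht)).hasDerivWithinAt) fun t ht => ?_
    exact mul_nonneg (sub_nonneg.2 (h t (interior_subset ht))) (Real.exp_pos _).le
  have : d x * Real.exp (-(x ^ 2 / 2)) ≤ 0 :=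
    ge_of_tendsto hlim ((eventually_ge_atTop x).mono fun t ht =>
      hmono self_mem_Ici ht ht)
  exact nonpos_of_mul_nonpos_left this (Real.exp_pos _)

lemma tendsto_abs_add_one_mul_exp_neg_sq :
    Tendsto (fun t : ℝ => (1 + |t|) * Real.exp (-(t ^ 2 / 2))) atTop (𝓝 0) := by
  have h1 : Tendsto (fun t : ℝ => (1 + t) * Real.exp (-t)) atTop (𝓝 0) := by
    have h0 := Real.tendsto_pow_mul_exp_neg_atTop_nhds_zero 0
    have h1 := Real.tendsto_pow_mul_exp_neg_atTop_nhds_zero 1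
    simpa [add_mul] using h0.add h1
  refine squeeze_zero' (Eventually.of_forall fun t => by positivity) ?_ h1
  filter_upwards [eventually_ge_atTop 2] with t ht
  rw [abs_of_nonneg (by linarith)]
  gcongr
  nlinarith

lemma tendsto_mul_exp_neg_sq_of_le {u : ℝ → ℝ} {C : ℝ} (hu : ∀ t, |u t| ≤ C * (1 + |t|)) :
    Tendsto (fun t => u t * Real.exp (-(t ^ 2 / 2))) atTop (𝓝 0) := by
  have h := tendsto_abs_add_one_mul_exp_neg_sq.const_mul C
  rw [mul_zero] at h
  refine squeeze_zero_norm (fun t => ?_) h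
  rw [Real.norm_eq_abs, abs_mul, abs_of_pos (Real.exp_pos _), ← mul_assoc]
  exact mul_le_mul_of_nonneg_right (hu t) (Real.exp_pos _).le

/-- Comparison with the barrier `L + 2L/(1 + t)`. The constant `L` absorbs the linear growth of `H`,
the second term absorbs the remaining `L`, and the barrier is at most `3L` on `[0, ∞)`. -/
lemma stein_le_of_nonneg {f H : ℝ → ℝ} {L : ℝ} (hL : 0 ≤ L)
    (hf : ∀ t, HasDerivAt f (t * f t + H t) t) (hH : ∀ t, |H t| ≤ L * (1 + |t|))
    (hlim : Tendsto (fun t => f t * Real.exp (-(t ^ 2 / 2))) atTop (𝓝 0)) {x : ℝ} (hx : 0 ≤ x) :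
    f x ≤ 3 * L := by
  have key : f x - (L + 2 * L * (1 + x)⁻¹) ≤ 0 := by
    refine nonpos_of_mul_le_deriv (d := fun t => f t - (L + 2 * L * (1 + t)⁻¹))
      (d' := fun t => t * f t + H t - 2 * L * (-1 / (1 + t) ^ 2)) (fun t ht => ?_)
      (fun t ht => ?_) ?_
    · have h1 : HasDerivAt (fun t : ℝ => (1 + t)⁻¹) (-1 / (1 + t) ^ 2) t :=
        ((hasDerivAt_id t).const_add 1).inv (by simp only [id]; linarith)
      exact (hf t).sub ((h1.const_mul (2 * L)).const_add L)
    · have ht0 : 0 ≤ t := hx.trans ht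
      have h1 := (abs_le.1 (hH t)).1
      rw [abs_of_nonneg ht0] at h1
      have h2 : 0 ≤ 2 * L * t * (1 + t)⁻¹ + 2 * L * (1 / (1 + t) ^ 2) - L := by
        have : 2 * L * t * (1 + t)⁻¹ + 2 * L * (1 / (1 + t) ^ 2) - L =
            L * (1 + t ^ 2) / (1 + t) ^ 2 := by
          field_simp
          ring
        rw [this]
        positivity
      have h3 : (-1 : ℝ) / (1 + t) ^ 2 = -(1 / (1 + t) ^ 2) := by ring
      rw [h3]
      nlinarith
    -- The growth lemma needs a bound on all of `ℝ`, where `(1 + t)⁻¹` is unbounded. The barrier is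
    -- therefore clipped to `[-3L, 3L]`, which changes nothing for `t ≥ 0`.
    · have h1 : Tendsto (fun t => f t * Real.exp (-(t ^ 2 / 2)) -
          max (-(3 * L)) (min (3 * L) (L + 2 * L * (1 + t)⁻¹)) * Real.exp (-(t ^ 2 / 2)))
          atTop (𝓝 (0 - 0)) := by
        refine hlim.sub (tendsto_mul_exp_neg_sq_of_le (C := 3 * L) fun t => ?_)
        have : |max (-(3 * L)) (min (3 * L) (L + 2 * L * (1 + t)⁻¹))| ≤ 3 * L :=
          abs_le.2 ⟨le_max_left _ _, max_le (by linarith) (min_le_left _ _)⟩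
        nlinarith [mul_nonneg hL (abs_nonneg t)]
      rw [sub_zero] at h1
      refine h1.congr' ?_
      filter_upwards [eventually_ge_atTop 0] with t ht
      have h2 : (1 + t)⁻¹ ≤ 1 := inv_le_one_of_one_le₀ (by linarith)
      have h3 : 0 ≤ (1 + t)⁻¹ := by positivity
      rw [min_eq_right (by nlinarith), max_eq_right (by nlinarith [mul_nonneg hL h3]), sub_mul]
  have h2 : (1 + x)⁻¹ ≤ 1 := inv_le_one_of_one_le₀ (by linarith)
  nlinarith

/-- For `x > 0` the constant `M / x` is a barrier on `[x, ∞)`, because `t (M / x) ≥ M` there. -/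
lemma stein_mul_le_of_nonneg {u F : ℝ → ℝ} {M : ℝ} (hM : 0 ≤ M)
    (hu : ∀ t, HasDerivAt u (t * u t + F t) t) (hF : ∀ t, |F t| ≤ M)
    (hlim : Tendsto (fun t => u t * Real.exp (-(t ^ 2 / 2))) atTop (𝓝 0)) {x : ℝ} (hx : 0 ≤ x) :
    x * u x ≤ M := by
  rcases hx.eq_or_lt with rfl | hx
  · simpa
  have key : u x - M / x ≤ 0 := by
    refine nonpos_of_mul_le_deriv (d := fun t => u t - M / x)
      (d' := fun t => t * u t + F t) (fun t ht => (hu t).sub_const _) (fun t ht => ?_) ?_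
    · have h1 := (abs_le.1 (hF t)).1
      have h2 : M ≤ t * (M / x) := by
        rw [← mul_div_assoc, le_div_iff₀ hx]
        nlinarith
      nlinarith
    · have h1 := hlim.sub (tendsto_mul_exp_neg_sq_of_le (u := fun _ => M / x) (C := M / x)
        fun t => by
          rw [abs_of_nonneg (by positivity)]
          nlinarith [mul_nonneg (div_nonneg hM hx.le) (abs_nonneg t)])
      simpa [sub_mul] using h1
  rw [sub_nonpos, le_div_iff₀ hx] at key
  linarith

/-- One-sided bounds for solutions of Stein-type equations give two-sided ones, by symmetry. -/
lemma stein_hasDerivAt_neg {f H : ℝ → ℝ} (hf : ∀ t, HasDerivAt f (t * f t + H t) t) (t : ℝ) :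
    HasDerivAt (fun t => -f t) (t * -f t + -H t) t ∧
    HasDerivAt (fun t => f (-t)) (t * f (-t) + -H (-t)) t ∧
    HasDerivAt (fun t => -f (-t)) (t * -f (-t) + H (-t)) t := by
  have h2 : HasDerivAt (fun t => f (-t)) ((-t * f (-t) + H (-t)) * -1) t :=
    (hf (-t)).comp t (hasDerivAt_neg t)
  refine ⟨(hf t).neg.congr_deriv (by ring), h2.congr_deriv (by ring), h2.neg.congr_deriv (by ring)⟩

lemma stein_abs_le {f H : ℝ → ℝ} {L : ℝ} (hL : 0 ≤ L)
    (hf : ∀ t, HasDerivAt f (t * f t + H t) t) (hH : ∀ t, |H t| ≤ L * (1 + |t|))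
    (hlim : Tendsto (fun t => f t * Real.exp (-(t ^ 2 / 2))) atTop (𝓝 0))
    (hlim' : Tendsto (fun t => f (-t) * Real.exp (-(t ^ 2 / 2))) atTop (𝓝 0)) (x : ℝ) :
    |f x| ≤ 3 * L := by
  have hH' : ∀ t, |-H t| ≤ L * (1 + |t|) := fun t => by rw [abs_neg]; exact hH t
  have hHn : ∀ t, |H (-t)| ≤ L * (1 + |t|) := fun t => by simpa using hH (-t)
  have hHn' : ∀ t, |-H (-t)| ≤ L * (1 + |t|) := fun t => by rw [abs_neg]; exact hHn t
  have hd := stein_hasDerivAt_neg hf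
  rcases le_total 0 x with hx | hx
  · have h1 := stein_le_of_nonneg hL hf hH hlim hx
    have h2 := stein_le_of_nonneg hL (fun t => (hd t).1) hH' (by simpa using hlim.neg) hx
    exact abs_le.2 ⟨by linarith, h1⟩
  · have h1 := stein_le_of_nonneg hL (fun t => (hd t).2.1) hHn' hlim' (neg_nonneg.2 hx)
    have h2 := stein_le_of_nonneg hL (fun t => (hd t).2.2) hHn (by simpa using hlim'.neg)
      (neg_nonneg.2 hx)
    rw [neg_neg] at h1 h2
    exact abs_le.2 ⟨by linarith, h1⟩

lemma stein_abs_mul_le {f H : ℝ → ℝ} {L : ℝ} (hL : 0 ≤ L)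
    (hf : ∀ t, HasDerivAt f (t * f t + H t) t) (hH : ∀ t, |H t| ≤ L)
    (hlim : Tendsto (fun t => f t * Real.exp (-(t ^ 2 / 2))) atTop (𝓝 0))
    (hlim' : Tendsto (fun t => f (-t) * Real.exp (-(t ^ 2 / 2))) atTop (𝓝 0)) (x : ℝ) :
    |x * f x| ≤ L := by
  have hH' : ∀ t, |-H t| ≤ L := fun t => by rw [abs_neg]; exact hH t
  have hHn : ∀ t, |H (-t)| ≤ L := fun t => hH (-t)
  have hHn' : ∀ t, |-H (-t)| ≤ L := fun t => by rw [abs_neg]; exact hHn t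
  have hd := stein_hasDerivAt_neg hf
  rcases le_total 0 x with hx | hx
  · have h1 := stein_mul_le_of_nonneg hL hf hH hlim hx
    have h2 := stein_mul_le_of_nonneg hL (fun t => (hd t).1) hH' (by simpa using hlim.neg) hx
    exact abs_le.2 ⟨by linarith, h1⟩
  · have h1 := stein_mul_le_of_nonneg hL (fun t => (hd t).2.1) hHn' hlim' (neg_nonneg.2 hx)
    have h2 := stein_mul_le_of_nonneg hL (fun t => (hd t).2.2) hHn (by simpa using hlim'.neg)
      (neg_nonneg.2 hx)
    rw [neg_neg] at h1 h2
    exact abs_le.2 ⟨by linarith, by linarith⟩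

/-- The solution is `exp (t²/2)` times the integral of `H s exp (-s²/2)` over `s ≤ t`. That integral
vanishes at both ends of the line since `H` is centred. -/
lemma exists_stein_antideriv {H : ℝ → ℝ} (hH : Continuous H) (hint : Integrable H stdGauss)
    (h0 : ∫ t, H t ∂stdGauss = 0) :
    ∃ f : ℝ → ℝ, (∀ t, HasDerivAt f (t * f t + H t) t) ∧
      Tendsto (fun t => f t * Real.exp (-(t ^ 2 / 2))) atTop (𝓝 0) ∧
      Tendsto (fun t => f (-t) * Real.exp (-(t ^ 2 / 2))) atTop (𝓝 0) := by
  set p : ℝ → ℝ := fun t => H t * Real.exp (-(t ^ 2 / 2)) with hp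
  have hpc : Continuous p := by fun_prop
  have hpdf : ∀ t, gaussianPDFReal 0 1 t • H t = (√(2 * Real.pi))⁻¹ * p t := fun t => by
    simp only [gaussianPDFReal, hp, smul_eq_mul, sub_zero, NNReal.coe_one, mul_one]
    rw [neg_div]
    ring
  have hne : (√(2 * Real.pi))⁻¹ ≠ 0 := inv_ne_zero (Real.sqrt_pos.2 (by positivity)).ne'
  have hpint : Integrable p := by
    have h1 : Integrable (fun t => gaussianPDFReal 0 1 t • H t) := by
      rw [stdGauss, gaussianReal_of_var_ne_zero 0 one_ne_zero,
        integrable_withDensity_iff_integrable_smul' (measurable_gaussianPDF 0 1)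
          (ae_of_all _ fun _ => gaussianPDF_lt_top)] at hint
      simpa only [toReal_gaussianPDF] using hint
    simp only [hpdf] at h1
    exact (integrable_const_mul_iff (IsUnit.mk0 _ hne) p).1 h1
  have hp0 : ∫ t, p t = 0 := by
    rw [stdGauss, integral_gaussianReal_eq_integral_smul one_ne_zero] at h0
    simp only [hpdf, integral_const_mul] at h0
    exact (mul_eq_zero.1 h0).resolve_left hne
  set I : ℝ → ℝ := fun x => ∫ t in Iic x, p t with hI
  have hId : ∀ x, HasDerivAt I (p x) x := by
    intro x
    have h1 : I = fun x => I 0 + ∫ t in (0 : ℝ)..x, p t := by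
      funext x
      rw [← intervalIntegral.integral_Iic_sub_Iic hpint.integrableOn hpint.integrableOn]
      simp only [hI]
      ring
    rw [h1]
    exact (intervalIntegral.integral_hasDerivAt_right (hpc.intervalIntegrable _ _)
      (hpc.stronglyMeasurableAtFilter _ _) hpc.continuousAt).const_add _
  have htop : Tendsto I atTop (𝓝 0) := by
    rw [← hp0]
    exact (aecover_Iic tendsto_id).integral_tendsto_of_countably_generated hpint
  have hbot : Tendsto I atBot (𝓝 0) := by
    have h1 : I = fun x => -∫ t in Ioi x, p t := by
      funext x
      have := intervalIntegral.integral_Iic_add_Ioi (b := x) hpint.integrableOn hpint.integrableOn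
      rw [hp0] at this
      simp only [hI]
      linarith
    rw [h1, ← neg_zero, ← hp0]
    exact ((aecover_Ioi tendsto_id).integral_tendsto_of_countably_generated hpint).neg
  have hexp : ∀ t : ℝ, Real.exp (t ^ 2 / 2) * Real.exp (-(t ^ 2 / 2)) = 1 := fun t => by
    rw [← Real.exp_add, add_neg_cancel, Real.exp_zero]
  refine ⟨fun t => Real.exp (t ^ 2 / 2) * I t, fun t => ?_, ?_, ?_⟩
  · have h1 : HasDerivAt (fun t : ℝ => t ^ 2 / 2) t t := by
      refine (((hasDerivAt_id t).pow 2).div_const 2).congr_deriv ?_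
      simp
    refine (h1.exp.mul (hId t)).congr_deriv ?_
    simp only [hp]
    linear_combination H t * hexp t
  · refine htop.congr fun t => ?_
    linear_combination -I t * hexp t
  · refine (hbot.comp tendsto_neg_atTop_atBot).congr fun t => ?_
    simp only [Function.comp_apply, neg_sq]
    linear_combination -I (-t) * hexp t

end ReLUNet

namespace ReLUNet

open Filter Topology

/-! ### Bounded Stein solutions and the central limit error -/

lemma integrable_id_stdGauss : Integrable (fun t : ℝ => t) stdGauss :=
  (memLp_id_gaussianReal' 1 ENNReal.one_ne_top).integrable le_rfl

lemma integrable_sq_stdGauss : Integrable (fun t : ℝ => t ^ 2) stdGauss :=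
  (memLp_id_gaussianReal' (μ := 0) (v := 1) 2 ENNReal.ofNat_ne_top).integrable_sq

lemma integral_sq_stdGauss : ∫ t, t ^ 2 ∂stdGauss = 1 := by
  have h := integral_act_sq 1 1
  have : ∀ t : ℝ, act 1 1 t = t := fun t => by simp [act, max_add_min]
  simp only [this] at h
  rw [h]
  norm_num

lemma integral_abs_stdGauss_le : ∫ t, |t| ∂stdGauss ≤ 1 := by
  calc ∫ t, |t| ∂stdGauss ≤ ∫ t, (1 + t ^ 2) / 2 ∂stdGauss := by
        refine integral_mono integrable_id_stdGauss.abs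
          (((integrable_const _).add integrable_sq_stdGauss).div_const _) fun t => ?_
        simp only
        nlinarith [sq_nonneg (|t| - 1), sq_abs t]
    _ = 1 := by
        rw [integral_div, integral_add (integrable_const _) integrable_sq_stdGauss,
          integral_sq_stdGauss]
        simp

lemma continuous_of_abs_sub_le {h : ℝ → ℝ} {L : ℝ} (hh : ∀ x y, |h x - h y| ≤ L * |x - y|) :
    Continuous h := by
  have : LipschitzWith L.toNNReal h := LipschitzWith.of_dist_le_mul fun x y => by
    rw [Real.dist_eq, Real.dist_eq]
    exact (hh x y).trans (mul_le_mul_of_nonneg_right (Real.le_coe_toNNReal L) (abs_nonneg _))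
  exact this.continuous

lemma integrable_comp_of_abs_sub_le {Ω : Type*} [MeasurableSpace Ω] {P : Measure Ω}
    [IsFiniteMeasure P] {h : ℝ → ℝ} {L : ℝ} (hh : ∀ x y, |h x - h y| ≤ L * |x - y|)
    {S : Ω → ℝ} (hS : Integrable S P) : Integrable (fun ω => h (S ω)) P := by
  refine (((hS.abs.const_mul L).add (integrable_const |h 0|))).mono'
    ((continuous_of_abs_sub_le hh).comp_aestronglyMeasurable hS.1) (ae_of_all _ fun ω => ?_)
  have h1 := hh (S ω) 0
  rw [sub_zero] at h1
  have h2 := abs_add_le (h (S ω) - h 0) (h 0)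
  rw [sub_add_cancel] at h2
  exact h2.trans (add_le_add h1 le_rfl)

lemma abs_integral_le_of_abs_le {Ω : Type*} [MeasurableSpace Ω] {P : Measure Ω} {f g : Ω → ℝ}
    (hg : Integrable g P) (h : ∀ ω, |f ω| ≤ g ω) : |∫ ω, f ω ∂P| ≤ ∫ ω, g ω ∂P :=
  norm_integral_le_of_norm_le (f := f) hg (ae_of_all _ h)

/-- The bounded solution of Stein's equation for a smooth Lipschitz test function. -/
lemma exists_stein_solution {h h' : ℝ → ℝ} {L : ℝ} (hL : 0 ≤ L)
    (hd : ∀ t, HasDerivAt h (h' t) t) (hb : ∀ t, |h' t| ≤ L) :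
    ∃ f f' : ℝ → ℝ, (∀ t, HasDerivAt f (f' t) t) ∧
      (∀ t, f' t - t * f t = h t - ∫ s, h s ∂stdGauss) ∧ (∀ t, |f t| ≤ 3 * L) ∧
      ∀ s t, |f' s - f' t| ≤ 8 * L * |s - t| := by
  have hlip : ∀ x y, |h x - h y| ≤ L * |x - y| := fun x y => by
    have := convex_univ.norm_image_sub_le_of_norm_hasDerivWithin_le (f := h) (f' := h') (C := L)
      (fun t _ => (hd t).hasDerivWithinAt) (fun t _ => hb t) (mem_univ y) (mem_univ x)
    exact this
  have hhint : Integrable h stdGauss := integrable_comp_of_abs_sub_le hlip integrable_id_stdGauss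
  set m := ∫ s, h s ∂stdGauss with hm
  set H : ℝ → ℝ := fun t => h t - m with hH
  have hHd : ∀ t, HasDerivAt H (h' t) t := fun t => (hd t).sub_const m
  have hHb : ∀ t, |H t| ≤ L * (1 + |t|) := by
    intro t
    have h1 : H t = ∫ s, (h t - h s) ∂stdGauss := by
      rw [integral_sub (integrable_const _) hhint]
      simp [hH, hm]
    rw [h1]
    have h2 : ∀ s, |h t - h s| ≤ L * |t| + L * |s| := fun s =>
      (hlip t s).trans (by nlinarith [abs_sub t s])
    calc |∫ s, (h t - h s) ∂stdGauss| ≤ ∫ s, (L * |t| + L * |s|) ∂stdGauss :=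
          abs_integral_le_of_abs_le ((integrable_const _).add
            (integrable_id_stdGauss.abs.const_mul L)) h2
      _ = L * |t| + L * ∫ s, |s| ∂stdGauss := by
          rw [integral_add (integrable_const _) (integrable_id_stdGauss.abs.const_mul L),
            integral_const_mul L fun s : ℝ => |s|]
          simp
      _ ≤ L * (1 + |t|) := by nlinarith [integral_abs_stdGauss_le]
  have hHc : Continuous H := continuous_iff_continuousAt.2 fun t => (hHd t).continuousAt
  have hH0 : ∫ t, H t ∂stdGauss = 0 := by
    rw [integral_sub hhint (integrable_const _)]
    simp [hm]
  obtain ⟨f, hf, hlim, hlim'⟩ := exists_stein_antideriv hHc (hhint.sub (integrable_const _)) hH0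
  have hfb := stein_abs_le hL hf hHb hlim hlim'
  set u : ℝ → ℝ := fun t => t * f t + H t with hu
  set F : ℝ → ℝ := fun t => f t + h' t with hF
  -- The derivative `u = f'` solves an equation of the same type, with right-hand side `f + h'`
  -- bounded by `4L`. So `|t u t| ≤ 4L`, and `|u'| ≤ 8L`.
  have hud : ∀ t, HasDerivAt u (t * u t + F t) t := fun t => by
    refine (((hasDerivAt_id t).mul (hf t)).add (hHd t)).congr_deriv ?_
    simp only [hu, hF, id]
    ring
  have hFb : ∀ t, |F t| ≤ 4 * L := fun t =>
    (abs_add_le _ _).trans (by linarith [hfb t, hb t])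
  have hub : ∀ t, |u t| ≤ 4 * L * (1 + |t|) := fun t => by
    refine (abs_add_le _ _).trans ?_
    rw [abs_mul]
    have := mul_le_mul_of_nonneg_left (hfb t) (abs_nonneg t)
    nlinarith [hHb t]
  have hxu := stein_abs_mul_le (by linarith) hud hFb (tendsto_mul_exp_neg_sq_of_le hub)
    (tendsto_mul_exp_neg_sq_of_le (u := fun t => u (-t)) fun t => by simpa using hub (-t))
  refine ⟨f, u, hf, fun t => by simp only [hu]; ring, hfb, fun s t => ?_⟩
  exact convex_univ.norm_image_sub_le_of_norm_hasDerivWithin_le (f := u)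
    (f' := fun t => t * u t + F t) (C := 8 * L) (fun t _ => (hud t).hasDerivWithinAt)
    (fun t _ => (abs_add_le _ _).trans (by linarith [hxu t, hFb t])) (mem_univ t) (mem_univ s)

lemma abs_taylor_le {f f' : ℝ → ℝ} {M : ℝ} (hM : 0 ≤ M) (hd : ∀ t, HasDerivAt f (f' t) t)
    (hf : ∀ s t, |f' s - f' t| ≤ M * |s - t|) (x d : ℝ) :
    |f (x + d) - f x - d * f' x| ≤ M * d ^ 2 := by
  have h := (convex_uIcc x (x + d)).norm_image_sub_le_of_norm_hasDerivWithin_le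
    (f := fun t => f t - t * f' x) (f' := fun t => f' t - f' x) (C := M * |d|)
    (fun t _ => (((hd t).sub ((hasDerivAt_id t).mul_const (f' x))).congr_deriv
      (by ring)).hasDerivWithinAt) (fun t ht => ?_) left_mem_uIcc right_mem_uIcc
  · rw [Real.norm_eq_abs, Real.norm_eq_abs, add_sub_cancel_left, mul_assoc, ← sq, sq_abs] at h
    convert h using 2
    ring
  · refine (hf t x).trans (mul_le_mul_of_nonneg_left ?_ hM)
    have := abs_sub_left_of_mem_uIcc ht
    simpa using this

/-- Berry–Esseen bound in the Wasserstein distance, for smooth test functions. -/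
lemma abs_integral_sum_sub_le_of_deriv {Ω ι : Type*} [MeasurableSpace Ω] {P : Measure Ω}
    [IsProbabilityMeasure P] [Fintype ι] [DecidableEq ι] {ξ : ι → Ω → ℝ}
    (hξ : ∀ i, Measurable (ξ i)) (hind : iIndepFun ξ P) (h3 : ∀ i, MemLp (ξ i) 3 P)
    (hmean : ∀ i, ∫ ω, ξ i ω ∂P = 0) (hvar : ∑ i, ∫ ω, ξ i ω ^ 2 ∂P = 1) {h h' : ℝ → ℝ} {L : ℝ}
    (hL : 0 ≤ L) (hd : ∀ t, HasDerivAt h (h' t) t) (hb : ∀ t, |h' t| ≤ L) :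
    |∫ ω, h (∑ i, ξ i ω) ∂P - ∫ s, h s ∂stdGauss| ≤
      8 * L * ∑ i, (∫ ω, |ξ i ω| ^ 3 ∂P + (∫ ω, |ξ i ω| ∂P) * ∫ ω, ξ i ω ^ 2 ∂P) := by
  obtain ⟨f, f', hfd, hfe, hfb, hfl⟩ := exists_stein_solution hL hd hb
  have hfc : Continuous f := continuous_iff_continuousAt.2 fun t => (hfd t).continuousAt
  have hfc' : Continuous f' := continuous_of_abs_sub_le hfl
  have i1 : ∀ i, Integrable (ξ i) P := fun i => (h3 i).integrable (by norm_num)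
  have i2 : ∀ i, Integrable (fun ω => ξ i ω ^ 2) P := fun i =>
    ((h3 i).mono_exponent (by norm_num)).integrable_sq
  have i3 : ∀ i, Integrable (fun ω => |ξ i ω| ^ 3) P := fun i =>
    (h3 i).integrable_norm_pow (by norm_num)
  set S : Ω → ℝ := fun ω => ∑ i, ξ i ω with hS
  have iS : Integrable S P := integrable_finsetSum _ fun i _ => i1 i
  have hSm : Measurable S := by fun_prop
  set R : ι → Ω → ℝ := fun i ω => ∑ j ∈ Finset.univ.erase i, ξ j ω with hR
  have iR : ∀ i, Integrable (R i) P := fun i => integrable_finsetSum _ fun j _ => i1 j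
  have hRm : ∀ i, Measurable (R i) := fun i => by fun_prop
  have hSR : ∀ i ω, S ω = R i ω + ξ i ω := fun i ω =>
    (Finset.sum_erase_add _ _ (Finset.mem_univ i)).symm
  have hindR : ∀ i, IndepFun (R i) (ξ i) P := fun i => by
    have := hind.indepFun_finsetSum_of_notMem hξ (Finset.notMem_erase i Finset.univ)
    refine this.congr (Eventually.of_forall fun ω => ?_) EventuallyEq.rfl
    simp [hR]
  have if' : ∀ {T : Ω → ℝ}, Integrable T P → Integrable (fun ω => f' (T ω)) P := fun hT =>
    integrable_comp_of_abs_sub_le hfl hT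
  have iξf : ∀ (i : ι) {T : Ω → ℝ}, Measurable T → Integrable (fun ω => ξ i ω * f (T ω)) P := by
    intro i T hT
    refine (i1 i).mul_bdd (c := 3 * L) (hfc.measurable.comp hT).aestronglyMeasurable
      (ae_of_all _ fun ω => hfb (T ω))
  have iξf' : ∀ i, Integrable (fun ω => ξ i ω ^ 2 * f' (R i ω)) P := by
    intro i
    exact ((hindR i).symm.comp (measurable_id.pow_const 2) hfc'.measurable).integrable_mul
      (i2 i) (if' (iR i))
  -- the contribution of one summand
  have hone : ∀ i, |∫ ω, ξ i ω * f (S ω) ∂P - (∫ ω, ξ i ω ^ 2 ∂P) * ∫ ω, f' (S ω) ∂P| ≤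
      8 * L * (∫ ω, |ξ i ω| ^ 3 ∂P + (∫ ω, |ξ i ω| ∂P) * ∫ ω, ξ i ω ^ 2 ∂P) := by
    intro i
    have e1 : ∫ ω, ξ i ω * f (R i ω) ∂P = 0 := by
      have := ((hindR i).symm.comp measurable_id hfc.measurable).integral_fun_mul_eq_mul_integral
        (hξ i).aestronglyMeasurable (hfc.measurable.comp (hRm i)).aestronglyMeasurable
      simp only [Function.comp_apply, id] at this
      rw [this]
      rw [hmean i, zero_mul]
    have e2 : ∫ ω, ξ i ω ^ 2 * f' (R i ω) ∂P =
        (∫ ω, ξ i ω ^ 2 ∂P) * ∫ ω, f' (R i ω) ∂P := by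
      have := ((hindR i).symm.comp (measurable_id.pow_const 2)
        hfc'.measurable).integral_fun_mul_eq_mul_integral
        ((hξ i).pow_const 2).aestronglyMeasurable
        (hfc'.measurable.comp (hRm i)).aestronglyMeasurable
      simpa only [Function.comp_apply, id] using this
    -- Leave-one-out expansion around `R i`, which is independent of `ξ i`: the zeroth-order term
    -- vanishes since `ξ i` is centred, and the first-order term factors.
    have e3 : ∫ ω, ξ i ω * (f (R i ω + ξ i ω) - f (R i ω) - ξ i ω * f' (R i ω)) ∂P =
        ∫ ω, ξ i ω * f (S ω) ∂P - (∫ ω, ξ i ω ^ 2 ∂P) * ∫ ω, f' (R i ω) ∂P := by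
      have : ∀ ω, ξ i ω * (f (R i ω + ξ i ω) - f (R i ω) - ξ i ω * f' (R i ω)) =
          ξ i ω * f (S ω) - ξ i ω * f (R i ω) - ξ i ω ^ 2 * f' (R i ω) := fun ω => by
        rw [hSR i]; ring
      simp only [this]
      rw [integral_sub (by exact (iξf i hSm).sub (iξf i (hRm i))) (iξf' i),
        integral_sub (iξf i hSm) (iξf i (hRm i)), e1, e2, sub_zero]
    have b1 : |∫ ω, ξ i ω * (f (R i ω + ξ i ω) - f (R i ω) - ξ i ω * f' (R i ω)) ∂P| ≤
        8 * L * ∫ ω, |ξ i ω| ^ 3 ∂P := by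
      rw [← integral_const_mul]
      refine abs_integral_le_of_abs_le ((i3 i).const_mul _) fun ω => ?_
      rw [abs_mul]
      have := abs_taylor_le (by linarith) hfd hfl (R i ω) (ξ i ω)
      calc _ ≤ |ξ i ω| * (8 * L * ξ i ω ^ 2) := by gcongr
        _ = _ := by rw [← sq_abs]; ring
    have b2 : |∫ ω, f' (R i ω) ∂P - ∫ ω, f' (S ω) ∂P| ≤ 8 * L * ∫ ω, |ξ i ω| ∂P := by
      rw [← integral_sub (if' (iR i)) (if' iS), ← integral_const_mul]
      refine abs_integral_le_of_abs_le ((i1 i).abs.const_mul _) fun ω => ?_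
      have := hfl (R i ω) (S ω)
      rw [hSR i, sub_add_cancel_left, abs_neg, ← hSR i] at this
      exact this
    have hv : 0 ≤ ∫ ω, ξ i ω ^ 2 ∂P := integral_nonneg fun ω => sq_nonneg _
    have e4 : ∫ ω, ξ i ω * f (S ω) ∂P - (∫ ω, ξ i ω ^ 2 ∂P) * ∫ ω, f' (S ω) ∂P =
        (∫ ω, ξ i ω * f (S ω) ∂P - (∫ ω, ξ i ω ^ 2 ∂P) * ∫ ω, f' (R i ω) ∂P) +
        (∫ ω, ξ i ω ^ 2 ∂P) * (∫ ω, f' (R i ω) ∂P - ∫ ω, f' (S ω) ∂P) := by ring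
    rw [e4, ← e3]
    refine (abs_add_le _ _).trans ?_
    rw [abs_mul, abs_of_nonneg hv]
    have := mul_le_mul_of_nonneg_left b2 hv
    linarith
  have hlip : ∀ x y, |h x - h y| ≤ L * |x - y| := fun x y =>
    convex_univ.norm_image_sub_le_of_norm_hasDerivWithin_le (f := h) (f' := h') (C := L)
      (fun t _ => (hd t).hasDerivWithinAt) (fun t _ => hb t) (mem_univ y) (mem_univ x)
  have hmain : ∫ ω, h (S ω) ∂P - ∫ s, h s ∂stdGauss =
      -∑ i, (∫ ω, ξ i ω * f (S ω) ∂P - (∫ ω, ξ i ω ^ 2 ∂P) * ∫ ω, f' (S ω) ∂P) := by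
    rw [Finset.sum_sub_distrib, ← Finset.sum_mul, hvar, one_mul,
      ← integral_finsetSum _ fun i _ => iξf i hSm]
    have e5 : ∀ ω, ∑ i, ξ i ω * f (S ω) = f' (S ω) - (h (S ω) - ∫ s, h s ∂stdGauss) := fun ω => by
      rw [← Finset.sum_mul, ← hfe (S ω)]
      simp only [hS]
      ring
    simp only [e5]
    rw [integral_sub (if' iS)
        (by exact (integrable_comp_of_abs_sub_le hlip iS).sub (integrable_const _)),
      integral_sub (integrable_comp_of_abs_sub_le hlip iS) (integrable_const _)]
    simp
  rw [hmain, abs_neg, Finset.mul_sum]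
  exact (Finset.abs_sum_le_sum_abs _ _).trans (Finset.sum_le_sum fun i _ => hone i)

end ReLUNet

namespace ReLUNet

open Filter Topology

/-! ### Passage to Lipschitz test functions and to iid means -/

/-- The average of `h` over `[x, x + ε]` is differentiable, and the difference quotient that is its
derivative inherits the bound `L`. -/
lemma exists_hasDerivAt_near {h : ℝ → ℝ} {L : ℝ} (hh : ∀ x y, |h x - h y| ≤ L * |x - y|)
    {ε : ℝ} (hε : 0 < ε) :
    ∃ g g' : ℝ → ℝ, (∀ t, HasDerivAt g (g' t) t) ∧ (∀ t, |g' t| ≤ L) ∧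
      ∀ t, |g t - h t| ≤ L * ε := by
  have hL : 0 ≤ L := by simpa using (abs_nonneg _).trans (hh 1 0)
  have hc := continuous_of_abs_sub_le hh
  set G : ℝ → ℝ := fun x => ∫ t in (0 : ℝ)..x, h t with hG
  have hGd : ∀ x, HasDerivAt G (h x) x := fun x =>
    intervalIntegral.integral_hasDerivAt_right (hc.intervalIntegrable _ _)
      (hc.stronglyMeasurableAtFilter _ _) hc.continuousAt
  refine ⟨fun x => (G (x + ε) - G x) / ε, fun x => (h (x + ε) - h x) / ε, fun x => ?_, fun x => ?_,
    fun x => ?_⟩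
  · exact (((hGd (x + ε)).comp_add_const x ε).sub (hGd x)).div_const ε
  · have := hh (x + ε) x
    rw [add_sub_cancel_left, abs_of_pos hε] at this
    rw [abs_div, abs_of_pos hε, div_le_iff₀ hε]
    exact this
  · have h1 : G (x + ε) - G x - ε * h x = ∫ t in x..(x + ε), (h t - h x) := by
      rw [intervalIntegral.integral_sub (hc.intervalIntegrable _ _) (by simp),
        intervalIntegral.integral_const, hG, add_sub_cancel_left, smul_eq_mul,
        intervalIntegral.integral_interval_sub_left (hc.intervalIntegrable _ _)
          (hc.intervalIntegrable _ _)]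
    have h2 : |∫ t in x..(x + ε), (h t - h x)| ≤ L * ε * |x + ε - x| := by
      refine intervalIntegral.norm_integral_le_of_norm_le_const (f := fun t => h t - h x)
        fun t ht => ?_
      rw [uIoc_of_le (by linarith)] at ht
      refine (hh t x).trans (mul_le_mul_of_nonneg_left ?_ hL)
      rw [abs_of_pos (by linarith [ht.1])]
      linarith [ht.2]
    rw [add_sub_cancel_left, abs_of_pos hε, ← h1] at h2
    rw [show (G (x + ε) - G x) / ε - h x = (G (x + ε) - G x - ε * h x) / ε by field_simp,
      abs_div, abs_of_pos hε, div_le_iff₀ hε]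
    exact h2

/-- Berry–Esseen bound in the Wasserstein distance. -/
lemma abs_integral_sum_sub_le {Ω ι : Type*} [MeasurableSpace Ω] {P : Measure Ω}
    [IsProbabilityMeasure P] [Fintype ι] {ξ : ι → Ω → ℝ}
    (hξ : ∀ i, Measurable (ξ i)) (hind : iIndepFun ξ P) (h3 : ∀ i, MemLp (ξ i) 3 P)
    (hmean : ∀ i, ∫ ω, ξ i ω ∂P = 0) (hvar : ∑ i, ∫ ω, ξ i ω ^ 2 ∂P = 1) {h : ℝ → ℝ} {L : ℝ}
    (hh : ∀ x y, |h x - h y| ≤ L * |x - y|) :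
    |∫ ω, h (∑ i, ξ i ω) ∂P - ∫ s, h s ∂stdGauss| ≤
      8 * L * ∑ i, (∫ ω, |ξ i ω| ^ 3 ∂P + (∫ ω, |ξ i ω| ∂P) * ∫ ω, ξ i ω ^ 2 ∂P) := by
  classical
  have hL : 0 ≤ L := by simpa using (abs_nonneg _).trans (hh 1 0)
  refine le_of_forall_pos_le_add fun δ hδ => ?_
  -- The denominator has `L + 1` because `L` may be `0`; smoothing costs `L ε` on each of the two
  -- integrals.
  set ε := δ / (2 * (L + 1)) with hε
  have hε0 : 0 < ε := by positivity
  have hLε : 2 * (L * ε) ≤ δ := by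
    have : 2 * ((L + 1) * ε) = δ := by rw [hε]; field_simp
    nlinarith
  obtain ⟨g, g', hg, hgb, hgh⟩ := exists_hasDerivAt_near hh hε0
  have hgl : ∀ x y, |g x - g y| ≤ L * |x - y| := fun x y =>
    convex_univ.norm_image_sub_le_of_norm_hasDerivWithin_le (f := g) (f' := g') (C := L)
      (fun t _ => (hg t).hasDerivWithinAt) (fun t _ => hgb t) (mem_univ y) (mem_univ x)
  have iS : Integrable (fun ω => ∑ i, ξ i ω) P :=
    integrable_finsetSum _ fun i _ => (h3 i).integrable (by norm_num)
  have hmain := abs_integral_sum_sub_le_of_deriv hξ hind h3 hmean hvar hL hg hgb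
  have c1 : |∫ ω, g (∑ i, ξ i ω) ∂P - ∫ ω, h (∑ i, ξ i ω) ∂P| ≤ L * ε := by
    rw [← integral_sub (integrable_comp_of_abs_sub_le hgl iS)
      (integrable_comp_of_abs_sub_le hh iS)]
    refine (abs_integral_le_of_abs_le (integrable_const (L * ε)) fun ω => hgh _).trans ?_
    simp
  have c2 : |∫ s, g s ∂stdGauss - ∫ s, h s ∂stdGauss| ≤ L * ε := by
    rw [← integral_sub (integrable_comp_of_abs_sub_le hgl integrable_id_stdGauss)
      (integrable_comp_of_abs_sub_le hh integrable_id_stdGauss)]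
    refine (abs_integral_le_of_abs_le (integrable_const (L * ε)) fun s => hgh s).trans ?_
    simp
  rw [abs_le] at c1 c2 hmain ⊢
  constructor <;> linarith [c1.1, c1.2, c2.1, c2.2, hmain.1, hmain.2]

/-- The mean of `n` iid variables is `O(1/n)`-close in the Wasserstein distance to the normal
variable of the same variance, when the third moment is controlled by the variance. -/
lemma abs_integral_mean_sub_le {α : Type*} [MeasurableSpace α] {ν : Measure α}
    [IsProbabilityMeasure ν] {Y : α → ℝ} (hY : Measurable Y) (h3 : MemLp Y 3 ν)
    (hmean : ∫ a, Y a ∂ν = 0) {s B : ℝ} (hs : 0 ≤ s) (hB : 0 ≤ B) (hvar : ∫ a, Y a ^ 2 ∂ν = s ^ 2)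
    (hthird : ∫ a, |Y a| ^ 3 ∂ν ≤ B * s ^ 2) {n : ℕ} (hn : 0 < n) {h : ℝ → ℝ}
    (hh : ∀ x y, |h x - h y| ≤ |x - y|) :
    |∫ ω, h ((∑ i, Y (ω i)) / n) ∂(Measure.pi fun _ : Fin n => ν) -
      ∫ z, h (s * (z / √(n : ℝ))) ∂stdGauss| ≤ 8 * (B + (1 + s ^ 2) / 2) / n := by
  have hn0 : (0 : ℝ) < n := by exact_mod_cast hn
  have hsq : 0 < √(n : ℝ) := Real.sqrt_pos.2 hn0
  have hnn : √(n : ℝ) ^ 2 = n := Real.sq_sqrt hn0.le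
  have i2 : Integrable (fun a => Y a ^ 2) ν := (h3.mono_exponent (by norm_num)).integrable_sq
  -- For `s = 0` no normalization is possible, but then `Y = 0` almost everywhere and both integrals
  -- equal `h 0`.
  rcases hs.eq_or_lt with rfl | hs
  · have hY0 : Y =ᵐ[ν] 0 := by
      have h0 : ∫ a, Y a ^ 2 ∂ν = 0 := by rw [hvar]; norm_num
      have := (integral_eq_zero_iff_of_nonneg (fun a => sq_nonneg (Y a)) i2).1 h0
      filter_upwards [this] with a ha
      exact pow_eq_zero_iff two_ne_zero |>.1 ha
    have hae : ∀ᵐ ω ∂(Measure.pi fun _ : Fin n => ν), ∀ i, Y (ω i) = 0 := by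
      rw [ae_all_iff]
      intro i
      exact (Measure.quasiMeasurePreserving_eval (fun _ : Fin n => ν) i).ae hY0
    have e1 : ∫ ω, h ((∑ i, Y (ω i)) / n) ∂(Measure.pi fun _ : Fin n => ν) = h 0 := by
      rw [integral_congr_ae (g := fun _ => h 0) (hae.mono fun ω hω => by simp [hω])]
      simp
    rw [e1]
    simp only [zero_mul, integral_const, probReal_univ, one_smul, sub_self, abs_zero]
    positivity
  have i1 : Integrable Y ν := h3.integrable (by norm_num)
  have i3 : Integrable (fun a => |Y a| ^ 3) ν := h3.integrable_norm_pow (by norm_num)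
  have hpos : 0 < s * √(n : ℝ) := by positivity
  set P := Measure.pi fun _ : Fin n => ν with hP
  set ξ : Fin n → (Fin n → α) → ℝ := fun i ω => Y (ω i) / (s * √(n : ℝ)) with hξ
  have hmp : ∀ i : Fin n, MeasurePreserving (Function.eval i) P ν := fun i =>
    measurePreserving_eval (fun _ : Fin n => ν) i
  have hcomp : ∀ (i : Fin n) {F : ℝ → ℝ}, Measurable F →
      ∫ ω, F (ξ i ω) ∂P = ∫ a, F (Y a / (s * √(n : ℝ))) ∂ν := fun i F hF => by
    rw [← (hmp i).map_eq, integral_map (hmp i).measurable.aemeasurable]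
    exact (hF.comp (hY.div_const _)).aestronglyMeasurable
  have hξm : ∀ i, Measurable (ξ i) := fun i =>
    (hY.comp (measurable_pi_apply i)).div_const _
  have hind : iIndepFun ξ P :=
    iIndepFun_pi (X := fun (_ : Fin n) a => Y a / (s * √(n : ℝ)))
      fun i => (hY.div_const _).aemeasurable
  have hξ3 : ∀ i, MemLp (ξ i) 3 P := fun i => by
    have h4 : MemLp (fun a => Y a / (s * √(n : ℝ))) 3 ν := by
      simpa only [div_eq_mul_inv] using h3.mul_const _
    exact h4.comp_measurePreserving (hmp i)
  have m1 : ∀ i, ∫ ω, ξ i ω ∂P = 0 := fun i => by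
    rw [hcomp i (F := fun x => x) measurable_id, integral_div, hmean, zero_div]
  have m2 : ∀ i, ∫ ω, ξ i ω ^ 2 ∂P = (n : ℝ)⁻¹ := fun i => by
    rw [hcomp i (F := fun x => x ^ 2) (by fun_prop)]
    simp only [div_pow]
    rw [integral_div, hvar, mul_pow, hnn]
    field_simp
  have m3 : ∀ i, ∫ ω, |ξ i ω| ^ 3 ∂P ≤ B / (s * (√(n : ℝ) * n)) := fun i => by
    rw [hcomp i (F := fun x => |x| ^ 3) (by fun_prop)]
    simp only [abs_div, div_pow]
    rw [integral_div, abs_of_pos hpos, div_le_iff₀ (by positivity)]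
    refine hthird.trans (le_of_eq ?_)
    rw [mul_pow, show √(n : ℝ) ^ 3 = √(n : ℝ) * n by rw [pow_succ, hnn]; ring]
    field_simp
  have m4 : ∀ i, ∫ ω, |ξ i ω| ∂P ≤ (1 + s ^ 2) / 2 / (s * √(n : ℝ)) := fun i => by
    rw [hcomp i (F := fun x => |x|) (by fun_prop)]
    simp only [abs_div]
    rw [integral_div, abs_of_pos hpos]
    gcongr
    calc ∫ a, |Y a| ∂ν ≤ ∫ a, (1 + Y a ^ 2) / 2 ∂ν := by
          refine integral_mono i1.abs (((integrable_const _).add i2).div_const _) fun a => ?_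
          simp only
          nlinarith [sq_nonneg (|Y a| - 1), sq_abs (Y a)]
      _ = _ := by
          rw [integral_div, integral_add (integrable_const _) i2, hvar]
          simp
  have hvar1 : ∑ i, ∫ ω, ξ i ω ^ 2 ∂P = 1 := by
    simp only [m2]
    simp [hn0.ne']
  -- The factor `s` in this Lipschitz constant cancels the single `1/s` in `m3` and in `m4`, so no
  -- lower bound on the variance is needed. The factor `1/√n` improves the rate to `1/n`.
  have hlip : ∀ x y : ℝ, |h (s * (x / √(n : ℝ))) - h (s * (y / √(n : ℝ)))| ≤
      s / √(n : ℝ) * |x - y| := fun x y => by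
    refine (hh _ _).trans (le_of_eq ?_)
    rw [show s * (x / √(n : ℝ)) - s * (y / √(n : ℝ)) = s / √(n : ℝ) * (x - y) by ring, abs_mul,
      abs_of_pos (show 0 < s / √(n : ℝ) by positivity)]
  have hmain := abs_integral_sum_sub_le hξm hind hξ3 m1 hvar1
    (h := fun x => h (s * (x / √(n : ℝ)))) hlip
  have hsum : ∀ ω : Fin n → α, s * ((∑ i, ξ i ω) / √(n : ℝ)) = (∑ i, Y (ω i)) / n := fun ω => by
    simp only [hξ]
    rw [← Finset.sum_div, div_div, mul_assoc, ← sq, hnn]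
    field_simp
  simp only [hsum] at hmain
  refine hmain.trans ?_
  calc 8 * (s / √(n : ℝ)) * ∑ i, (∫ ω, |ξ i ω| ^ 3 ∂P + (∫ ω, |ξ i ω| ∂P) * ∫ ω, ξ i ω ^ 2 ∂P)
      ≤ 8 * (s / √(n : ℝ)) * ∑ _i : Fin n, (B / (s * (√(n : ℝ) * n)) +
          (1 + s ^ 2) / 2 / (s * √(n : ℝ)) * (n : ℝ)⁻¹) := by
        refine mul_le_mul_of_nonneg_left (Finset.sum_le_sum fun i _ => ?_) (by positivity)
        rw [m2 i]
        exact add_le_add (m3 i) (mul_le_mul_of_nonneg_right (m4 i) (by positivity))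
    _ = 8 * (B + (1 + s ^ 2) / 2) / n := by
        rw [Finset.sum_const, Finset.card_univ, Fintype.card_fin, nsmul_eq_mul]
        have : √(n : ℝ) ^ 4 = n ^ 2 := by
          rw [show (4 : ℕ) = 2 * 2 from rfl, pow_mul, hnn]
        field_simp
        rw [hnn]

end ReLUNet

namespace ReLUNet

/-! ## Bounded Lipschitz test functions -/

lemma abs_le_one_of_blNorm_le {h : CorrState → ℝ} (hh : blNorm h ≤ 1) (x : CorrState) :
    |h x| ≤ 1 := by
  have h1 : ‖h x‖ₑ ≤ 1 := (le_iSup (fun x => ‖h x‖ₑ) x).trans (le_self_add.trans hh)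
  rw [← ofReal_norm, ENNReal.ofReal_le_one] at h1
  exact h1

lemma abs_sub_le_of_blNorm_le {h : CorrState → ℝ} (hh : blNorm h ≤ 1) (x y : ℝ) :
    |h (Sum.inl x) - h (Sum.inl y)| ≤ |x - y| := by
  rcases eq_or_ne x y with rfl | hxy
  · simp
  have h1 : ‖h (Sum.inl x) - h (Sum.inl y)‖ₑ / stateEDist (Sum.inl x) (Sum.inl y) ≤ 1 :=
    (le_iSup₂_of_le (f := fun (x y : CorrState) => ⨆ _ : x ≠ y, ‖h x - h y‖ₑ / stateEDist x y)
      (Sum.inl x) (Sum.inl y) (le_iSup_of_le (Sum.inl_injective.ne hxy) le_rfl)).trans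
      (le_add_self.trans hh)
  have h2 : stateEDist (Sum.inl x) (Sum.inl y) = ENNReal.ofReal |x - y| := by
    rw [← Real.dist_eq, ← edist_dist]
    rfl
  have h3 : (0 : ℝ) < |x - y| := abs_pos.2 (sub_ne_zero.2 hxy)
  rw [h2, ENNReal.div_le_iff (by simpa using sub_ne_zero.2 hxy) ENNReal.ofReal_ne_top, one_mul,
    ← ofReal_norm, ENNReal.ofReal_le_ofReal_iff h3.le] at h1
  exact h1

/-- The supremum in `dBL` ranges over arbitrary functions; the norm bound alone makes them
continuous on the real component, hence measurable. -/
lemma measurable_of_blNorm_le {h : CorrState → ℝ} (hh : blNorm h ≤ 1) : Measurable h := by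
  refine measurable_fun_sum ?_ (measurable_of_countable _)
  refine (continuous_of_abs_sub_le (L := 1) fun x y => ?_).measurable
  rw [one_mul]
  exact abs_sub_le_of_blNorm_le hh x y

/-! ## Linearization of the correlation -/

/-- Here `w` is the inverse square root of `1 + e` with `e = x + y + xy`. From `(w - 1)(w + 1) = -w²
e` and `w² ≤ 4` follows `|w - 1| ≤ 4|e|`, and `e² ≤ 9/2 (x² + y²)` gives `72 = 16 · 9/2`. The second
remainder is at most `|e||w - 1| + |xy|/2`, thus at most `(18 + 1/4)(x² + y²)`. -/
lemma abs_inv_sqrt_expansion {x y w : ℝ} (hx : |x| ≤ 1 / 2) (hy : |y| ≤ 1 / 2) (hw : 0 < w)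
    (h : w ^ 2 * ((1 + x) * (1 + y)) = 1) :
    (w - 1) ^ 2 ≤ 72 * (x ^ 2 + y ^ 2) ∧ |w - 1 + (x + y) / 2| ≤ 19 * (x ^ 2 + y ^ 2) := by
  have hx' := abs_le.1 hx
  have hy' := abs_le.1 hy
  have hw2 : w ^ 2 ≤ 4 := by
    have h1 : 1 / 4 ≤ (1 + x) * (1 + y) := by nlinarith [hx'.1, hy'.1]
    nlinarith [sq_nonneg w]
  set e := x + y + x * y with he
  have hwe : (w - 1) * (w + 1) = -(w ^ 2 * e) := by linear_combination (1 : ℝ) * h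
  have hxy : x ^ 2 * y ^ 2 ≤ (x ^ 2 + y ^ 2) / 8 := by
    have h1 : x ^ 2 ≤ 1 / 4 := by nlinarith [hx'.1, hx'.2]
    have h2 : y ^ 2 ≤ 1 / 4 := by nlinarith [hy'.1, hy'.2]
    nlinarith [sq_nonneg x, sq_nonneg y]
  have he2 : e ^ 2 ≤ 9 / 2 * (x ^ 2 + y ^ 2) := by
    nlinarith [sq_nonneg (x - y), sq_nonneg (x + y - 2 * (x * y))]
  have habs : |w - 1| ≤ 4 * |e| := by
    have h1 : |w - 1| * (w + 1) = w ^ 2 * |e| := by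
      rw [← abs_of_pos (show 0 < w + 1 by linarith), ← abs_mul, hwe, abs_neg, abs_mul,
        abs_of_nonneg (sq_nonneg w)]
    nlinarith [abs_nonneg (w - 1), abs_nonneg e]
  constructor
  · have := pow_le_pow_left₀ (abs_nonneg _) habs 2
    rw [mul_pow, sq_abs, sq_abs] at this
    linarith
  · have h1 : (w - 1 + (x + y) / 2) * (2 * (w + 1)) =
        e * ((1 - w) * (1 + 2 * w)) - x * y * (w + 1) := by
      linear_combination 2 * hwe + (w + 1) * he - (w + 1) * he
    have h2 : |w - 1 + (x + y) / 2| * (2 * (w + 1)) ≤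
        (|e| * |w - 1| + |x * y| / 2) * (2 * (w + 1)) := by
      rw [← abs_of_pos (show 0 < 2 * (w + 1) by linarith), ← abs_mul, h1]
      refine (abs_sub _ _).trans ?_
      rw [abs_mul, abs_mul, abs_mul (x * y), abs_of_pos (show 0 < 1 + 2 * w by linarith),
        abs_of_pos (show 0 < w + 1 by linarith), abs_of_pos (show 0 < 2 * (w + 1) by linarith),
        abs_sub_comm 1 w]
      nlinarith [mul_nonneg (abs_nonneg e) (abs_nonneg (w - 1))]
    have h3 := le_of_mul_le_mul_right h2 (by linarith)
    have h4 : |x * y| ≤ (x ^ 2 + y ^ 2) / 2 :=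
      abs_le.2 ⟨by nlinarith [sq_nonneg (x + y)], by nlinarith [sq_nonneg (x - y)]⟩
    have h5 : |e| * |w - 1| ≤ 4 * e ^ 2 := by
      rw [← sq_abs e]
      nlinarith [mul_le_mul_of_nonneg_left habs (abs_nonneg e)]
    nlinarith [sq_nonneg x, sq_nonneg y]

lemma abs_corr_sub_linearization_le {n : ℕ} (u v : Fin n → ℝ) {t a κ : ℝ} (ht : 0 < t)
    (ha : |a| ≤ κ) {h : CorrState → ℝ} (h1 : ∀ x, |h x| ≤ 1)
    (h2 : ∀ x y, |h (Sum.inl x) - h (Sum.inl y)| ≤ |x - y|) :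
    |h (corr u v) - h (Sum.inl (a + (t * (u ⬝ᵥ v) - a / 2 * (t * (u ⬝ᵥ u) + t * (v ⬝ᵥ v)))))| ≤
      (36 + 19 * κ) * ((t * (u ⬝ᵥ v) - a) ^ 2 + (t * (u ⬝ᵥ u) - 1) ^ 2 +
        (t * (v ⬝ᵥ v) - 1) ^ 2) := by
  have hκ : 0 ≤ κ := (abs_nonneg a).trans ha
  set A := t * (u ⬝ᵥ v) with hA
  set x := t * (u ⬝ᵥ u) - 1 with hx
  set y := t * (v ⬝ᵥ v) - 1 with hy
  have htriv : ∀ p q, |h p - h q| ≤ 2 := fun p q =>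
    (abs_sub _ _).trans (by linarith [h1 p, h1 q])
  -- If a normalized squared norm is off by more than `1/2`, the trivial bound `2` for bounded `h`
  -- is below `36 · (1/4)`. This case also covers the value `e` of the correlation.
  by_cases hx2 : |x| ≤ 1 / 2
  swap
  · have : 1 / 4 < x ^ 2 := by
      rw [← sq_abs]
      nlinarith
    refine (htriv _ _).trans ?_
    nlinarith [sq_nonneg (A - a), sq_nonneg y, mul_nonneg hκ (add_nonneg (add_nonneg
      (sq_nonneg (A - a)) (sq_nonneg x)) (sq_nonneg y))]
  by_cases hy2 : |y| ≤ 1 / 2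
  swap
  · have : 1 / 4 < y ^ 2 := by
      rw [← sq_abs]
      nlinarith
    refine (htriv _ _).trans ?_
    nlinarith [sq_nonneg (A - a), sq_nonneg x, mul_nonneg hκ (add_nonneg (add_nonneg
      (sq_nonneg (A - a)) (sq_nonneg x)) (sq_nonneg y))]
  have hx' := abs_le.1 hx2
  have hy' := abs_le.1 hy2
  have hu0 : 0 < u ⬝ᵥ u := pos_of_mul_pos_right (by linarith [hx'.1] : 0 < t * (u ⬝ᵥ u)) ht.le
  have hv0 : 0 < v ⬝ᵥ v := pos_of_mul_pos_right (by linarith [hy'.1] : 0 < t * (v ⬝ᵥ v)) ht.le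
  have hu : u ≠ 0 := by rintro rfl; simp at hu0
  have hv : v ≠ 0 := by rintro rfl; simp at hv0
  set α := √(u ⬝ᵥ u) with hα
  set β := √(v ⬝ᵥ v) with hβ
  have hα0 : 0 < α := Real.sqrt_pos.2 hu0
  have hβ0 : 0 < β := Real.sqrt_pos.2 hv0
  have hα2 : α ^ 2 = u ⬝ᵥ u := Real.sq_sqrt hu0.le
  have hβ2 : β ^ 2 = v ⬝ᵥ v := Real.sq_sqrt hv0.le
  have hcorr : corr u v = Sum.inl ((u ⬝ᵥ v) / (α * β)) := by simp [corr, hu, hv, hα, hβ]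
  set w := (t * (α * β))⁻¹ with hw
  have hw0 : 0 < w := by positivity
  have hR : (u ⬝ᵥ v) / (α * β) = A * w := by
    rw [hA, hw]
    field_simp
  have hw1 : w ^ 2 * ((1 + x) * (1 + y)) = 1 := by
    have e1 : 1 + x = t * α ^ 2 := by rw [hα2, hx]; ring
    have e2 : 1 + y = t * β ^ 2 := by rw [hβ2, hy]; ring
    rw [e1, e2, hw]
    field_simp
  obtain ⟨b1, b2⟩ := abs_inv_sqrt_expansion hx2 hy2 hw0 hw1
  rw [hcorr, hR]
  refine (h2 _ _).trans ?_
  -- The remainder is a product of two first-order deviations plus `a` times the second-order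
  -- remainder of the inverse square root.
  have e3 : A * w - (a + (A - a / 2 * (t * (u ⬝ᵥ u) + t * (v ⬝ᵥ v)))) =
      (A - a) * (w - 1) + a * (w - 1 + (x + y) / 2) := by
    rw [hx, hy]; ring
  rw [e3]
  refine (abs_add_le _ _).trans ?_
  have c1 : |(A - a) * (w - 1)| ≤ (A - a) ^ 2 + 36 * (x ^ 2 + y ^ 2) :=
    abs_le.2 ⟨by nlinarith [sq_nonneg (A - a + (w - 1)), sq_nonneg (A - a)],
      by nlinarith [sq_nonneg (A - a - (w - 1)), sq_nonneg (A - a)]⟩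
  have c2 : |a * (w - 1 + (x + y) / 2)| ≤ κ * (19 * (x ^ 2 + y ^ 2)) := by
    rw [abs_mul]
    exact mul_le_mul ha b2 (abs_nonneg _) hκ
  nlinarith [sq_nonneg (A - a), mul_nonneg hκ (sq_nonneg (A - a))]

/-! ### Fluctuations of empirical means -/

lemma integral_mean_sub_sq_le {α : Type*} [MeasurableSpace α] {ν : Measure α}
    [IsProbabilityMeasure ν] {Y : α → ℝ} (h2 : MemLp Y 2 ν) {n : ℕ} (hn : 0 < n) :
    ∫ ω, ((∑ i, Y (ω i)) / n - ∫ a, Y a ∂ν) ^ 2 ∂(Measure.pi fun _ : Fin n => ν) ≤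
      (∫ a, Y a ^ 2 ∂ν) / n := by
  have hn0 : (0 : ℝ) < n := by exact_mod_cast hn
  set P := Measure.pi fun _ : Fin n => ν with hP
  have hmp : ∀ i : Fin n, MeasurePreserving (Function.eval i) P ν := fun i =>
    measurePreserving_eval (fun _ : Fin n => ν) i
  have hYi : ∀ i : Fin n, MemLp (fun ω : Fin n → α => Y (ω i)) 2 P := fun i =>
    h2.comp_measurePreserving (hmp i)
  set T : (Fin n → α) → ℝ := ∑ i, fun ω : Fin n → α => Y (ω i) with hT
  have hTa : ∀ ω, T ω = ∑ i, Y (ω i) := fun ω => by simp [hT]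
  have hTm : MemLp T 2 P := memLp_finsetSum' _ fun i _ => hYi i
  have hmean : ∫ ω, T ω ∂P = n * ∫ a, Y a ∂ν := by
    simp only [hTa]
    rw [integral_finsetSum _ fun i _ => (hYi i).integrable (by norm_num)]
    have : ∀ i : Fin n, ∫ ω, Y (ω i) ∂P = ∫ a, Y a ∂ν := fun i => by
      have h := integral_map (μ := P) (φ := Function.eval i) (f := Y)
        (hmp i).measurable.aemeasurable (by rw [(hmp i).map_eq]; exact h2.1)
      rw [(hmp i).map_eq] at h
      exact h.symm
    simp [this]
  have hvar : Var[T; P] = n * Var[Y; ν] := by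
    rw [hT, variance_sum_pi fun _ => h2]
    simp
  have hV : Var[T; P] = ∫ ω, (T ω - n * ∫ a, Y a ∂ν) ^ 2 ∂P := by
    rw [variance_eq_integral hTm.1.aemeasurable, hmean]
  have hle : Var[Y; ν] ≤ ∫ a, Y a ^ 2 ∂ν := by
    refine (variance_le_expectation_sq h2.1).trans (le_of_eq ?_)
    simp
  have e1 : ∀ ω : Fin n → α, ((∑ i, Y (ω i)) / n - ∫ a, Y a ∂ν) ^ 2 =
      (T ω - n * ∫ a, Y a ∂ν) ^ 2 / (n : ℝ) ^ 2 := fun ω => by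
    rw [hTa]
    field_simp
  simp only [e1]
  rw [integral_div, ← hV, hvar, div_le_div_iff₀ (by positivity) hn0]
  nlinarith [mul_le_mul_of_nonneg_left hle (sq_nonneg (n : ℝ))]

end ReLUNet

namespace ReLUNet

/-! ## Comparison of the two kernels -/

lemma memLp_corrLin {sp sm : ℝ} (hs : sp ≠ 0 ∨ sm ≠ 0) {ρ : ℝ} (hρ : ρ ∈ Icc (-1 : ℝ) 1) :
    MemLp (corrLin sp sm ρ) 3 (stdGauss.prod stdGauss) := by
  have hm := (measurable_corrLin sp sm ρ).aestronglyMeasurable (μ := stdGauss.prod stdGauss)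
  rw [← integrable_norm_rpow_iff hm (by norm_num) (by norm_num)]
  simpa using integrable_abs_corrLin_pow_three hs hρ

lemma sigmaSqReLU_le {sp sm : ℝ} (hs : sp ≠ 0 ∨ sm ≠ 0) {ρ : ℝ} (hρ : ρ ∈ Icc (-1 : ℝ) 1) :
    sigmaSqReLU sp sm ρ ≤ 8 * corrLinBound sp sm ^ 2 := by
  rw [← integral_corrLin_sq hs hρ]
  have h := abs_integral_le_of_abs_le_normSq_pow (f := fun y => corrLin sp sm ρ y ^ 2)
    (C := corrLinBound sp sm ^ 2) (k := 2) fun y => by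
      rw [abs_pow, ← mul_pow]
      exact pow_le_pow_left₀ (abs_nonneg _) (abs_corrLin_le hs hρ y) 2
  refine (le_abs_self _).trans (h.trans (le_of_eq ?_))
  simp only [Nat.factorial]
  push_cast
  ring

/-- A bound of the drift coefficient on `[-1, 1]`. -/
noncomputable def muBound (sp sm : ℝ) : ℝ :=
  normConst sp sm / 4 * (2 * (|sp| + |sm|) ^ 2 *
    (normConst sp sm ^ 2 * (8 * (|sp| + |sm|) ^ 4) + 3 * |M2 sp sm| + 3) +
      4 * normConst sp sm * (8 * (|sp| + |sm|) ^ 4))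

lemma abs_muReLU_le {sp sm : ℝ} (hs : sp ≠ 0 ∨ sm ≠ 0) {ρ : ℝ} (hρ : ρ ∈ Icc (-1 : ℝ) 1) :
    |muReLU sp sm ρ| ≤ muBound sp sm := by
  have hc := normConst_pos hs
  have h11 := abs_K_le sp sm (p := 1) (r := 1) (k := 1) rfl hρ
  have h22 := abs_K_le sp sm (p := 2) (r := 2) (k := 2) rfl hρ
  have h31 := abs_K_le sp sm (p := 3) (r := 1) (k := 2) rfl hρ
  norm_num [Nat.factorial] at h11 h22 h31
  unfold muReLU muBound
  set c := normConst sp sm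
  set S := |sp| + |sm|
  rw [abs_mul, abs_of_pos (show 0 < c / 4 by positivity)]
  refine mul_le_mul_of_nonneg_left ?_ (by positivity)
  refine (abs_sub _ _).trans (add_le_add ?_ ?_)
  · rw [abs_mul]
    refine mul_le_mul (by linarith) ?_ (abs_nonneg _) (by positivity)
    refine (abs_add_le _ _).trans (add_le_add ((abs_add_le _ _).trans (add_le_add ?_ ?_)) ?_)
    · rw [abs_mul, abs_of_pos (show 0 < c ^ 2 by positivity)]
      refine mul_le_mul_of_nonneg_left (by linarith) (by positivity)
    · rw [abs_mul, abs_of_pos (show (0 : ℝ) < 3 by norm_num)]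
    · norm_num
  · rw [abs_mul, abs_of_pos (show 0 < 4 * c by positivity)]
    refine mul_le_mul_of_nonneg_left (by linarith) (by positivity)

/-- The joint empirical second moments of a layer concentrate around their means. -/
lemma integral_empirical_sub_sq_le (sp sm : ℝ) (c : ℝ) {p r : ℕ} (hk : p + r = 2) {ρ : ℝ}
    (hρ : ρ ∈ Icc (-1 : ℝ) 1) {n : ℕ} (hn : 0 < n) {m : ℝ} (hm : c * K sp sm p r ρ = m) :
    Integrable (fun ω : Fin n → ℝ × ℝ => (c / n * ∑ i, act sp sm (ω i).1 ^ p *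
        act sp sm (ρ * (ω i).1 + √(1 - ρ ^ 2) * (ω i).2) ^ r - m) ^ 2)
        (Measure.pi fun _ => stdGauss.prod stdGauss) ∧
    ∫ ω : Fin n → ℝ × ℝ, (c / n * ∑ i, act sp sm (ω i).1 ^ p *
        act sp sm (ρ * (ω i).1 + √(1 - ρ ^ 2) * (ω i).2) ^ r - m) ^ 2
        ∂(Measure.pi fun _ => stdGauss.prod stdGauss) ≤
      8 * c ^ 2 * (|sp| + |sm|) ^ 4 / n := by
  have hact := measurable_act sp sm
  set Y : ℝ × ℝ → ℝ := fun y => c * (act sp sm y.1 ^ p *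
    act sp sm (ρ * y.1 + √(1 - ρ ^ 2) * y.2) ^ r) with hY
  have hYm : Measurable Y := by fun_prop
  have hb : ∀ y : ℝ × ℝ, |Y y ^ 2| ≤
      c ^ 2 * (|sp| + |sm|) ^ 4 * (y.1 ^ 2 + y.2 ^ 2) ^ 2 := fun y => by
    have h := abs_act_mul_le sp sm (k := 1) (by omega : p + r = 2 * 1) hρ y
    simp only [hY]
    rw [mul_pow, abs_mul, abs_pow, abs_pow, sq_abs, mul_assoc]
    refine mul_le_mul_of_nonneg_left ?_ (sq_nonneg c)
    refine (pow_le_pow_left₀ (abs_nonneg _) h 2).trans (le_of_eq ?_)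
    ring
  have hY2 : MemLp Y 2 (stdGauss.prod stdGauss) :=
    (memLp_two_iff_integrable_sq hYm.aestronglyMeasurable).2
      (integrable_of_abs_le_normSq_pow (hYm.pow_const 2) hb)
  have hmean : ∫ y, Y y ∂(stdGauss.prod stdGauss) = m := by
    rw [← hm]
    exact integral_const_mul _ _
  have hsq := abs_integral_le_of_abs_le_normSq_pow hb
  have e : ∀ ω : Fin n → ℝ × ℝ, c / n * ∑ i, act sp sm (ω i).1 ^ p *
      act sp sm (ρ * (ω i).1 + √(1 - ρ ^ 2) * (ω i).2) ^ r = (∑ i, Y (ω i)) / n := fun ω => by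
    simp only [hY]
    rw [← Finset.mul_sum]
    ring
  simp only [e]
  constructor
  · have h1 : MemLp (fun ω : Fin n → ℝ × ℝ => ∑ i, Y (ω i)) 2
        (Measure.pi fun _ => stdGauss.prod stdGauss) :=
      memLp_finsetSum _ fun i _ =>
        hY2.comp_measurePreserving (measurePreserving_eval (fun _ : Fin n => _) i)
    have h2 : MemLp (fun ω : Fin n → ℝ × ℝ => (∑ i, Y (ω i)) / n - m) 2
        (Measure.pi fun _ => stdGauss.prod stdGauss) := by
      refine MemLp.sub ?_ (memLp_const m)
      simpa only [div_eq_mul_inv] using h1.mul_const _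
    exact h2.integrable_sq
  · have h := integral_mean_sub_sq_le hY2 hn
    rw [hmean] at h
    refine h.trans (div_le_div_of_nonneg_right ?_ (Nat.cast_nonneg n))
    refine (le_abs_self _).trans (hsq.trans (le_of_eq ?_))
    simp only [Nat.factorial]
    push_cast
    ring

/-- A pair of Gaussian vectors is regrouped as a vector of Gaussian pairs, so that the neurons
become iid coordinates of one product measure. -/
lemma integral_corrKernel_inl (sp sm : ℝ) (n : ℕ) (ρ : ℝ) {h : CorrState → ℝ}
    (hh : Measurable h) :
    ∫ x, h x ∂(corrKernel sp sm n (Sum.inl ρ)) =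
      ∫ ω : Fin n → ℝ × ℝ, h (corr (fun i => act sp sm (ω i).1)
        (fun i => act sp sm (ρ * (ω i).1 + √(1 - ρ ^ 2) * (ω i).2)))
        ∂(Measure.pi fun _ => stdGauss.prod stdGauss) := by
  have hstep : Measurable (corrStep sp sm n ρ) :=
    (measurable_corrStep sp sm n).comp measurable_prodMk_left
  have hmp := measurePreserving_arrowProdEquivProdArrow ℝ ℝ (Fin n) (fun _ => stdGauss)
    (fun _ => stdGauss)
  have e : corrKernel sp sm n (Sum.inl ρ) =
      ((stdGaussVec n).prod (stdGaussVec n)).map (corrStep sp sm n ρ) := rfl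
  rw [e, integral_map hstep.aemeasurable hh.aestronglyMeasurable, ← hmp.map_eq]
  exact integral_map hmp.measurable.aemeasurable (hh.comp hstep).aestronglyMeasurable

lemma measurable_inl_approxStepReal (sp sm : ℝ) (n : ℕ) (ρ : ℝ) :
    Measurable fun z => (Sum.inl (approxStepReal sp sm n ρ z) : CorrState) := by
  have h : Measurable (approxStepReal sp sm n ρ) :=
    (measurable_approxStepReal sp sm n).of_uncurry_left
  exact measurable_inl.comp h

lemma integral_approxKernel_inl (sp sm : ℝ) (n : ℕ) (ρ : ℝ) {h : CorrState → ℝ}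
    (hh : Measurable h) :
    ∫ x, h x ∂(approxKernel sp sm n (Sum.inl ρ)) =
      ∫ z, h (Sum.inl (approxStepReal sp sm n ρ z)) ∂stdGauss := by
  have hstep := measurable_inl_approxStepReal sp sm n ρ
  have e : approxKernel sp sm n (Sum.inl ρ) =
      stdGauss.map fun z => (Sum.inl (approxStepReal sp sm n ρ z) : CorrState) := rfl
  rw [e, integral_map hstep.aemeasurable hh.aestronglyMeasurable]

/-- The constant of the comparison of the two kernels. -/
noncomputable def kernelBound (sp sm : ℝ) : ℝ :=
  (36 + 19 * (2 * normConst sp sm * (|sp| + |sm|) ^ 2)) *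
      (24 * normConst sp sm ^ 2 * (|sp| + |sm|) ^ 4) +
    8 * (6 * corrLinBound sp sm + (1 + 8 * corrLinBound sp sm ^ 2) / 2) + muBound sp sm

lemma integrable_comp_of_abs_le_one {h : CorrState → ℝ} (hhm : Measurable h)
    (hh1 : ∀ x, |h x| ≤ 1) {Ω : Type*} [MeasurableSpace Ω] (Q : Measure Ω)
    [IsProbabilityMeasure Q] {T : Ω → CorrState} (hT : Measurable T) :
    Integrable (fun ω => h (T ω)) Q :=
  Integrable.of_bound (hhm.comp hT).aestronglyMeasurable 1 (ae_of_all _ fun _ => hh1 _)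

lemma sum_corrLin_div (sp sm ρ : ℝ) {n : ℕ} (ω : Fin n → ℝ × ℝ) :
    (∑ i, corrLin sp sm ρ (ω i)) / n =
      normConst sp sm / n * ∑ i, act sp sm (ω i).1 *
          act sp sm (ρ * (ω i).1 + √(1 - ρ ^ 2) * (ω i).2) -
        normConst sp sm * K sp sm 1 1 ρ / 2 *
          (normConst sp sm / n * ∑ i, act sp sm (ω i).1 ^ 2 +
            normConst sp sm / n *
              ∑ i, act sp sm (ρ * (ω i).1 + √(1 - ρ ^ 2) * (ω i).2) ^ 2) := by
  simp only [corrLin]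
  rw [Finset.sum_sub_distrib, ← Finset.mul_sum, ← Finset.mul_sum, Finset.sum_add_distrib,
    ← Finset.mul_sum, ← Finset.mul_sum]
  ring

/-- Replacing the correlation by its linearization around the mean costs `O(1/n)`. -/
lemma abs_integral_corr_sub_linearization_le {sp sm : ℝ} (hs : sp ≠ 0 ∨ sm ≠ 0) {n : ℕ}
    (hn : 0 < n) {ρ : ℝ} (hρ : ρ ∈ Icc (-1 : ℝ) 1) {h : CorrState → ℝ} (hhm : Measurable h)
    (hh1 : ∀ x, |h x| ≤ 1)
    (hh2 : ∀ x y : ℝ, |h (Sum.inl x) - h (Sum.inl y)| ≤ |x - y|) :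
    |∫ ω : Fin n → ℝ × ℝ, h (corr (fun i => act sp sm (ω i).1)
        (fun i => act sp sm (ρ * (ω i).1 + √(1 - ρ ^ 2) * (ω i).2)))
        ∂(Measure.pi fun _ => stdGauss.prod stdGauss) -
      ∫ ω : Fin n → ℝ × ℝ, h (Sum.inl (normConst sp sm * K sp sm 1 1 ρ +
        (∑ i, corrLin sp sm ρ (ω i)) / n)) ∂(Measure.pi fun _ => stdGauss.prod stdGauss)| ≤
      (36 + 19 * (2 * normConst sp sm * (|sp| + |sm|) ^ 2)) *
        (24 * normConst sp sm ^ 2 * (|sp| + |sm|) ^ 4) / n := by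
  have hn0 : (0 : ℝ) < n := by exact_mod_cast hn
  have hact := measurable_act sp sm
  have hc := normConst_pos hs
  have hcE := normConst_mul_integral hs
  have hK1 := abs_K_le sp sm (p := 1) (r := 1) (k := 1) rfl hρ
  have haκ : |normConst sp sm * K sp sm 1 1 ρ| ≤ 2 * normConst sp sm * (|sp| + |sm|) ^ 2 := by
    norm_num [Nat.factorial] at hK1
    rw [abs_mul, abs_of_pos hc]
    nlinarith
  -- Three empirical moments concentrate, with means `cK₁`, `1`, `1`. Each contributes `8 = E (g² +
  -- w²)²` to the final constant, whence `24`.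
  obtain ⟨iA, bA⟩ := integral_empirical_sub_sq_le sp sm (normConst sp sm) (p := 1) (r := 1) rfl
    hρ hn rfl
  obtain ⟨iB, bB⟩ := integral_empirical_sub_sq_le sp sm (normConst sp sm) (p := 2) (r := 0) rfl
    hρ hn (m := 1) (by rw [K_zero_right, hcE])
  obtain ⟨iC, bC⟩ := integral_empirical_sub_sq_le sp sm (normConst sp sm) (p := 0) (r := 2) rfl
    hρ hn (m := 1) (by rw [K_comm _ _ _ _ hρ, K_zero_right, hcE])
  simp only [pow_one, pow_zero, one_mul, mul_one] at iA bA iB bB iC bC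
  have hlin : ∀ ω : Fin n → ℝ × ℝ,
      |h (corr (fun i => act sp sm (ω i).1)
        (fun i => act sp sm (ρ * (ω i).1 + √(1 - ρ ^ 2) * (ω i).2))) -
        h (Sum.inl (normConst sp sm * K sp sm 1 1 ρ + (∑ i, corrLin sp sm ρ (ω i)) / n))| ≤
      (36 + 19 * (2 * normConst sp sm * (|sp| + |sm|) ^ 2)) *
        (((normConst sp sm / n * ∑ i, act sp sm (ω i).1 *
            act sp sm (ρ * (ω i).1 + √(1 - ρ ^ 2) * (ω i).2) -
              normConst sp sm * K sp sm 1 1 ρ) ^ 2 +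
          (normConst sp sm / n * ∑ i, act sp sm (ω i).1 ^ 2 - 1) ^ 2) +
          (normConst sp sm / n *
            ∑ i, act sp sm (ρ * (ω i).1 + √(1 - ρ ^ 2) * (ω i).2) ^ 2 - 1) ^ 2) := by
    intro ω
    have h0 := abs_corr_sub_linearization_le (fun i => act sp sm (ω i).1)
      (fun i => act sp sm (ρ * (ω i).1 + √(1 - ρ ^ 2) * (ω i).2)) (t := normConst sp sm / n)
      (by positivity) haκ hh1 hh2
    simp only [dotProduct, ← sq] at h0
    rw [sum_corrLin_div]
    exact h0
  have hLm : Measurable fun ω : Fin n → ℝ × ℝ => (∑ i, corrLin sp sm ρ (ω i)) / n := by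
    have := measurable_corrLin sp sm ρ
    fun_prop
  have hcm : Measurable fun ω : Fin n → ℝ × ℝ => corr (fun i => act sp sm (ω i).1)
      (fun i => act sp sm (ρ * (ω i).1 + √(1 - ρ ^ 2) * (ω i).2)) :=
    measurable_corr.comp (f := fun ω : Fin n → ℝ × ℝ => ((fun i => act sp sm (ω i).1),
      (fun i => act sp sm (ρ * (ω i).1 + √(1 - ρ ^ 2) * (ω i).2)))) (by fun_prop)
  have hLs : Measurable fun ω : Fin n → ℝ × ℝ => (Sum.inl (normConst sp sm * K sp sm 1 1 ρ +
      (∑ i, corrLin sp sm ρ (ω i)) / n) : CorrState) :=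
    measurable_inl.comp (hLm.const_add _)
  rw [← integral_sub (integrable_comp_of_abs_le_one hhm hh1 _ hcm)
    (integrable_comp_of_abs_le_one hhm hh1 _ hLs)]
  refine (abs_integral_le_of_abs_le (((iA.add iB).add iC).const_mul _) hlin).trans ?_
  simp only [Pi.add_apply]
  rw [integral_const_mul, integral_add (by exact iA.add iB) iC, integral_add iA iB,
    mul_div_assoc]
  refine mul_le_mul_of_nonneg_left ?_ (by positivity)
  refine (add_le_add (add_le_add bA bB) bC).trans (le_of_eq ?_)
  ring

/-- Dropping the drift costs `O(1/n)`. -/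
lemma abs_integral_drift_le {sp sm : ℝ} (hs : sp ≠ 0 ∨ sm ≠ 0) {n : ℕ} (hn : 0 < n) {ρ : ℝ}
    (hρ : ρ ∈ Icc (-1 : ℝ) 1) {h : CorrState → ℝ} (hhm : Measurable h)
    (hh1 : ∀ x, |h x| ≤ 1)
    (hh2 : ∀ x y : ℝ, |h (Sum.inl x) - h (Sum.inl y)| ≤ |x - y|) :
    |∫ z, h (Sum.inl (normConst sp sm * K sp sm 1 1 ρ +
        sigmaReLU sp sm ρ * (z / √(n : ℝ)))) ∂stdGauss -
      ∫ z, h (Sum.inl (approxStepReal sp sm n ρ z)) ∂stdGauss| ≤ muBound sp sm / n := by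
  have hn0 : (0 : ℝ) < n := by exact_mod_cast hn
  have hz1 : Measurable fun z : ℝ => (Sum.inl (normConst sp sm * K sp sm 1 1 ρ +
      sigmaReLU sp sm ρ * (z / √(n : ℝ))) : CorrState) := measurable_inl.comp (by fun_prop)
  have hz2 := measurable_inl_approxStepReal sp sm n ρ
  rw [← integral_sub (integrable_comp_of_abs_le_one hhm hh1 _ hz1)
    (integrable_comp_of_abs_le_one hhm hh1 _ hz2)]
  refine (abs_integral_le_of_abs_le (integrable_const (muBound sp sm / n)) fun z => ?_).trans
    (by simp)
  refine (hh2 _ _).trans ?_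
  unfold approxStepReal
  rw [show ∀ a b d : ℝ, a + d - (a + b + d) = -b from fun a b d => by ring, abs_neg, abs_div,
    abs_of_pos hn0]
  exact div_le_div_of_nonneg_right (abs_muReLU_le hs hρ) hn0.le

/-- Two intermediate laws link the kernels: the linearized correlation, and the Gaussian with its
mean and variance. The three gaps are the linearization, the normal approximation and the drift,
each `O(1/n)`. -/
lemma integral_sub_integral_le {sp sm : ℝ} (hs : sp ≠ 0 ∨ sm ≠ 0) {n : ℕ} (hn : 0 < n) {ρ : ℝ}
    (hρ : ρ ∈ Icc (-1 : ℝ) 1) {h : CorrState → ℝ} (hh : blNorm h ≤ 1) :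
    ∫ x, h x ∂(corrKernel sp sm n (Sum.inl ρ)) - ∫ x, h x ∂(approxKernel sp sm n (Sum.inl ρ)) ≤
      kernelBound sp sm / n := by
  have hhm := measurable_of_blNorm_le hh
  have hh1 := abs_le_one_of_blNorm_le hh
  have hh2 := abs_sub_le_of_blNorm_le hh
  have hBL := corrLinBound_nonneg hs
  rw [integral_corrKernel_inl _ _ _ _ hhm, integral_approxKernel_inl _ _ _ _ hhm]
  unfold kernelBound
  have step1 := abs_integral_corr_sub_linearization_le hs hn hρ hhm hh1 hh2
  have hσ : sigmaReLU sp sm ρ ^ 2 = sigmaSqReLU sp sm ρ := Real.sq_sqrt (sigmaSqReLU_nonneg hs hρ)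
  have step2 := abs_integral_mean_sub_le (measurable_corrLin sp sm ρ) (memLp_corrLin hs hρ)
    (integral_corrLin hs hρ) (s := sigmaReLU sp sm ρ) (B := 6 * corrLinBound sp sm)
    (Real.sqrt_nonneg _) (by positivity) (by rw [hσ]; exact integral_corrLin_sq hs hρ)
    (by rw [hσ]; exact integral_abs_corrLin_pow_three_le hs hρ) hn
    (h := fun x => h (Sum.inl (normConst sp sm * K sp sm 1 1 ρ + x))) fun x y => by
      simpa using hh2 (normConst sp sm * K sp sm 1 1 ρ + x) (normConst sp sm * K sp sm 1 1 ρ + y)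
  rw [hσ] at step2
  have hσle : 8 * (6 * corrLinBound sp sm + (1 + sigmaSqReLU sp sm ρ) / 2) / n ≤
      8 * (6 * corrLinBound sp sm + (1 + 8 * corrLinBound sp sm ^ 2) / 2) / n := by
    have := sigmaSqReLU_le hs hρ
    gcongr
  have step3 := abs_integral_drift_le hs hn hρ hhm hh1 hh2
  rw [add_div, add_div]
  have s1 := (abs_le.1 step1).2
  have s2 := (abs_le.1 step2).2
  have s3 := (abs_le.1 step3).2
  linarith

lemma dBL_corrKernel_approxKernel_le {sp sm : ℝ} (hs : sp ≠ 0 ∨ sm ≠ 0) {n : ℕ} (hn : 0 < n)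
    {x : CorrState} (hx : x ∈ corrValues) :
    dBL (corrKernel sp sm n x) (approxKernel sp sm n x) ≤
      ENNReal.ofReal (kernelBound sp sm / n) := by
  refine iSup₂_le fun h hh => ?_
  rcases hx with rfl | ⟨ρ, hρ, rfl⟩
  · have e : corrKernel sp sm n (Sum.inr ()) = approxKernel sp sm n (Sum.inr ()) := rfl
    rw [e, sub_self, ENNReal.ofReal_zero]
    exact zero_le
  · exact ENNReal.ofReal_le_ofReal (integral_sub_integral_le hs hn hρ hh)

end ReLUNet

/-! ### The main theorem -/

theorem mainTheorem8 (sp sm : ℝ) (hs : sp ≠ 0 ∨ sm ≠ 0) :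
    -- the explicit values of the constants and of the moments
    (normConst sp sm = 2 / (sp ^ 2 + sm ^ 2) ∧
      (∫ g, act sp sm g ^ 4 ∂stdGauss) = 3 / 2 * (sp ^ 4 + sm ^ 4) ∧
      M2 sp sm = normConst sp sm ^ 2 * (∫ g, act sp sm g ^ 4 ∂stdGauss) - 1 ∧
      ∀ ρ ∈ Set.Icc (-1 : ℝ) 1,
        K sp sm 1 1 ρ = (sp ^ 2 + sm ^ 2) * J 1 1 ρ - 2 * sp * sm * J 1 1 (-ρ) ∧
        K sp sm 2 2 ρ = (sp ^ 4 + sm ^ 4) * J 2 2 ρ + 2 * sp ^ 2 * sm ^ 2 * J 2 2 (-ρ) ∧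
        K sp sm 3 1 ρ =
          (sp ^ 4 + sm ^ 4) * J 3 1 ρ - sp * sm * (sp ^ 2 + sm ^ 2) * J 3 1 (-ρ) ∧
        J 1 1 ρ = (√(1 - ρ ^ 2) + ρ * Real.arccos (-ρ)) / (2 * Real.pi) ∧
        J 2 2 ρ =
          (3 * ρ * √(1 - ρ ^ 2) + Real.arccos (-ρ) * (1 + 2 * ρ ^ 2)) / (2 * Real.pi) ∧
        J 3 1 ρ =
          (√(1 - ρ ^ 2) * (2 + ρ ^ 2) + 3 * Real.arccos (-ρ) * ρ) / (2 * Real.pi) ∧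
        0 ≤ sigmaSqReLU sp sm ρ) ∧
    -- `corrKernel` is the transition kernel of the correlation chain of the network
    (∀ (n nin m : ℕ), 0 < n → ∀ (Ω : Type*) [MeasurableSpace Ω] (μ : Measure Ω)
      [IsProbabilityMeasure μ] (w : WeightIdx nin n → Ω → ℝ), IsStdGaussianFamily μ w →
      ∀ (x : Fin m → Fin nin → ℝ) (α β : Fin m),
        IsMarkovChain μ (history fun k ω γ => netPre sp sm w (x γ) k ω)
          (netCorr sp sm w (x α) (x β)) (corrKernel sp sm n)) ∧
    -- `approxKernel` is the transition kernel of the approximate chain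
    (∀ n : ℕ, 0 < n → ∀ (Ω : Type*) [MeasurableSpace Ω] (μ : Measure Ω)
      [IsProbabilityMeasure μ] (p₀ : Ω → CorrState) (z : ℕ → Ω → ℝ), Measurable p₀ →
      IsStdGaussianFamily μ z → IndepFun p₀ (fun ω k => z k ω) μ →
        IsMarkovChain μ (history (approxChain sp sm n p₀ z)) (approxChain sp sm n p₀ z)
          (approxKernel sp sm n)) ∧
    -- the two kernels are `O(1/n)` apart
    (∃ C : ℝ, ∀ n : ℕ, 0 < n → ∀ x ∈ corrValues,
      dBL (corrKernel sp sm n x) (approxKernel sp sm n x) ≤ ENNReal.ofReal (C / n)) := by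
  refine ⟨⟨normConst_eq sp sm, integral_act_pow_four sp sm, M2_eq hs, fun ρ hρ => ⟨?_, ?_, ?_,
    J_one_one hρ, J_two_two hρ, J_three_one hρ, sigmaSqReLU_nonneg hs hρ⟩⟩, ?_, ?_, ?_⟩
  · rw [K_eq_J sp sm one_ne_zero one_ne_zero (k := 1) rfl hρ]
    ring
  · rw [K_eq_J sp sm two_ne_zero two_ne_zero (k := 2) rfl hρ]
    ring
  · rw [K_eq_J sp sm three_ne_zero one_ne_zero (k := 2) rfl hρ]
    ring
  · intro n nin m hn Ω _ μ _ w hw x α β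
    exact isMarkovChain_netCorr sp sm (normConst_pos hs) hn μ w hw x α β
  · intro n _ Ω _ μ _ p₀ z hp hz hind
    exact isMarkovChain_approxChain sp sm n μ p₀ z hp hz hind
  · exact ⟨kernelBound sp sm, fun n hn x hx => dBL_corrKernel_approxKernel_le hs hn hx⟩
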